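/- **Funnels.** A funnel $F$ is a simple polygon (a closed region of the plane) whose boundary consists of a base edge $l_1r_1$ and of two polygonal chains $\mathcal L=(l_1,\dots,l_k)$ and $\mathcal R=(r_1,\dots,r_m)$, $k,m\ge 2$, which end in a common vertex $l_k=r_m=\alpha$, the apex, such that $l_1,r_1,\alpha$ are convex vertices and all other vertices are reflex (interior angle strictly larger than $\pi$). Place $F$ with the base at the bottom and $l_1$ on the left; then both chains go strictly upwards. Two points of $F$ see each other if the segment between them is contained in $F$. A vertex guard set is a set of vertices of $F$ such that every point of $F$ is seen by a vertex of the set. **Upper segments.** For $i<k$ let $p$ be the point where the ray from $l_i$ through $l_{i+1}$ meets $\mathcal R$, and let $\mathrm{up}(l_i)=\overline{l_{i+1}p}$; define $\mathrm{up}(r_j)$, $j<m$, symmetrically, and let $\mathrm{up}(\alpha)=\{\alpha\}$. For an inner point $u$ of an edge $\overline{l_il_{i+1}}$ let $\mathrm{up}(u)=\mathrm{up}(l_i)$, and symmetrically on $\mathcal R$. If $\mathrm{up}(l_i)=\overline{l_{i+1}p}$ and $\mathrm{up}(r_j)=\overline{r_{j+1}q}$ intersect in a point $t$, let $\mathrm{up}(l_i,r_j)=\overline{qt}\cup\overline{tp}$;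 otherwise let $\mathrm{up}(l_i,r_j)$ be the upper one of the two segments. **Algorithm.** Input: the chains $\mathcal L$, $\mathcal R$. Build a weighted digraph $G$, initially with the dummy vertices $x,y$, where $\mathrm{up}(x)=\overline{l_1r_1}$, and start with $S=\{x\}$. While $S\neq\emptyset$, remove an arbitrary $t$ from $S$, let $s=\mathrm{up}(t)$, and let $q$ and $p$ be the ends of $s$ on $\mathcal L$ and $\mathcal R$. Let $i,j$ be the largest indices such that $l_i$, $r_j$ are not above $q$, $p$, respectively. Let $i'=i+1$ if $l_{i+1}$ sees the whole of $s$ and $i'=i$ otherwise, and define $j'$ symmetrically. Let $i''$ be the largest index such that $l_{i''}$ is strictly below $\mathrm{up}(p)$, and $j''$ the largest index such that $r_{j''}$ is strictly below $\mathrm{up}(q)$. For each $z\in\{l_{i'},r_{j'},(l_{i''},r_{j''})\}$ add the edge $(t,z)$, of weight $2$ if $z$ is the pair and of weight $1$ otherwise; if $\alpha\in\mathrm{up}(z)$, add the edge $(z,y)$ of weight $0$, and otherwise put $z$ into $S$ unless $z$ was already in $G$. Finally find a shortest weighted $x$–$y$ path in $G$ and output the set of all guards listed in its vertices other than $x,y$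 (a pair contributes both of its guards). **Theorem.** There is a polynomial $P\in\mathbb N_0[X]$ such that on every funnel $F$ with chains of $k$ and $m$ vertices, and for all choices of $t$ in the loop, the algorithm terminates after fewer than $P(k+m)$ elementary operations (exact arithmetic and comparisons of real numbers, and list and index operations, each of unit cost), and it outputs a vertex guard set of $F$. If moreover no vertex other than $\alpha$ lies on the line through an edge of the opposite chain (in particular, if no three vertices are collinear), then the output has minimum size among all vertex guard sets of $F$. -/

import Mathlib

noncomputable section

namespace FunnelGuarding

/-! ### Polygons, visibility, funnels -/

/-- Points of the Euclidean plane. -/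
abbrev Pt : Type := ℝ × ℝ

/-- Twice the signed area of the triangle `a b c`: positive iff `a, b, c` make a left turn. -/
def cross (a b c : Pt) : ℝ :=
  (b.1 - a.1) * (c.2 - a.2) - (b.2 - a.2) * (c.1 - a.1)

/-- The `i`-th vertex of a chain, counted from `0`. -/
def vtx (C : List Pt) (i : ℕ) : Pt := C.getD i 0

/-- The height of `p` above the line through the base edge `l₁ r₁` of a polygon with chains
`L` and `R`, scaled by the length of the base. -/
def height (L R : List Pt) (p : Pt) : ℝ := cross (vtx L 0) (vtx R 0) p

/-- The edges of a polygonal chain, as a point set. -/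
def chainCurve (C : List Pt) : Set Pt :=
  {x | ∃ i, i + 1 < C.length ∧ x ∈ segment ℝ (vtx C i) (vtx C (i + 1))}

/-- The boundary of the polygon that consists of the two chains and of the base edge. -/
def boundary (L R : List Pt) : Set Pt :=
  chainCurve L ∪ chainCurve R ∪ segment ℝ (vtx L 0) (vtx R 0)

/-- The closed region bounded by a curve: the curve together with the bounded connected
components of its complement. -/
def enclosedRegion (B : Set Pt) : Set Pt :=
  B ∪ {x | x ∉ B ∧ Bornology.IsBounded (connectedComponentIn Bᶜ x)}

/-- The polygon, as a closed region. -/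
def region (L R : List Pt) : Set Pt := enclosedRegion (boundary L R)

/-- A funnel. `L = (l₁, …, l_k)` and `R = (r₁, …, r_m)` are its left and its right concave
chain, from bottom to top; both end in the apex, and `l₁ r₁` is the base edge. The base need not
be horizontal: "up" is the direction perpendicular to it in which `l₁` is on the left. -/
structure IsFunnel (L R : List Pt) : Prop where
  two_le_left : 2 ≤ L.length
  two_le_right : 2 ≤ R.length
  /-- The chains meet at the apex `l_k = r_m`. -/
  apex_eq : vtx L (L.length - 1) = vtx R (R.length - 1)
  /-- The vertices of each chain are listed from bottom to top. -/
  left_up : ∀ i, i + 1 < L.length → height L R (vtx L i) < height L R (vtx L (i + 1))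
  right_up : ∀ j, j + 1 < R.length → height L R (vtx R j) < height L R (vtx R (j + 1))
  /-- The inner vertices of the chains are reflex vertices of the polygon. -/
  left_concave : ∀ i, i + 2 < L.length → 0 < cross (vtx L i) (vtx L (i + 1)) (vtx L (i + 2))
  right_concave : ∀ j, j + 2 < R.length → cross (vtx R j) (vtx R (j + 1)) (vtx R (j + 2)) < 0
  /-- The apex is a convex vertex of the polygon. -/
  apex_convex :
    0 < cross (vtx L (L.length - 2)) (vtx R (R.length - 2)) (vtx L (L.length - 1))

/-- `p` and `q` see each other in `F`. -/
def Sees (F : Set Pt) (p q : Pt) : Prop := segment ℝ p q ⊆ F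

/-- `D` is a set of vertices of the polygon that guards every point of it. -/
def IsVertexGuardSet (L R : List Pt) (D : Finset Pt) : Prop :=
  (∀ v ∈ D, v ∈ L ∨ v ∈ R) ∧ ∀ p ∈ region L R, ∃ g ∈ D, Sees (region L R) g p

/-- No vertex other than the apex lies on the line through an edge of the opposite chain. -/
def OppositeEdgesAvoidVertices (L R : List Pt) : Prop :=
  (∀ i j, i + 1 < L.length → j + 1 < R.length →
      cross (vtx R j) (vtx R (j + 1)) (vtx L i) ≠ 0) ∧
  (∀ i j, i + 1 < L.length → j + 1 < R.length →
      cross (vtx L i) (vtx L (i + 1)) (vtx R j) ≠ 0)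

/-! ### The cost model

A real random access machine. A computation yields a value together with the number of elementary
operations performed. Elementary operations of cost `1`: exact arithmetic and comparison of two
real numbers, arithmetic and comparison of two indices, comparison of two digraph vertices, and
visiting one cell of a list. -/

structure Timed (α : Type) where
  val : α
  time : ℕ

instance : Monad Timed where
  pure a := ⟨a, 0⟩
  bind x f := ⟨(f x.val).val, x.time + (f x.val).time⟩

def tick : Timed Unit := ⟨(), 1⟩

def rAdd (x y : ℝ) : Timed ℝ := ⟨x + y, 1⟩
def rSub (x y : ℝ) : Timed ℝ := ⟨x - y, 1⟩
def rMul (x y : ℝ) : Timed ℝ := ⟨x * y, 1⟩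
def rDiv (x y : ℝ) : Timed ℝ := ⟨x / y, 1⟩
def rLe (x y : ℝ) : Timed Bool := ⟨decide (x ≤ y), 1⟩
def rLt (x y : ℝ) : Timed Bool := ⟨decide (x < y), 1⟩
def rEq (x y : ℝ) : Timed Bool := ⟨decide (x = y), 1⟩
def nAdd (x y : ℕ) : Timed ℕ := ⟨x + y, 1⟩
def nSub (x y : ℕ) : Timed ℕ := ⟨x - y, 1⟩
def nLt (x y : ℕ) : Timed Bool := ⟨decide (x < y), 1⟩
def bAnd (x y : Bool) : Timed Bool := ⟨x && y, 1⟩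
def bOr (x y : Bool) : Timed Bool := ⟨x || y, 1⟩

/-- The length of a chain. -/
def len : List Pt → Timed ℕ
  | [] => pure 0
  | _ :: C => do
    tick
    let n ← len C
    nAdd n 1

/-- The `i`-th vertex of a chain. -/
def nth : List Pt → ℕ → Timed Pt
  | [], _ => pure 0
  | c :: _, 0 => do
    tick
    pure c
  | _ :: C, i + 1 => do
    tick
    nth C i

/-! ### Geometric primitives of the algorithm -/

def crossT (a b c : Pt) : Timed ℝ := do
  let x₁ ← rSub b.1 a.1
  let y₁ ← rSub c.2 a.2
  let x₂ ← rSub b.2 a.2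
  let y₂ ← rSub c.1 a.1
  let u ← rMul x₁ y₁
  let v ← rMul x₂ y₂
  rSub u v

def heightT (L R : List Pt) (p : Pt) : Timed ℝ := do
  let l ← nth L 0
  let r ← nth R 0
  crossT l r p

def apexT (L : List Pt) : Timed Pt := do
  let k ← len L
  let i ← nSub k 1
  nth L i

def ptEq (a b : Pt) : Timed Bool := do
  let x ← rEq a.1 b.1
  let y ← rEq a.2 b.2
  bAnd x y

/-- The intersection of the (not parallel) lines `u v` and `c d`. -/
def meet (u v c d : Pt) : Timed Pt := do
  let sc ← crossT u v c
  let sd ← crossT u v d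
  let w ← rSub sc sd
  let s ← rDiv sc w
  let dx ← rSub d.1 c.1
  let dy ← rSub d.2 c.2
  let ex ← rMul s dx
  let ey ← rMul s dy
  let x ← rAdd c.1 ex
  let y ← rAdd c.2 ey
  pure (x, y)

/-- The point in which the line through `u`, `v` meets the chain, whose edges are scanned from
bottom to top. -/
def hit (u v : Pt) : List Pt → Timed Pt
  | [] => pure u
  | [c] => pure c
  | c :: d :: C => do
    tick
    let sc ← crossT u v c
    let sd ← crossT u v d
    let s ← rMul sc sd
    let b ← rLe s 0
    if b then meet u v c d else hit u v (d :: C)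

/-- The largest index of a vertex of the chain which is not above height `h`. (`i` is the index of
the first vertex of the list, `best` the result for the vertices before it.) -/
def lastNotAbove (L R : List Pt) (h : ℝ) : List Pt → ℕ → ℕ → Timed ℕ
  | [], _, best => pure best
  | c :: C, i, best => do
    tick
    let hc ← heightT L R c
    let b ← rLe hc h
    let i₁ ← nAdd i 1
    if b then lastNotAbove L R h C i₁ i else lastNotAbove L R h C i₁ best

/-- The largest index of a vertex of the chain which is strictly below height `h`. -/
def lastBelow (L R : List Pt) (h : ℝ) : List Pt → ℕ → ℕ → Timed ℕ
  | [], _, best => pure best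
  | c :: C, i, best => do
    tick
    let hc ← heightT L R c
    let b ← rLt hc h
    let i₁ ← nAdd i 1
    if b then lastBelow L R h C i₁ i else lastBelow L R h C i₁ best

/-- Whether no vertex of the chain whose height is strictly between `h₀` and `h₁` lies strictly to
the right of the line directed from `a` to `b`. -/
def clear (L R : List Pt) (a b : Pt) (h₀ h₁ : ℝ) : List Pt → Timed Bool
  | [] => pure true
  | c :: C => do
    tick
    let hc ← heightT L R c
    let above ← rLt h₀ hc
    let below ← rLt hc h₁
    let s ← crossT a b c
    let out ← rLt s 0
    let inside ← bAnd above below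
    let blocks ← bAnd inside out
    if blocks then pure false else clear L R a b h₀ h₁ C

/-- Visibility test for two points of the funnel: the segment between them is blocked iff, between
the heights of its ends, a vertex of the left chain lies to the right of it or a vertex of the
right chain lies to the left of it. -/
def seesT (L R : List Pt) (v w : Pt) : Timed Bool := do
  let hv ← heightT L R v
  let hw ← heightT L R w
  let b ← rLe hv hw
  if b then do
    let cl ← clear L R v w hv hw L
    let cr ← clear L R w v hv hw R
    bAnd cl cr
  else do
    let cl ← clear L R w v hw hv L
    let cr ← clear L R v w hw hv R
    bAnd cl cr

/-! ### Upper segments -/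

/-- A segment or a `∨`-shape inside the funnel, as the polygonal line from its end `q` on the left
chain via `t` to its end `p` on the right chain. A segment has `t = q`. -/
structure Front where
  q : Pt
  t : Pt
  p : Pt

/-- Vertices of the auxiliary digraph: the dummy vertices `x` (`source`) and `y` (`sink`), single
guards `l_{i+1}` (`left i`) and `r_{j+1}` (`right j`), and pairs of guards (`pair i j`). -/
inductive Node
  | source
  | sink
  | left (i : ℕ)
  | right (j : ℕ)
  | pair (i j : ℕ)
  deriving DecidableEq

def nodeEq (a b : Node) : Timed Bool := ⟨decide (a = b), 1⟩

/-- `upseg` of a vertex of the left chain: the segment from the next vertex of the chain to the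
point in which the upper tangent hits the right chain. For the apex it is the apex itself. -/
def upsegLeft (L R : List Pt) (i : ℕ) : Timed Front := do
  let k ← len L
  let i₁ ← nAdd i 1
  let b ← nLt i₁ k
  if b then do
    let u ← nth L i
    let v ← nth L i₁
    let p ← hit u v R
    pure ⟨v, v, p⟩
  else do
    let a ← apexT L
    pure ⟨a, a, a⟩

/-- `upseg` of a vertex of the right chain. -/
def upsegRight (L R : List Pt) (j : ℕ) : Timed Front := do
  let m ← len R
  let j₁ ← nAdd j 1
  let b ← nLt j₁ m
  if b then do
    let u ← nth R j
    let v ← nth R j₁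
    let q ← hit u v L
    pure ⟨q, q, v⟩
  else do
    let a ← apexT L
    pure ⟨a, a, a⟩

/-- `upseg` of a pair. The segment `f` of the left guard rises to the right and the segment `g` of
the right guard rises to the left, so they intersect iff the left end of `f` is not above that of
`g` and the right end of `g` is not above that of `f`. If they intersect, the result is the
`∨`-shape with its bottom at the intersection, otherwise the upper one of `f` and `g`. -/
def upsegPair (L R : List Pt) (i j : ℕ) : Timed Front := do
  let f ← upsegLeft L R i
  let g ← upsegRight L R j
  let fq ← heightT L R f.q
  let fp ← heightT L R f.p
  let gq ← heightT L R g.q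
  let gp ← heightT L R g.p
  let b₁ ← rLe fq gq
  let b₂ ← rLe gp fp
  let b ← bAnd b₁ b₂
  if b then do
    let i₁ ← nAdd i 1
    let j₁ ← nAdd j 1
    let u ← nth L i
    let v ← nth L i₁
    let c ← nth R j
    let d ← nth R j₁
    let t ← meet u v c d
    pure ⟨g.q, t, f.p⟩
  else if b₁ then pure g else pure f

/-- `upseg` of a vertex of the digraph; that of `x` is the base. -/
def upseg (L R : List Pt) : Node → Timed Front
  | .left i => upsegLeft L R i
  | .right j => upsegRight L R j
  | .pair i j => upsegPair L R i j
  | _ => do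
    let l ← nth L 0
    let r ← nth R 0
    pure ⟨l, l, r⟩

/-- Whether `v` sees the whole of `s`. The polygon has no holes, so this holds iff `v` sees the
ends and the bend of `s`. -/
def seesFront (L R : List Pt) (v : Pt) (s : Front) : Timed Bool := do
  let a ← seesT L R v s.q
  let b ← seesT L R v s.t
  let c ← seesT L R v s.p
  let d ← bAnd a b
  bAnd d c

/-- Whether `s` includes the apex; being the top of the funnel, it can only be an end of `s`. -/
def hasApex (L : List Pt) (s : Front) : Timed Bool := do
  let a ← apexT L
  let b ← ptEq s.q a
  let c ← ptEq s.p a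
  bOr b c

/-- Given that vertex `i` of the chain `C` is the topmost one not above the end of `s` on `C`: the
index `i + 1` if that vertex exists and sees the whole of `s`, and `i` otherwise. -/
def topSeeing (L R C : List Pt) (s : Front) (i : ℕ) : Timed ℕ := do
  let k ← len C
  let i₁ ← nAdd i 1
  let b ← nLt i₁ k
  if b then do
    let v ← nth C i₁
    let c ← seesFront L R v s
    if c then pure i₁ else pure i
  else pure i

/-- The out-neighbours of `t` with the weights of the edges to them: `l_{i'}`, `r_{j'}` and
`(l_{i''}, r_{j''})`. The end `p` of `s` lies on the edge of the right chain that starts at its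
vertex `j` (and is not the upper end of that edge), so `upseg(p)` is `upseg` of that vertex, and a
vertex of the left chain is strictly below it iff it is below its end on the left chain;
symmetrically for `q`. -/
def outNeighbours (L R : List Pt) (t : Node) : Timed (List (Node × ℕ)) := do
  let s ← upseg L R t
  let hq ← heightT L R s.q
  let hp ← heightT L R s.p
  let i ← lastNotAbove L R hq L 0 0
  let j ← lastNotAbove L R hp R 0 0
  let i' ← topSeeing L R L s i
  let j' ← topSeeing L R R s j
  let up ← upsegRight L R j
  let uq ← upsegLeft L R i
  let hup ← heightT L R up.q
  let huq ← heightT L R uq.p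
  let i'' ← lastBelow L R hup L 0 0
  let j'' ← lastBelow L R huq R 0 0
  pure [(.left i', 1), (.right j', 1), (.pair i'' j'', 2)]

/-! ### Construction of the digraph -/

/-- A weighted directed edge `(tail, head, weight)`. -/
abbrev Edge : Type := Node × Node × ℕ

/-- The edges of the digraph so far, its vertices so far, and the set `S` of vertices that are
still to be processed. -/
structure State where
  edges : List Edge
  known : List Node
  work : List Node

def initState : State := ⟨[], [.source], [.source]⟩

def memNode (z : Node) : List Node → Timed Bool
  | [] => pure false
  | a :: l => do
    tick
    let b ← nodeEq z a
    if b then pure true else memNode z l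

/-- Take the element at position `n` out of a list. -/
def takeAt : List Node → ℕ → Timed (Node × List Node)
  | [], _ => pure (.source, [])
  | a :: l, 0 => do
    tick
    pure (a, l)
  | a :: l, n + 1 => do
    tick
    let r ← takeAt l n
    pure (r.1, a :: r.2)

/-- Add the edge `(t, z)`. If `upseg(z)` includes the apex, add also the edge `(z, y)`; otherwise
`z` has to be processed, unless it was already in the digraph. -/
def addEdge (L R : List Pt) (t z : Node) (w : ℕ) (σ : State) : Timed State := do
  tick
  let s ← upseg L R z
  let a ← hasApex L s
  let b ← memNode z σ.known
  if a then pure ⟨(z, .sink, 0) :: (t, z, w) :: σ.edges, z :: σ.known, σ.work⟩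
  else if b then pure ⟨(t, z, w) :: σ.edges, σ.known, σ.work⟩
  else pure ⟨(t, z, w) :: σ.edges, z :: σ.known, z :: σ.work⟩

def addEdges (L R : List Pt) (t : Node) : List (Node × ℕ) → State → Timed State
  | [], σ => pure σ
  | z :: zs, σ => do
    let σ₁ ← addEdge L R t z.1 z.2 σ
    addEdges L R t zs σ₁

/-- One iteration of the while loop; it processes the element of `S` at position `n`. -/
def loopBody (L R : List Pt) (n : ℕ) (σ : State) : Timed State := do
  let r ← takeAt σ.work n
  let zs ← outNeighbours L R r.1
  addEdges L R r.1 zs ⟨σ.edges, σ.known, r.2⟩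

/-- `LoopRuns pick L R σ τ T`: the while loop, started in state `σ`, terminates in state `τ` after
`T` operations. The rule `pick` makes the arbitrary choice of the next element of `S`, as a
position in the list (taken modulo its length); it may depend on the whole state. -/
inductive LoopRuns (pick : State → ℕ) (L R : List Pt) : State → State → ℕ → Prop
  | done (σ : State) : σ.work = [] → LoopRuns pick L R σ σ 1
  | step (σ τ : State) (T : ℕ) : σ.work ≠ [] →
      LoopRuns pick L R (loopBody L R (pick σ % σ.work.length) σ).val τ T →
      LoopRuns pick L R σ τ (1 + (loopBody L R (pick σ % σ.work.length) σ).time + T)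

/-! ### Shortest weighted path -/

/-- A label: a vertex, the weight of a path from `x` to it, and that path without `x`, listed
backwards. Newer labels stand in front of older ones. -/
abbrev Label : Type := Node × ℕ × List Node

def lookup (z : Node) : List Label → Timed (Option (ℕ × List Node))
  | [] => pure none
  | a :: l => do
    tick
    let b ← nodeEq z a.1
    if b then pure (some a.2) else lookup z l

/-- Relax one edge. -/
def relax (e : Edge) (labels : List Label) : Timed (List Label) := do
  tick
  let lt ← lookup e.1 labels
  match lt with
  | none => pure labels
  | some (d, path) => do
    let d₁ ← nAdd d e.2.2
    let lz ← lookup e.2.1 labels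
    match lz with
    | none => pure ((e.2.1, d₁, e.2.1 :: path) :: labels)
    | some (d₂, _) => do
      let b ← nLt d₁ d₂
      if b then pure ((e.2.1, d₁, e.2.1 :: path) :: labels) else pure labels

def relaxAll : List Edge → List Label → Timed (List Label)
  | [], labels => pure labels
  | e :: es, labels => do
    let labels₁ ← relax e labels
    relaxAll es labels₁

/-- Relax all edges in `es`, once for every element of the first list. -/
def relaxRounds (es : List Edge) : List Edge → List Label → Timed (List Label)
  | [], labels => pure labels
  | _ :: rounds, labels => do
    tick
    let labels₁ ← relaxAll es labels
    relaxRounds es rounds labels₁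

/-- The guards listed in the vertices of a path. -/
def guardsOf (L R : List Pt) : List Node → Timed (List Pt)
  | [] => pure []
  | z :: zs => do
    tick
    let gs ← guardsOf L R zs
    match z with
    | .left i => do
      let a ← nth L i
      pure (a :: gs)
    | .right j => do
      let a ← nth R j
      pure (a :: gs)
    | .pair i j => do
      let a ← nth L i
      let b ← nth R j
      pure (a :: b :: gs)
    | _ => pure gs

/-- Find a shortest weighted path from `x` to `y` (Bellman-Ford, with as many rounds as there are
edges) and list the guards on it. -/
def shortestPathGuards (L R : List Pt) (es : List Edge) : Timed (List Pt) := do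
  let labels ← relaxRounds es es [(.source, 0, [])]
  let ly ← lookup .sink labels
  match ly with
  | none => pure []
  | some (_, path) => guardsOf L R path

/-! ### The algorithm -/

/-- `AlgorithmRuns pick L R out T`: the algorithm for optimum vertex-to-point guarding of funnels,
run on the chains `L` and `R` with the choices made by `pick`, terminates after `T` operations and
outputs the list `out`. -/
def AlgorithmRuns (pick : State → ℕ) (L R : List Pt) (out : List Pt) (T : ℕ) : Prop :=
  ∃ (σ : State) (T₁ : ℕ), LoopRuns pick L R initState σ T₁ ∧
    out = (shortestPathGuards L R σ.edges).val ∧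
    T = T₁ + (shortestPathGuards L R σ.edges).time

end FunnelGuarding

end

noncomputable section

namespace FunnelGuarding

/-! ### Funnels in adapted coordinates -/

/-! Take coordinates `x` along the base and `h` perpendicular to it. As functions of `h`, the left
chain is concave and the right chain is convex. So the points to the right of the left chain form
the union, not the intersection, of the half-planes `A e ≤ 0` over all left edges; likewise with `B
f ≤ 0` on the other side. The funnel is thus a union of convex pieces, one for each pair of a left
and a right edge, and two of its points that share such a pair see each other
(`CommonEdges.segment_inF`). Two facts drive nearly all computations. For a fixed point, `A e` falls
with `e` up to the edge at the height of the point and rises afterwards. And `A e + B f` depends on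
the height alone and increases strictly with it, because the lines of a left and of a right edge
converge upwards. Reflection (`mirror`) exchanges the chains and halves the work.

For a node `t` let U(t) be the part of the funnel above its upper segment (`Frame.Upper`).

Feasibility. If `z` is an out-neighbour of `t`, then U(z) is contained in U(t), and the guards of
`z` see U(t) minus U(z) (`upper_of_outNeighbour`, `guards_see`). For a pair, a point not above the
upper segment of one guard and not seen by it lies in a pocket below that guard, and the pockets of
the two guards are disjoint (`not_both_pockets`). U is the whole funnel at the source and empty at
the nodes joined to the sink, so the guards on any walk from source to sink form a guard set
(`walkTo_spec`).

Optimality. Given a guard set `D`, call a guard spent at `t` if it sees nothing of U(t). Points of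
U(t) inside the two edges on which the front of `t` ends must be guarded. A case analysis of the
guards that see them yields an out-neighbour reached by an edge of weight `n` at which at least `n`
more guards are spent (`exists_outNeighbour_spent`). Following such neighbours gives a walk to the
sink of weight at most `D.card` (`exists_walk`), and the weight of a walk is the number of guards it
lists, with repetitions. The hypothesis on opposite edges is used only to make two weak inequalities
strict, since the indices of the pair are defined by strict ones.

Termination and time. A node enters the work list at most once, and there are quadratically many
nodes. Bellman-Ford with one round per edge follows every simple walk, and each subroutine has an
explicit polynomial bound. -/

/-- A funnel in linear coordinates `x` (along the base) and `h` (perpendicular to it). The left chain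
`l 0, …, l K` is, as a function of `h`, concave with slopes `sa`, the right chain `r 0, …, r M` is
convex with slopes `sb`. -/
structure Frame where
  x : Pt →L[ℝ] ℝ
  h : Pt →L[ℝ] ℝ
  K : ℕ
  M : ℕ
  l : ℕ → Pt
  r : ℕ → Pt
  sa : ℕ → ℝ
  sb : ℕ → ℝ
  K_pos : 0 < K
  M_pos : 0 < M
  inj : ∀ p q, x p = x q → h p = h q → p = q
  dir_x : ∃ d, 0 < x d ∧ h d = 0
  dir_h : ∃ d, h d < 0
  l_up : ∀ e < K, h (l e) < h (l (e + 1))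
  r_up : ∀ f < M, h (r f) < h (r (f + 1))
  l_edge : ∀ e < K, x (l (e + 1)) = x (l e) + sa e * (h (l (e + 1)) - h (l e))
  r_edge : ∀ f < M, x (r (f + 1)) = x (r f) + sb f * (h (r (f + 1)) - h (r f))
  sa_lt : ∀ e, e + 1 < K → sa (e + 1) < sa e
  sb_lt : ∀ f, f + 1 < M → sb f < sb (f + 1)
  apex : l K = r M
  apex_lt : sb (M - 1) < sa (K - 1)
  base : h (l 0) = h (r 0)

namespace Frame

variable (H : Frame)

/-- The reflection of a frame, which exchanges the two chains. -/
def mirror : Frame where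
  x := -H.x
  h := H.h
  K := H.M
  M := H.K
  l := H.r
  r := H.l
  sa f := -H.sb f
  sb e := -H.sa e
  K_pos := H.M_pos
  M_pos := H.K_pos
  inj p q hx hh := H.inj p q (by simpa using hx) hh
  dir_x := by
    obtain ⟨d, h1, h2⟩ := H.dir_x
    exact ⟨-d, by simpa using h1, by simpa using h2⟩
  dir_h := H.dir_h
  l_up := H.r_up
  r_up := H.l_up
  l_edge f hf := by
    have := H.r_edge f hf
    simp only [neg_apply]
    linarith
  r_edge e he := by
    have := H.l_edge e he
    simp only [neg_apply]
    linarith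
  sa_lt f hf := neg_lt_neg (H.sb_lt f hf)
  sb_lt e he := neg_lt_neg (H.sa_lt e he)
  apex := H.apex.symm
  apex_lt := neg_lt_neg H.apex_lt
  base := H.base.symm

/-- The horizontal distance of `w` from the line through the left edge `e`, positive above it. -/
def A (e : ℕ) (w : Pt) : ℝ := H.x (H.l e) + H.sa e * (H.h w - H.h (H.l e)) - H.x w

/-- The horizontal distance of `w` from the line through the right edge `f`, positive above it. -/
def B (f : ℕ) (w : Pt) : ℝ := H.x w - H.x (H.r f) - H.sb f * (H.h w - H.h (H.r f))

theorem mirror_A (f : ℕ) (w : Pt) : H.mirror.A f w = H.B f w := by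
  simp only [A, B, mirror, neg_apply]; ring

theorem mirror_B (e : ℕ) (w : Pt) : H.mirror.B e w = H.A e w := by
  simp only [A, B, mirror, neg_apply]; ring

/-- `w` lies in the funnel. -/
def InF (w : Pt) : Prop :=
  H.h (H.l 0) ≤ H.h w ∧ (∃ e < H.K, H.A e w ≤ 0) ∧ ∃ f < H.M, H.B f w ≤ 0

theorem mirror_InF (w : Pt) : H.mirror.InF w ↔ H.InF w := by
  simp only [InF, mirror_A, mirror_B]
  have : H.mirror.h (H.mirror.l 0) = H.h (H.l 0) := H.base.symm
  rw [this]
  exact and_congr_right fun _ => and_comm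

/-! ### Monotonicity along the chains and of the distances to edge lines. -/

theorem h_l_mono {c d : ℕ} (hcd : c ≤ d) (hd : d ≤ H.K) : H.h (H.l c) ≤ H.h (H.l d) := by
  induction d, hcd using Nat.le_induction with
  | base => rfl
  | succ d _ ih => exact (ih (by omega)).trans (H.l_up d (by omega)).le

theorem h_l_strictMono {c d : ℕ} (hcd : c < d) (hd : d ≤ H.K) : H.h (H.l c) < H.h (H.l d) :=
  (H.l_up c (by omega)).trans_le (H.h_l_mono hcd hd)

theorem lt_of_h_l_lt {c d : ℕ} (hc : c ≤ H.K) (hh : H.h (H.l c) < H.h (H.l d)) : c < d := by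
  by_contra hcd
  exact absurd (H.h_l_mono (not_lt.1 hcd) hc) (not_le.2 hh)

theorem h_r_mono {c d : ℕ} (hcd : c ≤ d) (hd : d ≤ H.M) : H.h (H.r c) ≤ H.h (H.r d) :=
  H.mirror.h_l_mono hcd hd

theorem sa_anti {e e' : ℕ} (hee : e ≤ e') (he : e' < H.K) : H.sa e' ≤ H.sa e := by
  induction e', hee using Nat.le_induction with
  | base => rfl
  | succ d _ ih => exact (H.sa_lt d he).le.trans (ih (by omega))

/-- The last left edge has the least slope and the last right edge the greatest, so the comparison
at the convex apex implies all others. -/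
theorem sb_lt_sa {e f : ℕ} (he : e < H.K) (hf : f < H.M) : H.sb f < H.sa e := by
  have h1 := H.sa_anti (e := e) (e' := H.K - 1) (by omega) (by omega)
  have h2 := H.mirror.sa_anti (e := f) (e' := H.M - 1) (by omega) (Nat.sub_lt hf.pos one_pos)
  have h3 := H.apex_lt
  simp only [mirror] at h2
  linarith

/-- The coordinate `x` cancels in `A e + B f`. What remains is affine in the height, with slope `sa
e - sb f`, which is positive. -/
theorem A_add_B_lt {e f : ℕ} (he : e < H.K) (hf : f < H.M) {u w : Pt} (huw : H.h u < H.h w) :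
    H.A e u + H.B f u < H.A e w + H.B f w := by
  have := mul_pos (sub_pos.2 (H.sb_lt_sa he hf)) (sub_pos.2 huw)
  simp only [A, B]
  nlinarith

theorem A_add_B_le {e f : ℕ} (he : e < H.K) (hf : f < H.M) {u w : Pt} (huw : H.h u ≤ H.h w) :
    H.A e u + H.B f u ≤ H.A e w + H.B f w := by
  have := mul_nonneg (sub_pos.2 (H.sb_lt_sa he hf)).le (sub_nonneg.2 huw)
  simp only [A, B]
  nlinarith

/-- Consecutive edge lines cross at their common vertex, so their distance is proportional to the
height above it. The monotonicity of `A` in the index follows by telescoping. -/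
theorem A_succ_sub {e : ℕ} (he : e < H.K) (w : Pt) :
    H.A (e + 1) w - H.A e w = (H.sa (e + 1) - H.sa e) * (H.h w - H.h (H.l (e + 1))) := by
  have := H.l_edge e he
  simp only [A]
  rw [this]; ring

/-- Above a common vertex the later of two consecutive lines bounds the larger half-plane `A ≤ 0`.
Together with `A_le_of_le`, this makes `A e w` minimal in `e` at the edge at the height of `w`. -/
theorem A_le_of_ge {e e' : ℕ} (hee : e ≤ e') (he : e' < H.K) {w : Pt}
    (hw : H.h (H.l e') ≤ H.h w) : H.A e' w ≤ H.A e w := by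
  induction e', hee using Nat.le_induction with
  | base => rfl
  | succ d _ ih =>
    have h1 := ih (by omega) ((H.l_up d (by omega)).le.trans hw)
    have h2 := H.A_succ_sub (e := d) (by omega) w
    have h3 := mul_nonneg (sub_pos.2 (H.sa_lt d he)).le (sub_nonneg.2 hw)
    nlinarith

theorem A_lt_of_gt {e e' : ℕ} (hee : e < e') (he : e' < H.K) {w : Pt}
    (hw : H.h (H.l e') < H.h w) : H.A e' w < H.A e w := by
  have h1 := H.A_le_of_ge (e := e) (e' := e' - 1) (w := w) (by omega) (by omega)
    ((H.h_l_mono (by omega) he.le).trans hw.le)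
  have h2 := H.A_succ_sub (e := e' - 1) (by omega) w
  have h3 := H.sa_lt (e' - 1) (by omega)
  rw [Nat.sub_add_cancel (by omega)] at h2 h3
  have := mul_pos (sub_pos.2 h3) (sub_pos.2 hw)
  nlinarith

theorem A_le_of_le {e e' : ℕ} (hee : e ≤ e') (he : e' < H.K) {w : Pt}
    (hw : H.h w ≤ H.h (H.l (e + 1))) : H.A e w ≤ H.A e' w := by
  induction e', hee using Nat.le_induction with
  | base => rfl
  | succ d hd ih =>
    have h1 := ih (by omega)
    have h2 := H.A_succ_sub (e := d) (by omega) w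
    have h4 := hw.trans (H.h_l_mono (c := e + 1) (d := d + 1) (by omega) (by omega))
    have h3 := mul_nonneg (sub_pos.2 (H.sa_lt d he)).le (sub_nonneg.2 h4)
    nlinarith

theorem A_lt_of_lt {e e' : ℕ} (hee : e < e') (he : e' < H.K) {w : Pt}
    (hw : H.h w < H.h (H.l (e + 1))) : H.A e w < H.A e' w := by
  have h1 := H.A_le_of_le (e := e + 1) (e' := e') (w := w) hee he
    (hw.le.trans (H.l_up _ (by omega)).le)
  have h2 := H.A_succ_sub (e := e) (by omega) w
  have := mul_pos (sub_pos.2 (H.sa_lt e (by omega))) (sub_pos.2 hw)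
  nlinarith

theorem A_self (e : ℕ) : H.A e (H.l e) = 0 := by simp [A]

theorem A_next {e : ℕ} (he : e < H.K) : H.A e (H.l (e + 1)) = 0 := by
  simp only [A]; rw [H.l_edge e he]; ring

theorem A_vertex_pos {e c : ℕ} (he : e < H.K) (hc : c ≤ H.K) (h1 : c ≠ e) (h2 : c ≠ e + 1) :
    0 < H.A e (H.l c) := by
  rcases lt_or_gt_of_ne h1 with h | h
  · rw [← H.A_self c]
    exact H.A_lt_of_lt h he (H.l_up c (by omega))
  · obtain ⟨d, rfl⟩ : ∃ d, c = d + 1 := ⟨c - 1, by omega⟩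
    rw [← H.A_next (e := d) (by omega)]
    exact H.A_lt_of_gt (by omega) (by omega) (H.l_up d (by omega))

theorem A_vertex_nonneg {e c : ℕ} (he : e < H.K) (hc : c ≤ H.K) : 0 ≤ H.A e (H.l c) := by
  by_cases h1 : c = e
  · rw [h1, A_self]
  by_cases h2 : c = e + 1
  · rw [h2, H.A_next he]
  exact (H.A_vertex_pos he hc h1 h2).le

theorem exists_A_vertex_nonpos {c : ℕ} (hc : c ≤ H.K) : ∃ e < H.K, H.A e (H.l c) ≤ 0 := by
  rcases hc.lt_or_eq with h | h
  · exact ⟨c, h, (H.A_self c).le⟩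
  · have := H.K_pos
    refine ⟨c - 1, by omega, ?_⟩
    have := H.A_next (e := c - 1) (by omega)
    rw [Nat.sub_add_cancel (by omega)] at this
    exact this.le

theorem B_vertex_nonneg {f c : ℕ} (hf : f < H.M) (hc : c ≤ H.M) : 0 ≤ H.B f (H.r c) := by
  rw [← mirror_A]; exact H.mirror.A_vertex_nonneg hf hc

theorem B_vertex_pos {f c : ℕ} (hf : f < H.M) (hc : c ≤ H.M) (h1 : c ≠ f) (h2 : c ≠ f + 1) :
    0 < H.B f (H.r c) := by
  rw [← mirror_A]; exact H.mirror.A_vertex_pos hf hc h1 h2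

theorem B_self (f : ℕ) : H.B f (H.r f) = 0 := by simp [B]

theorem B_next {f : ℕ} (hf : f < H.M) : H.B f (H.r (f + 1)) = 0 := by
  rw [← mirror_A]; exact H.mirror.A_next hf

theorem B_le_of_ge {f f' : ℕ} (hff : f ≤ f') (hf : f' < H.M) {w : Pt}
    (hw : H.h (H.r f') ≤ H.h w) : H.B f' w ≤ H.B f w := by
  rw [← mirror_A, ← mirror_A]; exact H.mirror.A_le_of_ge hff hf hw

/-- At the heights of edge `e` the value `A e w` is the least of all, so the edge provided by
membership in the funnel may be replaced by `e`. -/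
theorem InF.A_nonpos {H : Frame} {w : Pt} (hw : H.InF w) {e : ℕ} (he : e < H.K)
    (h1 : H.h (H.l e) ≤ H.h w) (h2 : H.h w ≤ H.h (H.l (e + 1))) : H.A e w ≤ 0 := by
  obtain ⟨e', he', h⟩ := hw.2.1
  rcases le_total e e' with hee | hee
  · exact (H.A_le_of_le hee he' h2).trans h
  · exact (H.A_le_of_ge hee he h1).trans h

theorem InF.B_nonpos {H : Frame} {w : Pt} (hw : H.InF w) {f : ℕ} (hf : f < H.M)
    (h1 : H.h (H.r f) ≤ H.h w) (h2 : H.h w ≤ H.h (H.r (f + 1))) : H.B f w ≤ 0 := by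
  rw [← mirror_A]; exact InF.A_nonpos ((H.mirror_InF w).2 hw) hf h1 h2

/-- At the apex all `A e` and `B f` are nonnegative. Their sums grow strictly above it, so no pair
can be nonpositive there; the definition of `InF` needs no upper bound on the height. -/
theorem InF.h_le {H : Frame} {w : Pt} (hw : H.InF w) : H.h w ≤ H.h (H.l H.K) := by
  obtain ⟨-, ⟨e, he, h1⟩, f, hf, h2⟩ := hw
  by_contra! h
  have h3 := H.A_add_B_lt he hf h
  have h4 := H.A_vertex_nonneg he le_rfl
  have h5 := H.B_vertex_nonneg hf le_rfl
  rw [← H.apex] at h5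
  linarith

/-- Points not above any line of a left edge are not above the last right edge. -/
theorem B_last_nonpos {w : Pt} (hA : 0 ≤ H.A (H.K - 1) w) (hh : H.h w ≤ H.h (H.l H.K)) :
    H.B (H.M - 1) w ≤ 0 := by
  have hK := H.K_pos
  have hM := H.M_pos
  have h1 := H.A_next (e := H.K - 1) (by omega)
  have h2 := H.B_next (f := H.M - 1) (by omega)
  rw [Nat.sub_add_cancel hK] at h1
  rw [Nat.sub_add_cancel hM, ← H.apex] at h2
  have := H.A_add_B_le (e := H.K - 1) (f := H.M - 1) (by omega) (by omega) hh
  linarith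

theorem B_last_neg {w : Pt} (hA : 0 ≤ H.A (H.K - 1) w) (hh : H.h w < H.h (H.l H.K)) :
    H.B (H.M - 1) w < 0 := by
  have hK := H.K_pos
  have hM := H.M_pos
  have h1 := H.A_next (e := H.K - 1) (by omega)
  have h2 := H.B_next (f := H.M - 1) (by omega)
  rw [Nat.sub_add_cancel hK] at h1
  rw [Nat.sub_add_cancel hM, ← H.apex] at h2
  have := H.A_add_B_lt (e := H.K - 1) (f := H.M - 1) (by omega) (by omega) hh
  linarith

/-! ### Points on the chains and their order by height. -/

/-- `w` lies on the left chain. -/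
def OnL (w : Pt) : Prop := ∃ e < H.K, w ∈ segment ℝ (H.l e) (H.l (e + 1))

theorem A_convexComb (e : ℕ) {a b : ℝ} (hab : a + b = 1) (u w : Pt) :
    H.A e (a • u + b • w) = a * H.A e u + b * H.A e w := by
  simp only [A, map_add, map_smul, smul_eq_mul]
  linear_combination (-(H.x (H.l e)) + H.sa e * (H.h (H.l e))) * hab

theorem B_convexComb (f : ℕ) {a b : ℝ} (hab : a + b = 1) (u w : Pt) :
    H.B f (a • u + b • w) = a * H.B f u + b * H.B f w := by
  rw [← mirror_A, ← mirror_A, ← mirror_A]; exact H.mirror.A_convexComb f hab u w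

theorem h_convexComb {a b : ℝ} (u w : Pt) :
    H.h (a • u + b • w) = a * H.h u + b * H.h w := by
  simp only [map_add, map_smul, smul_eq_mul]

theorem onL_vertex {c : ℕ} (hc : c ≤ H.K) : H.OnL (H.l c) := by
  rcases hc.lt_or_eq with h | h
  · exact ⟨c, h, left_mem_segment ℝ _ _⟩
  · have := H.K_pos
    refine ⟨c - 1, by omega, ?_⟩
    rw [Nat.sub_add_cancel (by omega)]
    exact right_mem_segment ℝ _ _

variable {H}

theorem OnL.A_nonneg {w : Pt} (hw : H.OnL w) {e : ℕ} (he : e < H.K) : 0 ≤ H.A e w := by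
  obtain ⟨d, hd, a, b, ha, hb, hab, rfl⟩ := hw
  rw [H.A_convexComb e hab]
  have h1 := H.A_vertex_nonneg he hd.le
  have h2 := H.A_vertex_nonneg he (Nat.succ_le_of_lt hd)
  positivity

theorem OnL.exists_A_nonpos {w : Pt} (hw : H.OnL w) : ∃ e < H.K, H.A e w ≤ 0 := by
  obtain ⟨d, hd, a, b, ha, hb, hab, rfl⟩ := hw
  refine ⟨d, hd, ?_⟩
  rw [H.A_convexComb d hab, H.A_self, H.A_next hd]
  simp

theorem OnL.h_mem {w : Pt} (hw : H.OnL w) :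
    ∃ e < H.K, H.h (H.l e) ≤ H.h w ∧ H.h w ≤ H.h (H.l (e + 1)) := by
  obtain ⟨d, hd, a, b, ha, hb, hab, rfl⟩ := hw
  refine ⟨d, hd, ?_⟩
  have := H.l_up d hd
  rw [H.h_convexComb]
  obtain rfl : a = 1 - b := by linarith
  constructor <;> nlinarith

theorem OnL.inF {w : Pt} (hw : H.OnL w) : H.InF w := by
  obtain ⟨e, he, h1, h2⟩ := hw.h_mem
  have hK := H.K_pos
  have hM := H.M_pos
  exact ⟨(H.h_l_mono (Nat.zero_le e) he.le).trans h1, hw.exists_A_nonpos, H.M - 1, by omega,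
    H.B_last_nonpos (hw.A_nonneg (by omega)) (h2.trans (H.h_l_mono he le_rfl))⟩

/-- Along the left chain, the distance from the line of a right edge grows with the height. -/
theorem OnL.B_le {u w : Pt} (hu : H.OnL u) (hw : ∃ e < H.K, H.A e w ≤ 0) {f : ℕ} (hf : f < H.M)
    (huw : H.h u ≤ H.h w) : H.B f u ≤ H.B f w := by
  obtain ⟨e, he, h⟩ := hw
  have := H.A_add_B_le he hf huw
  have := hu.A_nonneg he
  linarith

theorem OnL.B_lt {u w : Pt} (hu : H.OnL u) (hw : ∃ e < H.K, H.A e w ≤ 0) {f : ℕ} (hf : f < H.M)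
    (huw : H.h u < H.h w) : H.B f u < H.B f w := by
  obtain ⟨e, he, h⟩ := hw
  have := H.A_add_B_lt he hf huw
  have := hu.A_nonneg he
  linarith

/-- On the left chain `B f` is strictly increasing in the height. So comparing the height of a
vertex with that of the point where the line of edge `f` hits the chain amounts to reading off the
sign of `B f`. -/
theorem OnL.h_lt_iff {u w : Pt} (hu : H.OnL u) (hw : H.OnL w) {f : ℕ} (hf : f < H.M) :
    H.h u < H.h w ↔ H.B f u < H.B f w :=
  ⟨hu.B_lt hw.exists_A_nonpos hf, fun h => by
    by_contra hh
    exact absurd (hw.B_le hu.exists_A_nonpos hf (not_lt.1 hh)) (not_le.2 h)⟩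

theorem OnL.h_le_iff {u w : Pt} (hu : H.OnL u) (hw : H.OnL w) {f : ℕ} (hf : f < H.M) :
    H.h u ≤ H.h w ↔ H.B f u ≤ H.B f w := by
  rw [← not_lt, ← not_lt, hw.h_lt_iff hu hf]

end Frame
end FunnelGuarding

namespace FunnelGuarding

namespace Frame

variable {H : Frame}

/-! ### Fronts -/

/-- `w` lies on the right chain. -/
def OnR (H : Frame) (w : Pt) : Prop := H.mirror.OnL w

theorem onR_iff {w : Pt} : H.OnR w ↔ ∃ f < H.M, w ∈ segment ℝ (H.r f) (H.r (f + 1)) := Iff.rfl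

theorem OnR.inF {w : Pt} (hw : H.OnR w) : H.InF w := (H.mirror_InF w).1 (OnL.inF hw)

theorem onR_vertex {c : ℕ} (hc : c ≤ H.M) : H.OnR (H.r c) := H.mirror.onL_vertex hc

theorem OnR.A_le {u w : Pt} (hu : H.OnR u) (hw : ∃ f < H.M, H.B f w ≤ 0) {e : ℕ} (he : e < H.K)
    (huw : H.h u ≤ H.h w) : H.A e u ≤ H.A e w := by
  rw [← mirror_B, ← mirror_B]
  exact OnL.B_le hu (by simp only [mirror_A]; exact hw) he huw

theorem OnR.h_lt_iff {u w : Pt} (hu : H.OnR u) (hw : H.OnR w) {e : ℕ} (he : e < H.K) :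
    H.h u < H.h w ↔ H.A e u < H.A e w := by
  rw [← mirror_B, ← mirror_B]; exact OnL.h_lt_iff hu hw he

/-- The monotonicity of `B f` along the left chain also allows comparison with a point of the right
chain: up to the height of `r (f + 1)` it is at most its value there, which is zero. -/
theorem OnL.h_right_lt {u : Pt} (hu : H.OnL u) {f : ℕ} (hf : f < H.M) (hB : 0 < H.B f u) :
    H.h (H.r (f + 1)) < H.h u := by
  by_contra! h
  have := hu.B_le (onR_vertex (Nat.succ_le_of_lt hf)).inF.2.1 hf h
  rw [Nat.succ_eq_add_one, H.B_next hf] at this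
  linarith

theorem OnR.h_left_lt {u : Pt} (hu : H.OnR u) {e : ℕ} (he : e < H.K) (hA : 0 < H.A e u) :
    H.h (H.l (e + 1)) < H.h u :=
  OnL.h_right_lt (H := H.mirror) hu he (by rwa [mirror_B])

/-- `w` lies above the upper segment of the left vertex `c`. -/
def AboveL (H : Frame) (c : ℕ) (w : Pt) : Prop := c < H.K ∧ 0 < H.A c w ∧ H.h (H.l c) < H.h w

/-- `w` lies above the upper segment of the right vertex `c`. -/
def AboveR (H : Frame) (c : ℕ) (w : Pt) : Prop := c < H.M ∧ 0 < H.B c w ∧ H.h (H.r c) < H.h w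

theorem mirror_AboveL {c : ℕ} {w : Pt} : H.mirror.AboveL c w ↔ H.AboveR c w := by
  simp only [AboveL, AboveR, mirror_A]; rfl

theorem mirror_AboveR {c : ℕ} {w : Pt} : H.mirror.AboveR c w ↔ H.AboveL c w := by
  simp only [AboveL, AboveR, mirror_B]; rfl

/-- The regions above the upper segments of one chain are nested, since `A` decreases in the index
for points above the vertices concerned. -/
theorem AboveL.mono {a c : ℕ} {w : Pt} (hw : H.AboveL c w) (hac : a ≤ c) : H.AboveL a w :=
  ⟨hac.trans_lt hw.1, hw.2.1.trans_le (H.A_le_of_ge hac hw.1 hw.2.2.le),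
    (H.h_l_mono hac hw.1.le).trans_lt hw.2.2⟩

theorem AboveL.h_next_lt {c : ℕ} {w : Pt} (hw : H.AboveL c w) (hF : H.InF w) :
    H.h (H.l (c + 1)) < H.h w := by
  by_contra! h
  exact absurd (hF.A_nonpos hw.1 hw.2.2.le h) (not_le.2 hw.2.1)

/-- The upper segment of the last vertex before the apex is the apex itself, and no point of the
funnel is higher; for larger indices `AboveL` fails by definition. -/
theorem not_aboveL_of_last {c : ℕ} {w : Pt} (hF : H.InF w) (hc : H.K ≤ c + 1) :
    ¬ H.AboveL c w := fun hw => by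
  have h1 := hw.h_next_lt hF
  have h2 := hF.h_le
  have : c + 1 = H.K := by have := hw.1; omega
  rw [this] at h1
  linarith

theorem not_aboveR_of_last {c : ℕ} {w : Pt} (hF : H.InF w) (hc : H.M ≤ c + 1) :
    ¬ H.AboveR c w := fun hw =>
  not_aboveL_of_last (H := H.mirror) ((H.mirror_InF w).2 hF) hc (mirror_AboveL.2 hw)

/-- The points of the funnel above the upper segments of a left and of a right vertex. -/
def Upper (H : Frame) (cL cR : Option ℕ) (w : Pt) : Prop :=
  H.InF w ∧ (∀ a ∈ cL, H.AboveL a w) ∧ ∀ b ∈ cR, H.AboveR b w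

theorem mirror_Upper {cL cR : Option ℕ} {w : Pt} :
    H.mirror.Upper cR cL w ↔ H.Upper cL cR w := by
  simp only [Upper, mirror_AboveL, mirror_AboveR, mirror_InF]
  exact and_congr_right fun _ => and_comm

/-- The lower boundary of `H.Upper cL cR` starts on the edge `i` of the left chain and ends on the
edge `j` of the right chain. -/
structure IsFront (H : Frame) (cL cR : Option ℕ) (i j : ℕ) : Prop where
  left_lt : i < H.K
  right_lt : j < H.M
  cL_lt : ∀ a ∈ cL, a < i
  cR_lt : ∀ b ∈ cR, b < j
  cR_above : ∀ b ∈ cR, 0 < H.B b (H.l (i + 1))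
  cL_above : ∀ a ∈ cL, 0 < H.A a (H.r (j + 1))
  -- Edge `i` does not start too high: `l i` is a base vertex, or it fails to be above one of the
  -- two upper segments.
  left_attained : i = 0 ∨ (∃ a ∈ cL, i = a + 1) ∨ ∃ b ∈ cR, H.B b (H.l i) ≤ 0
  right_attained : j = 0 ∨ (∃ b ∈ cR, j = b + 1) ∨ ∃ a ∈ cL, H.A a (H.r j) ≤ 0

namespace IsFront

variable {cL cR : Option ℕ} {i j : ℕ}

theorem mirror (hf : H.IsFront cL cR i j) : H.mirror.IsFront cR cL j i where
  left_lt := hf.right_lt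
  right_lt := hf.left_lt
  cL_lt := hf.cR_lt
  cR_lt := hf.cL_lt
  cR_above a ha := by rw [mirror_B]; exact hf.cL_above a ha
  cL_above b hb := by rw [mirror_A]; exact hf.cR_above b hb
  left_attained := by simp only [mirror_B]; exact hf.right_attained
  right_attained := by simp only [mirror_A]; exact hf.left_attained

/-- Otherwise `w` is beyond the line of edge `i` but not higher than `l i`. This contradicts each
way in which the start of the front is attained; in the third, `A i + B b` is positive at `w` and at
most zero at `l i`. -/
theorem A_nonpos_or (hf : H.IsFront cL cR i j) {w : Pt} (hw : H.Upper cL cR w) :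
    H.A i w ≤ 0 ∨ H.h (H.l i) < H.h w := by
  by_contra! h
  obtain ⟨hA, hh⟩ := h
  rcases hf.left_attained with hi | ⟨a, ha, rfl⟩ | ⟨b, hb, hBl⟩
  · subst hi
    exact absurd (hw.1.A_nonpos hf.left_lt hw.1.1 (hh.trans (H.l_up 0 hf.left_lt).le))
      (not_le.2 hA)
  · have := (hw.2.1 a ha).h_next_lt hw.1
    linarith
  · have h1 := H.A_add_B_le hf.left_lt (hw.2.2 b hb).1 hh
    have h2 := (hw.2.2 b hb).2.1
    rw [H.A_self] at h1
    linarith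

theorem B_nonpos_or (hf : H.IsFront cL cR i j) {w : Pt} (hw : H.Upper cL cR w) :
    H.B j w ≤ 0 ∨ H.h (H.r j) < H.h w := by
  have := hf.mirror.A_nonpos_or (mirror_Upper.2 hw)
  rwa [mirror_A] at this

/-- If `r j` is not above `l (i + 1)`, then edge `i` gives a value no larger than the last left
edge, where it is negative. If it is above, only an attainment of `r j` by a left vertex `a < i`
remains possible, and passing from `a` to `i` makes `A` strictly smaller. -/
theorem A_right_neg_of_lt (hf : H.IsFront cL cR i j) (hh : H.h (H.l i) < H.h (H.r j)) :
    H.A i (H.r j) < 0 := by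
  have hi := hf.left_lt
  have hj := hf.right_lt
  have hr := H.r_up j hj
  have h0 := H.h_r_mono (c := j + 1) (d := H.M) hj le_rfl
  have hF : H.InF (H.r j) := (onR_vertex hj.le).inF
  rcases le_or_gt (H.h (H.r j)) (H.h (H.l (i + 1))) with h1 | h1
  · have hM := H.M_pos
    have h2 := H.mirror.B_last_neg (w := H.r j)
      (by rw [mirror_A]; exact H.B_vertex_nonneg (Nat.sub_lt hM one_pos) hj.le) (hr.trans_le h0)
    rw [mirror_B] at h2
    exact (H.A_le_of_le (Nat.le_sub_one_of_lt hi) (Nat.sub_lt hi.pos one_pos) h1).trans_lt h2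
  · rcases hf.right_attained with h | ⟨b, hb, rfl⟩ | ⟨a, ha, hA⟩
    · subst h
      have := H.h_l_mono (Nat.zero_le i) hi.le
      have := H.base
      linarith
    · have := (H.onL_vertex (Nat.succ_le_of_lt hi)).h_right_lt (f := b) (by omega)
        (hf.cR_above b hb)
      rw [Nat.succ_eq_add_one] at this
      linarith
    · exact (H.A_lt_of_gt (hf.cL_lt a ha) hi hh).trans_le hA

/-- For unequal heights one inequality is `A_right_neg_of_lt`, possibly mirrored, and `A i + B j`
transfers it to the lower of the two vertices. The result places `i` and `j` among the indices over
which the pair of an out-neighbour is maximal. -/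
theorem vertex_neg (hf : H.IsFront cL cR i j) : H.B j (H.l i) < 0 ∧ H.A i (H.r j) < 0 := by
  have hi := hf.left_lt
  have hj := hf.right_lt
  rcases lt_trichotomy (H.h (H.l i)) (H.h (H.r j)) with h | h | h
  · have h1 := hf.A_right_neg_of_lt h
    have h2 := H.A_add_B_lt hi hj h
    rw [H.A_self, H.B_self] at h2
    exact ⟨by linarith, h1⟩
  · have hM := H.M_pos
    have h2 := H.mirror.B_last_neg (w := H.r j)
      (by rw [mirror_A]; exact H.B_vertex_nonneg (Nat.sub_lt hM one_pos) hj.le)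
      ((H.r_up j hj).trans_le (H.h_r_mono (c := j + 1) (d := H.M) hj le_rfl))
    rw [mirror_B] at h2
    have h1 := (H.A_le_of_le (w := H.r j) (Nat.le_sub_one_of_lt hi) (Nat.sub_lt hi.pos one_pos)
      (h ▸ (H.l_up i hi).le)).trans_lt h2
    have h3 := H.A_add_B_le hi hj h.le
    rw [H.A_self, H.B_self] at h3
    exact ⟨by linarith, h1⟩
  · have h1 := hf.mirror.A_right_neg_of_lt h
    rw [mirror_A] at h1
    have h2 := H.A_add_B_lt hi hj h
    rw [H.A_self, H.B_self] at h2
    exact ⟨h1, by change H.B j (H.l i) < 0 at h1; linarith⟩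

/-- The left constraint holds by nesting. The right one already holds at `l (i + 1)` by `cR_above`,
and it persists because `w` is higher and `B b` grows. -/
theorem upper_of_aboveL (hf : H.IsFront cL cR i j) {c : ℕ} {w : Pt} (hF : H.InF w)
    (hw : H.AboveL c w) (hc : i ≤ c) : H.Upper cL cR w := by
  refine ⟨hF, fun a ha => hw.mono ((hf.cL_lt a ha).le.trans hc), fun b hb => ?_⟩
  have hbM : b < H.M := (hf.cR_lt b hb).trans hf.right_lt
  have h1 := (hw.mono hc).h_next_lt hF
  have hl := H.onL_vertex (Nat.succ_le_of_lt hf.left_lt)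
  have h2 := hl.h_right_lt hbM (hf.cR_above b hb)
  have h3 := hl.B_le hF.2.1 hbM h1.le
  have h4 := H.r_up b hbM
  exact ⟨hbM, (hf.cR_above b hb).trans_le h3, by rw [Nat.succ_eq_add_one] at h2; linarith⟩

theorem upper_of_aboveR (hf : H.IsFront cL cR i j) {c : ℕ} {w : Pt} (hF : H.InF w)
    (hw : H.AboveR c w) (hc : j ≤ c) : H.Upper cL cR w :=
  mirror_Upper.1 (hf.mirror.upper_of_aboveL ((H.mirror_InF w).2 hF) (mirror_AboveL.2 hw) hc)

/-- Edge `i` enters the region above the front before its upper end, so some point inside the edge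
has to be guarded. This point is the test point of the lower bound. -/
theorem exists_upper_left (hf : H.IsFront cL cR i j) :
    ∃ c ∈ openSegment ℝ (H.l i) (H.l (i + 1)), H.Upper cL cR c := by
  have hi := hf.left_lt
  obtain ⟨s, hs0, hs1, hs⟩ : ∃ s : ℝ, 0 < s ∧ s < 1 ∧
      ∀ b ∈ cR, 0 < H.B b (s • H.l i + (1 - s) • H.l (i + 1)) := by
    rcases cR with - | b
    · exact ⟨1 / 2, by norm_num, by norm_num, by simp⟩
    · have h1 := hf.cR_above b rfl
      set u := H.B b (H.l i) with hu
      set v := H.B b (H.l (i + 1)) with hv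
      have hd : 0 < |u| + 2 * v := by positivity
      -- The weight of the lower end is so small that the convex combination of `u` and `v` is `v *
      -- (u + |u| + v) / (|u| + 2 * v)`, hence positive whatever the sign of `u`.
      refine ⟨v / (|u| + 2 * v), by positivity, ?_, ?_⟩
      · rw [div_lt_one hd]; linarith [abs_nonneg u]
      · rintro _ ⟨⟩
        rw [H.B_convexComb b (by ring), ← hu, ← hv]
        have : v / (|u| + 2 * v) * u + (1 - v / (|u| + 2 * v)) * v
            = v * (u + |u| + v) / (|u| + 2 * v) := by
          field_simp
          ring
        rw [this]
        have := neg_abs_le u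
        exact div_pos (mul_pos h1 (by linarith)) hd
  set c := s • H.l i + (1 - s) • H.l (i + 1) with hc
  have hc1 : c ∈ openSegment ℝ (H.l i) (H.l (i + 1)) := ⟨s, 1 - s, hs0, by linarith, by ring, rfl⟩
  have hL : H.OnL c := ⟨i, hi, openSegment_subset_segment _ _ _ hc1⟩
  have hh : H.h (H.l i) < H.h c := by
    have := H.l_up i hi
    rw [hc, H.h_convexComb]; nlinarith
  refine ⟨c, hc1, hL.inF, fun a ha => ?_, fun b hb => ?_⟩
  · have hai := hf.cL_lt a ha
    refine ⟨hai.trans hi, ?_, (H.h_l_mono hai.le hi.le).trans_lt hh⟩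
    rw [hc, H.A_convexComb a (by ring)]
    have h1 := H.A_vertex_nonneg (e := a) (c := i) (by omega) hi.le
    have h2 := H.A_vertex_pos (e := a) (c := i + 1) (by omega) hi (by omega) (by omega)
    have h3 : 0 < 1 - s := by linarith
    positivity
  · have hbM : b < H.M := (hf.cR_lt b hb).trans hf.right_lt
    have := hL.h_right_lt hbM (hs b hb)
    exact ⟨hbM, hs b hb, (H.r_up b hbM).trans this⟩

theorem exists_upper_right (hf : H.IsFront cL cR i j) :
    ∃ c ∈ openSegment ℝ (H.r j) (H.r (j + 1)), H.Upper cL cR c := by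
  obtain ⟨c, h1, h2⟩ := hf.mirror.exists_upper_left
  exact ⟨c, h1, mirror_Upper.1 h2⟩

end IsFront

/-! ### Visibility -/

/-- `g` and `w` are both on the inner side of a left edge and of a right edge; then they see each
other. -/
def CommonEdges (H : Frame) (g w : Pt) : Prop :=
  (∃ e < H.K, H.A e g ≤ 0 ∧ H.A e w ≤ 0) ∧ ∃ f < H.M, H.B f g ≤ 0 ∧ H.B f w ≤ 0

theorem mirror_CommonEdges {g w : Pt} : H.mirror.CommonEdges g w ↔ H.CommonEdges g w := by
  simp only [CommonEdges, mirror_A, mirror_B]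
  exact and_comm

/-- The edge is the one that starts at the topmost vertex not above `w`, with the index capped at
the last edge; being topmost, it is not before `i`. -/
theorem exists_A_nonpos_of_ge {w : Pt} (hw : H.InF w) {i : ℕ} (hi : i < H.K)
    (hh : H.h (H.l i) ≤ H.h w) : ∃ e < H.K, i ≤ e ∧ H.h (H.l e) ≤ H.h w ∧ H.A e w ≤ 0 := by
  classical
  set P : ℕ → Prop := fun e => H.h (H.l e) ≤ H.h w
  have hK := H.K_pos
  set e := Nat.findGreatest P (H.K - 1) with he
  have h1 : e ≤ H.K - 1 := Nat.findGreatest_le _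
  have h2 : i ≤ e := Nat.le_findGreatest (by omega) hh
  have h3 : P e := Nat.findGreatest_spec (P := P) (m := i) (by omega) hh
  refine ⟨e, by omega, h2, h3, hw.A_nonpos (by omega) h3 ?_⟩
  by_cases h4 : e + 1 = H.K
  · rw [h4]; exact hw.h_le
  · exact (not_le.1 (Nat.findGreatest_is_greatest (P := P) (n := H.K - 1) (k := e + 1) (by omega)
      (by omega))).le

theorem exists_B_nonpos_of_ge {w : Pt} (hw : H.InF w) {j : ℕ} (hj : j < H.M)
    (hh : H.h (H.r j) ≤ H.h w) : ∃ f < H.M, j ≤ f ∧ H.h (H.r f) ≤ H.h w ∧ H.B f w ≤ 0 := by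
  have := exists_A_nonpos_of_ge ((H.mirror_InF w).2 hw) hj hh
  simp only [mirror_A] at this
  exact this

namespace IsFront

variable {cL cR : Option ℕ} {i j : ℕ}

/-- If edge `j` does not serve, `w` is above `r j`, and the edge `f ≥ j` at the height of `w` is
used. When `l c` is at least as high as `w`, `B f` is at most `B j` there. When it is lower, `A c +
B f` is nonpositive at `w`, hence also at `l c`, where `A c` vanishes. -/
theorem exists_common_right (hf : H.IsFront cL cR i j) {w : Pt} (hw : H.Upper cL cR w) {c : ℕ}
    (hB : H.B j (H.l c) ≤ 0) (hcw : H.h w ≤ H.h (H.l c) ∨ c < H.K ∧ H.A c w ≤ 0) :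
    ∃ f < H.M, H.B f (H.l c) ≤ 0 ∧ H.B f w ≤ 0 := by
  rcases hf.B_nonpos_or hw with h | h
  · exact ⟨j, hf.right_lt, hB, h⟩
  obtain ⟨f, hfM, hjf, hrf, hBf⟩ := exists_B_nonpos_of_ge hw.1 hf.right_lt h.le
  refine ⟨f, hfM, ?_, hBf⟩
  rcases le_total (H.h w) (H.h (H.l c)) with hh | hh
  · exact (H.B_le_of_ge hjf hfM (hrf.trans hh)).trans hB
  · rcases hcw with hc | ⟨hcK, hA⟩
    · exact (H.B_le_of_ge hjf hfM (hrf.trans hc)).trans hB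
    · have := H.A_add_B_le hcK hfM hh
      rw [H.A_self] at this
      linarith

theorem sees_left (hf : H.IsFront cL cR i j) {w : Pt} (hw : H.Upper cL cR w)
    (hn : ¬ H.AboveL i w) : H.CommonEdges (H.l i) w := by
  have hA : H.A i w ≤ 0 := by
    rcases hf.A_nonpos_or hw with h | h
    · exact h
    · by_contra h'
      exact hn ⟨hf.left_lt, not_le.1 h', h⟩
  exact ⟨⟨i, hf.left_lt, (H.A_self i).le, hA⟩,
    hf.exists_common_right hw hf.vertex_neg.1.le (Or.inr ⟨hf.left_lt, hA⟩)⟩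

/-- Points beyond the line of edge `i + 1`, or all points if there is no such edge, are not higher
than `l (i + 1)` by `hn` or because it is the apex. For them edge `i` serves as the common left
edge. -/
theorem sees_left_succ (hf : H.IsFront cL cR i j) {w : Pt} (hw : H.Upper cL cR w)
    (hB : H.B j (H.l (i + 1)) ≤ 0) (hn : ¬ H.AboveL (i + 1) w) :
    H.CommonEdges (H.l (i + 1)) w := by
  have hi := hf.left_lt
  by_cases h : i + 1 < H.K ∧ H.A (i + 1) w ≤ 0
  · exact ⟨⟨i + 1, h.1, (H.A_self _).le, h.2⟩, hf.exists_common_right hw hB (Or.inr h)⟩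
  have hh : H.h w ≤ H.h (H.l (i + 1)) := by
    by_cases h1 : i + 1 < H.K
    · by_contra! h2
      exact hn ⟨h1, not_le.1 fun h3 => h ⟨h1, h3⟩, h2⟩
    · have : i + 1 = H.K := by omega
      rw [this]; exact hw.1.h_le
  refine ⟨⟨i, hi, (H.A_next hi).le, ?_⟩, hf.exists_common_right hw hB (Or.inl hh)⟩
  rcases hf.A_nonpos_or hw with h1 | h1
  · exact h1
  · exact hw.1.A_nonpos hi h1.le hh

/-- Unless `w` is seen by the left vertex `a` of a pair or is above its upper segment, it lies in
the pocket below that vertex. -/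
theorem sees_or_pocket (hf : H.IsFront cL cR i j) {w : Pt} (hw : H.Upper cL cR w) {a : ℕ}
    (hia : i ≤ a) (ha : a < H.K) (hB : H.B j (H.l a) ≤ 0) (hn : ¬ H.AboveL a w) :
    H.CommonEdges (H.l a) w ∨ i < a ∧ H.h w ≤ H.h (H.l a) ∧ 0 < H.A (a - 1) w := by
  by_cases hA : H.A a w ≤ 0
  · exact Or.inl ⟨⟨a, ha, (H.A_self a).le, hA⟩, hf.exists_common_right hw hB (Or.inr ⟨ha, hA⟩)⟩
  have hh : H.h w ≤ H.h (H.l a) := by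
    by_contra! h
    exact hn ⟨ha, not_le.1 hA, h⟩
  have hne : i < a := by
    rcases hia.lt_or_eq with h | h
    · exact h
    · subst h
      rcases hf.A_nonpos_or hw with h | h
      · exact absurd h hA
      · exact absurd h (not_lt.2 hh)
  by_cases hA' : H.A (a - 1) w ≤ 0
  · have := H.A_next (e := a - 1) (by omega)
    rw [Nat.sub_add_cancel (by omega)] at this
    exact Or.inl ⟨⟨a - 1, by omega, this.le, hA'⟩, hf.exists_common_right hw hB (Or.inl hh)⟩
  · exact Or.inr ⟨hne, hh, not_le.1 hA'⟩

/-- In the pocket, `A (a - 1) + B b` would be positive at `w`, but it is nonpositive at the higher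
point `l a`. Hence a point missed by the left guard is not above the right tangent, and the pocket
argument applies to the right guard too. -/
theorem not_pocket_of_aboveR {w : Pt} {a b : ℕ} (hi : 0 < a) (ha : a < H.K)
    (hj : j ≤ b) (hBa : H.B j (H.l a) ≤ 0) (hh : H.h w ≤ H.h (H.l a))
    (hA : 0 < H.A (a - 1) w) : ¬ H.AboveR b w := fun hb => by
  have h1 := H.A_add_B_le (e := a - 1) (f := b) (by omega) hb.1 hh
  have h2 := H.A_next (e := a - 1) (by omega)
  rw [Nat.sub_add_cancel (by omega)] at h2
  have h3 := H.B_le_of_ge hj hb.1 (hb.2.2.le.trans hh)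
  have h4 := hb.2.1
  linarith

/-- `A (a - 1) + B (b - 1)` is positive at `w`, hence at `l a` and at `r b`, where one summand
vanishes. As `B j` is negative at `l a`, this forces `l a` below `r (b - 1)`; symmetrically, `r b`
is below `l (a - 1)`. Going up the chains closes a strict cycle of heights. -/
theorem not_both_pockets {w : Pt} {a b : ℕ} (hia : i < a) (ha : a < H.K)
    (hjb : j < b) (hb : b < H.M) (hBa : H.B j (H.l a) < 0) (hAb : H.A i (H.r b) < 0)
    (hha : H.h w ≤ H.h (H.l a)) (hhb : H.h w ≤ H.h (H.r b)) (hA : 0 < H.A (a - 1) w)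
    (hB : 0 < H.B (b - 1) w) : False := by
  have ha' : a - 1 < H.K := by omega
  have hb' : b - 1 < H.M := by omega
  have h1 := H.A_add_B_le ha' hb' hha
  have h2 := H.A_next ha'
  have h3 := H.A_add_B_le ha' hb' hhb
  have h4 := H.B_next hb'
  have h5 := H.l_up _ ha'
  have h6 := H.r_up _ hb'
  rw [Nat.sub_add_cancel (by omega)] at h2 h4 h5 h6
  have h7 : H.h (H.l a) < H.h (H.r (b - 1)) := by
    by_contra! h
    have := H.B_le_of_ge (f := j) (by omega) hb' h
    linarith
  have h8 : H.h (H.r b) < H.h (H.l (a - 1)) := by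
    by_contra! h
    have := H.A_le_of_ge (e := i) (by omega) ha' h
    linarith
  linarith

theorem sees_pair_aux (hf : H.IsFront cL cR i j) {w : Pt} (hw : H.Upper cL cR w) {a b : ℕ}
    (hia : i ≤ a) (ha : a < H.K) (hjb : j ≤ b) (hb : b < H.M) (hBa : H.B j (H.l a) < 0)
    (hAb : H.A i (H.r b) < 0) (hn : ¬ H.AboveL a w) :
    H.CommonEdges (H.l a) w ∨ H.CommonEdges (H.r b) w := by
  rcases hf.sees_or_pocket hw hia ha hBa.le hn with h | ⟨h1, h2, h3⟩
  · exact Or.inl h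
  have hnb := not_pocket_of_aboveR (b := b) (by omega) ha hjb hBa.le h2 h3
  rcases hf.mirror.sees_or_pocket (mirror_Upper.2 hw) hjb hb
    (by rw [mirror_B]; exact hAb.le) (fun h => hnb (mirror_AboveL.1 h)) with h | ⟨h4, h5, h6⟩
  · exact Or.inr (mirror_CommonEdges.1 h)
  · rw [mirror_A] at h6
    exact (not_both_pockets h1 ha h4 hb hBa hAb h2 h5 h3 h6).elim

theorem sees_pair (hf : H.IsFront cL cR i j) {w : Pt} (hw : H.Upper cL cR w) {a b : ℕ}
    (hia : i ≤ a) (ha : a < H.K) (hjb : j ≤ b) (hb : b < H.M) (hBa : H.B j (H.l a) < 0)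
    (hAb : H.A i (H.r b) < 0) (hn : ¬ (H.AboveL a w ∧ H.AboveR b w)) :
    H.CommonEdges (H.l a) w ∨ H.CommonEdges (H.r b) w := by
  by_cases h : H.AboveL a w
  · have h' : ¬ H.mirror.AboveL b w := fun h2 => hn ⟨h, mirror_AboveL.1 h2⟩
    have := hf.mirror.sees_pair_aux (mirror_Upper.2 hw) hjb hb hia ha
      (by rw [mirror_B]; exact hAb) (by rw [mirror_A]; exact hBa) h'
    rw [mirror_CommonEdges, mirror_CommonEdges] at this
    exact this.symm
  · exact hf.sees_pair_aux hw hia ha hjb hb hBa hAb h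

end IsFront

/-! ### Sufficient and necessary conditions for visibility. -/

/-- The half-planes of the two edges and that of the base are convex, and their intersection lies in
the funnel. -/
theorem CommonEdges.segment_inF {g w : Pt} (hgw : H.CommonEdges g w)
    (hg : H.InF g) (hw : H.InF w) : ∀ u ∈ segment ℝ g w, H.InF u := by
  rintro _ ⟨a, b, ha, hb, hab, rfl⟩
  obtain ⟨⟨e, he, h1, h2⟩, f, hf, h3, h4⟩ := hgw
  refine ⟨?_, ⟨e, he, ?_⟩, f, hf, ?_⟩
  · rw [H.h_convexComb]
    have h1 := mul_le_mul_of_nonneg_left hg.1 ha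
    have h2 := mul_le_mul_of_nonneg_left hw.1 hb
    have : H.h (H.l 0) = a * H.h (H.l 0) + b * H.h (H.l 0) := by rw [← add_mul, hab, one_mul]
    linarith
  · rw [H.A_convexComb e hab]
    have := mul_nonpos_of_nonneg_of_nonpos ha h1
    have := mul_nonpos_of_nonneg_of_nonpos hb h2
    linarith
  · rw [H.B_convexComb f hab]
    have := mul_nonpos_of_nonneg_of_nonpos ha h3
    have := mul_nonpos_of_nonneg_of_nonpos hb h4
    linarith

/-- A point that sees the left edge `i` from within the funnel is not above the line through it. -/
theorem A_nonpos_of_sees {g c : Pt} (hs : ∀ u ∈ segment ℝ g c, H.InF u) {i : ℕ} (hi : i < H.K)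
    (hc : H.A i c = 0) (h1 : H.h c < H.h (H.l (i + 1)))
    (h2 : H.h (H.l i) < H.h c ∨ H.h (H.l i) = H.h c ∧ H.h c ≤ H.h g) : H.A i g ≤ 0 := by
  obtain ⟨s, hs0, hs1, hlo, hhi⟩ : ∃ s : ℝ, 0 < s ∧ s ≤ 1 ∧
      H.h (H.l i) ≤ s * H.h g + (1 - s) * H.h c ∧
      s * H.h g + (1 - s) * H.h c ≤ H.h (H.l (i + 1)) := by
    -- A short step from `c` towards `g` stays within the heights of edge `i`. There the funnel
    -- satisfies `A i ≤ 0`, and since `A i` vanishes at `c`, its value is a positive multiple of `A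
    -- i g`.
    have key : ∀ m : ℝ, 0 < m → ∃ s : ℝ, 0 < s ∧ s ≤ 1 ∧ |s * (H.h g - H.h c)| ≤ m := by
      intro m hm
      have hd : 0 < m + |H.h g - H.h c| := by positivity
      refine ⟨m / (m + |H.h g - H.h c|), by positivity, ?_, ?_⟩
      · rw [div_le_one hd]; linarith [abs_nonneg (H.h g - H.h c)]
      · rw [abs_mul, abs_of_pos (by positivity), div_mul_eq_mul_div, div_le_iff₀ hd]
        nlinarith
    rcases h2 with h2 | ⟨h2, h3⟩
    · obtain ⟨s, a, b, d⟩ := key (min (H.h c - H.h (H.l i)) (H.h (H.l (i + 1)) - H.h c))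
        (lt_min (by linarith) (by linarith))
      have d1 := d.trans (min_le_left _ _)
      have d2 := d.trans (min_le_right _ _)
      rw [abs_le] at d1 d2
      exact ⟨s, a, b, by linarith [d1.1], by linarith [d2.2]⟩
    · obtain ⟨s, a, b, d⟩ := key (H.h (H.l (i + 1)) - H.h c) (by linarith)
      rw [abs_le] at d
      have := mul_nonneg a.le (sub_nonneg.2 h3)
      exact ⟨s, a, b, by linarith, by linarith [d.2]⟩
  have hu := hs (s • g + (1 - s) • c) ⟨s, 1 - s, hs0.le, by linarith, by ring, rfl⟩
  have := hu.A_nonpos hi (by rwa [H.h_convexComb]) (by rwa [H.h_convexComb])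
  rw [H.A_convexComb i (by ring), hc, mul_zero, add_zero] at this
  exact nonpos_of_mul_nonpos_right this hs0

theorem A_nonpos_of_sees_openSegment {g c : Pt} (hs : ∀ u ∈ segment ℝ g c, H.InF u) {i : ℕ}
    (hi : i < H.K) (hc : c ∈ openSegment ℝ (H.l i) (H.l (i + 1))) : H.A i g ≤ 0 := by
  obtain ⟨a, b, ha, hb, hab, rfl⟩ := hc
  have hu := H.l_up i hi
  refine A_nonpos_of_sees hs hi ?_ ?_ (Or.inl ?_)
  · rw [H.A_convexComb i hab, H.A_self, H.A_next hi]; ring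
  · rw [H.h_convexComb]
    obtain rfl : b = 1 - a := by linarith
    nlinarith
  · rw [H.h_convexComb]
    obtain rfl : a = 1 - b := by linarith
    nlinarith

theorem AboveL.not_sees {c : ℕ} {w : Pt} (hw : H.AboveL c w) :
    ¬ ∀ u ∈ segment ℝ (H.l c) w, H.InF u := fun hs => by
  rw [segment_symm] at hs
  exact absurd (A_nonpos_of_sees hs hw.1 (H.A_self c) (H.l_up c hw.1) (Or.inr ⟨rfl, hw.2.2.le⟩))
    (not_le.2 hw.2.1)

theorem B_nonpos_of_sees_openSegment {g c : Pt} (hs : ∀ u ∈ segment ℝ g c, H.InF u) {j : ℕ}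
    (hj : j < H.M) (hc : c ∈ openSegment ℝ (H.r j) (H.r (j + 1))) : H.B j g ≤ 0 := by
  rw [← mirror_A]
  exact A_nonpos_of_sees_openSegment (fun u hu => (H.mirror_InF u).2 (hs u hu)) hj hc

theorem AboveR.not_sees {c : ℕ} {w : Pt} (hw : H.AboveR c w) :
    ¬ ∀ u ∈ segment ℝ (H.r c) w, H.InF u := fun hs =>
  (mirror_AboveL.2 hw).not_sees fun u hu => (H.mirror_InF u).2 (hs u hu)

end Frame
end FunnelGuarding

namespace FunnelGuarding

namespace Frame

/-! ### The region of a funnel -/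

variable (H : Frame)

/-- The boundary of the funnel. -/
def bdry : Set Pt := {w | H.OnL w} ∪ {w | H.OnR w} ∪ segment ℝ (H.l 0) (H.r 0)

/-- The interior of the funnel. -/
def inner : Set Pt :=
  {w | H.h (H.l 0) < H.h w ∧ (∃ e < H.K, H.A e w < 0) ∧ ∃ f < H.M, H.B f w < 0}

theorem continuous_A (e : ℕ) : Continuous (H.A e) := by
  unfold A; fun_prop

theorem continuous_B (f : ℕ) : Continuous (H.B f) := by
  unfold B; fun_prop

theorem isOpen_inner : IsOpen H.inner := by
  have h1 : IsOpen {w | H.h (H.l 0) < H.h w} := isOpen_lt continuous_const H.h.continuous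
  have h2 : IsOpen {w | ∃ e < H.K, H.A e w < 0} := by
    have : {w | ∃ e < H.K, H.A e w < 0} = ⋃ e ∈ Set.Iio H.K, {w | H.A e w < 0} := by
      ext w; simp
    rw [this]
    exact isOpen_biUnion fun e _ => isOpen_lt (H.continuous_A e) continuous_const
  have h3 : IsOpen {w | ∃ f < H.M, H.B f w < 0} := by
    have : {w | ∃ f < H.M, H.B f w < 0} = ⋃ f ∈ Set.Iio H.M, {w | H.B f w < 0} := by
      ext w; simp
    rw [this]
    exact isOpen_biUnion fun f _ => isOpen_lt (H.continuous_B f) continuous_const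
  exact h1.inter (h2.inter h3)

theorem isClosed_inF : IsClosed {w | H.InF w} := by
  have h1 : IsClosed {w | H.h (H.l 0) ≤ H.h w} := isClosed_le continuous_const H.h.continuous
  have h2 : IsClosed {w | ∃ e < H.K, H.A e w ≤ 0} := by
    have : {w | ∃ e < H.K, H.A e w ≤ 0} = ⋃ e ∈ Set.Iio H.K, {w | H.A e w ≤ 0} := by
      ext w; simp
    rw [this]
    exact (Set.finite_Iio _).isClosed_biUnion fun e _ =>
      isClosed_le (H.continuous_A e) continuous_const
  have h3 : IsClosed {w | ∃ f < H.M, H.B f w ≤ 0} := by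
    have : {w | ∃ f < H.M, H.B f w ≤ 0} = ⋃ f ∈ Set.Iio H.M, {w | H.B f w ≤ 0} := by
      ext w; simp
    rw [this]
    exact (Set.finite_Iio _).isClosed_biUnion fun f _ =>
      isClosed_le (H.continuous_B f) continuous_const
  exact h1.inter (h2.inter h3)

theorem inner_subset : H.inner ⊆ {w | H.InF w} := by
  rintro w ⟨h1, ⟨e, he, h2⟩, f, hf, h3⟩
  exact ⟨h1.le, ⟨e, he, h2.le⟩, f, hf, h3.le⟩

variable {H}

theorem mem_segment_of_coords {u v w : Pt} {s : ℝ} (h0 : 0 ≤ s) (h1 : s ≤ 1)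
    (hx : H.x w = (1 - s) * H.x u + s * H.x v) (hh : H.h w = (1 - s) * H.h u + s * H.h v) :
    w ∈ segment ℝ u v := by
  refine ⟨1 - s, s, by linarith, h0, by ring, ?_⟩
  apply H.inj
  · simp only [map_add, map_smul, smul_eq_mul, hx]
  · simp only [map_add, map_smul, smul_eq_mul, hh]

/-- For the edge starting at the topmost vertex not above `w`, both signs force `A e w = 0`. Above
its upper end the next edge would give a negative value. -/
theorem onL_of_A_nonneg {w : Pt} (hw : H.InF w) (hA : ∀ e < H.K, 0 ≤ H.A e w) : H.OnL w := by
  obtain ⟨e, he, -, h1, h2⟩ := exists_A_nonpos_of_ge hw H.K_pos hw.1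
  have h4 := H.l_up e he
  by_cases h3 : H.h w ≤ H.h (H.l (e + 1))
  · have h5 : H.A e w = 0 := le_antisymm h2 (hA e he)
    have hd : H.h (H.l (e + 1)) - H.h (H.l e) ≠ 0 := by linarith
    refine ⟨e, he, mem_segment_of_coords (H := H)
      (s := (H.h w - H.h (H.l e)) / (H.h (H.l (e + 1)) - H.h (H.l e)))
      (div_nonneg (by linarith) (by linarith)) ((div_le_one (by linarith)).2 (by linarith)) ?_ ?_⟩
    · have h6 := H.l_edge e he
      simp only [A] at h5
      rw [h6]
      field_simp
      linear_combination -(H.h (H.l (e + 1)) - H.h (H.l e)) * h5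
    · field_simp
      ring
  · exfalso
    push Not at h3
    have h5 : e + 1 < H.K := by
      by_contra h
      have : e + 1 = H.K := by omega
      rw [this] at h3
      exact absurd hw.h_le (not_le.2 h3)
    have := H.A_lt_of_gt (Nat.lt_succ_self e) h5 h3
    have := hA _ h5
    simp only [Nat.succ_eq_add_one] at *
    linarith

theorem onR_of_B_nonneg {w : Pt} (hw : H.InF w) (hB : ∀ f < H.M, 0 ≤ H.B f w) : H.OnR w :=
  onL_of_A_nonneg (H := H.mirror) ((H.mirror_InF w).2 hw) fun f hf => by
    rw [mirror_A]; exact hB f hf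

theorem base_x_lt : H.x (H.l 0) < H.x (H.r 0) := by
  have hK := H.K_pos
  have hM := H.M_pos
  have h1 := H.B_last_neg (w := H.l 0) (H.A_vertex_nonneg (by omega) (by omega))
    (H.h_l_strictMono hK le_rfl)
  have h2 := H.mirror.A_le_of_le (e := 0) (e' := H.M - 1) (w := H.l 0) (by omega)
    (Nat.sub_lt hM one_pos) (H.base.le.trans (H.r_up 0 hM).le)
  rw [mirror_A, mirror_A] at h2
  have h3 : H.B 0 (H.l 0) < 0 := by linarith
  simp only [B, H.base] at h3
  linarith

theorem inF_subset : {w | H.InF w} ⊆ H.inner ∪ H.bdry := by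
  intro w hw
  by_cases hL : H.OnL w
  · exact Or.inr (Or.inl (Or.inl hL))
  by_cases hR : H.OnR w
  · exact Or.inr (Or.inl (Or.inr hR))
  rcases hw.1.lt_or_eq with h | h
  · left
    refine ⟨h, ?_, ?_⟩
    · by_contra! h'
      exact hL (onL_of_A_nonneg hw h')
    · by_contra! h'
      exact hR (onR_of_B_nonneg hw h')
  · right; right
    have h1 := hw.A_nonpos H.K_pos h.le (h.symm.le.trans (H.l_up 0 H.K_pos).le)
    have h2 := hw.B_nonpos H.M_pos (H.base ▸ h.le) (h.symm.le.trans
      (H.base.le.trans (H.r_up 0 H.M_pos).le))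
    have hb := base_x_lt (H := H)
    simp only [A, B, ← H.base, ← h] at h1 h2
    have hd : H.x (H.r 0) - H.x (H.l 0) ≠ 0 := by linarith
    refine mem_segment_of_coords (H := H)
      (s := (H.x w - H.x (H.l 0)) / (H.x (H.r 0) - H.x (H.l 0)))
      (div_nonneg (by linarith) (by linarith)) ((div_le_one (by linarith)).2 (by linarith)) ?_ ?_
    · field_simp
      ring
    · rw [← H.base, ← h]; ring

theorem bdry_subset : H.bdry ⊆ {w | H.InF w} := by
  rintro w ((hw | hw) | hw)
  · exact OnL.inF hw
  · exact OnR.inF hw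
  · have hK := H.K_pos
    have hM := H.M_pos
    have hc : H.CommonEdges (H.l 0) (H.r 0) := by
      have hb := base_x_lt (H := H)
      refine ⟨⟨0, hK, (H.A_self 0).le, ?_⟩, 0, hM, ?_, (H.B_self 0).le⟩
      · simp only [A, H.base]; linarith
      · simp only [B, H.base]; linarith
    exact hc.segment_inF (H.onL_vertex (Nat.zero_le _)).inF (onR_vertex (Nat.zero_le _)).inF w hw

theorem inner_disjoint_bdry {w : Pt} (hw : w ∈ H.inner) : w ∉ H.bdry := by
  obtain ⟨h1, ⟨e, he, h2⟩, f, hf, h3⟩ := hw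
  rintro ((hw | hw) | ⟨a, b, ha, hb, hab, rfl⟩)
  · exact absurd (OnL.A_nonneg hw he) (not_le.2 h2)
  · have := OnL.A_nonneg (H := H.mirror) hw hf
    rw [mirror_A] at this
    linarith
  · rw [H.h_convexComb, ← H.base, ← add_mul, hab, one_mul] at h1
    exact lt_irrefl _ h1

/-- In the coordinates `(x, h)` each pair of edges confines the funnel to a box, and there are
finitely many pairs. Injectivity of the coordinates makes them a linear isomorphism, whose inverse
preserves boundedness. -/
theorem isBounded_inF : Bornology.IsBounded {w | H.InF w} := by
  let φ : Pt →L[ℝ] Pt := H.x.prod H.h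
  have hφ : Function.Injective φ := fun p q hpq =>
    H.inj p q (congrArg Prod.fst hpq) (congrArg Prod.snd hpq)
  let ψ : Pt ≃L[ℝ] Pt := (LinearEquiv.ofInjectiveEndo φ.toLinearMap hφ).toContinuousLinearEquiv
  have hψ : ∀ p, ψ p = (H.x p, H.h p) := fun p => rfl
  have hbox : Bornology.IsBounded (⋃ e ∈ Set.Iio H.K, ⋃ f ∈ Set.Iio H.M,
      (Set.Icc (-(|H.x (H.l e)| + |H.sa e| * (H.h (H.l H.K) - H.h (H.l 0))))
        (|H.x (H.r f)| + |H.sb f| * (H.h (H.l H.K) - H.h (H.l 0))) ×ˢ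
      Set.Icc (H.h (H.l 0)) (H.h (H.l H.K)) : Set Pt)) := by
    refine (Bornology.isBounded_biUnion (Set.finite_Iio _)).2 fun e _ =>
      (Bornology.isBounded_biUnion (Set.finite_Iio _)).2 fun f _ => ?_
    exact (Metric.isBounded_Icc _ _).prod (Metric.isBounded_Icc _ _)
  refine (ψ.symm.lipschitz.isBounded_image hbox).subset ?_
  intro w hw
  refine ⟨ψ w, ?_, ψ.symm_apply_apply w⟩
  have hh := InF.h_le hw
  obtain ⟨h0, ⟨e, he, h1⟩, f, hf, h2⟩ := hw
  simp only [Set.mem_iUnion]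
  refine ⟨e, he, f, hf, ?_, h0, hh⟩
  rw [hψ]
  simp only [A, B] at h1 h2
  have key : ∀ (s v : ℝ), H.h (H.l 0) ≤ v → v ≤ H.h (H.l H.K) →
      |s * (H.h w - v)| ≤ |s| * (H.h (H.l H.K) - H.h (H.l 0)) := by
    intro s v hv1 hv2
    rw [abs_mul]
    refine mul_le_mul_of_nonneg_left ?_ (abs_nonneg s)
    rw [abs_le]; constructor <;> linarith
  have k1 := key (H.sa e) (H.h (H.l e)) (H.h_l_mono (Nat.zero_le e) he.le) (H.h_l_mono he.le le_rfl)
  have k2 := key (H.sb f) (H.h (H.r f)) (H.base ▸ H.h_r_mono (Nat.zero_le f) hf.le)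
    (H.apex ▸ H.h_r_mono hf.le le_rfl)
  rw [abs_le] at k1 k2
  have k3 := neg_abs_le (H.x (H.l e))
  have k4 := le_abs_self (H.x (H.r f))
  constructor <;> linarith [k1.1, k1.2, k2.1, k2.2]

theorem not_isBounded_ray {d : Pt} (hd : d ≠ 0) (w : Pt) :
    ¬ Bornology.IsBounded ((fun s : ℝ => w + s • d) '' Set.Ici 0) := fun hb => by
  obtain ⟨C, hC⟩ := hb.exists_norm_le
  have hd' : 0 < ‖d‖ := norm_pos_iff.2 hd
  have hC0 : 0 ≤ C := (norm_nonneg _).trans (hC _ ⟨0, by simp, rfl⟩)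
  have h1 := hC _ ⟨(C + ‖w‖ + 1) / ‖d‖, by simp only [Set.mem_Ici]; positivity, rfl⟩
  have h2 : ‖((C + ‖w‖ + 1) / ‖d‖) • d‖ = C + ‖w‖ + 1 := by
    rw [norm_smul, Real.norm_of_nonneg (by positivity), div_mul_cancel₀ _ hd'.ne']
  have h3 := norm_le_norm_add_norm_sub' (((C + ‖w‖ + 1) / ‖d‖) • d)
    (w + ((C + ‖w‖ + 1) / ‖d‖) • d)
  have h4 : ‖((C + ‖w‖ + 1) / ‖d‖) • d - (w + ((C + ‖w‖ + 1) / ‖d‖) • d)‖ = ‖w‖ := by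
    rw [← norm_neg]; congr 1; abel
  linarith

/-- Downwards below the base; to the left if all `A e` are positive; to the right if all `B f` are.
The violated condition only becomes worse along the ray. -/
theorem exists_escaping_ray {w : Pt} (hw : ¬ H.InF w) :
    ∃ d : Pt, d ≠ 0 ∧ ∀ s : ℝ, 0 ≤ s → ¬ H.InF (w + s • d) := by
  obtain ⟨d, hd, hd'⟩ := H.dir_x
  have hd0 : d ≠ 0 := by rintro rfl; simp at hd
  by_cases h1 : H.h (H.l 0) ≤ H.h w
  · by_cases h2 : ∃ e < H.K, H.A e w ≤ 0
    · have h3 : ∀ f < H.M, 0 < H.B f w := by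
        by_contra! h
        exact hw ⟨h1, h2, h⟩
      refine ⟨d, hd0, fun s hs h4 => ?_⟩
      obtain ⟨-, -, f, hf, h5⟩ := h4
      have := h3 f hf
      simp only [B, map_add, map_smul, smul_eq_mul, hd'] at h5 this
      nlinarith
    · push Not at h2
      refine ⟨-d, neg_ne_zero.2 hd0, fun s hs h4 => ?_⟩
      obtain ⟨-, ⟨e, he, h5⟩, -⟩ := h4
      have := h2 e he
      simp only [A, map_add, map_smul, map_neg, smul_eq_mul, hd'] at h5 this
      nlinarith
  · obtain ⟨c, hc⟩ := H.dir_h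
    refine ⟨c, by rintro rfl; simp at hc, fun s hs h4 => h1 ?_⟩
    have := h4.1
    simp only [map_add, map_smul, smul_eq_mul] at this
    nlinarith

/-- A point outside the funnel lies on a ray that avoids it, so its component is unbounded. Off the
boundary the plane is split into the open interior and the open exterior, so the component of an
interior point cannot leave the bounded interior. -/
theorem enclosedRegion_bdry : enclosedRegion H.bdry = {w | H.InF w} := by
  ext w
  constructor
  · rintro (hw | ⟨hw, hb⟩)
    · exact bdry_subset hw
    · by_contra hF
      obtain ⟨d, hd, hray⟩ := exists_escaping_ray hF
      refine not_isBounded_ray hd w (hb.subset ?_)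
      refine IsPreconnected.subset_connectedComponentIn ?_ ⟨0, by simp, by simp⟩ ?_
      · exact isPreconnected_Ici.image _ (by fun_prop)
      · rintro _ ⟨s, hs, rfl⟩ hmem
        exact hray s hs (bdry_subset hmem)
  · intro hw
    rcases inF_subset hw with h | h
    · right
      refine ⟨inner_disjoint_bdry h, (isBounded_inF (H := H)).subset ?_⟩
      refine Set.Subset.trans ?_ H.inner_subset
      refine IsPreconnected.subset_left_of_subset_union H.isOpen_inner H.isClosed_inF.isOpen_compl
        (Set.disjoint_left.2 fun v hv hv' => hv' (H.inner_subset hv)) ?_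
        ⟨w, mem_connectedComponentIn (inner_disjoint_bdry h), h⟩ isPreconnected_connectedComponentIn
      intro v hv
      have hv' := connectedComponentIn_subset _ _ hv
      by_cases hvF : H.InF v
      · exact Or.inl ((inF_subset hvF).resolve_right hv')
      · exact Or.inr hvF
    · exact Or.inl h

end Frame

/-! ### The frame of a funnel -/

/-- The coordinate along the vector `b`. -/
def along (b : Pt) : Pt →L[ℝ] ℝ :=
  b.1 • ContinuousLinearMap.fst ℝ ℝ ℝ + b.2 • ContinuousLinearMap.snd ℝ ℝ ℝ

theorem along_apply (b p : Pt) : along b p = b.1 * p.1 + b.2 * p.2 := by simp [along]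

/-- The coordinate perpendicular to the vector `b`. -/
def across (b : Pt) : Pt →L[ℝ] ℝ := along (-b.2, b.1)

theorem across_apply (b p : Pt) : across b p = b.1 * p.2 - b.2 * p.1 := by
  simp only [across, along_apply]; ring

/-- The change to base coordinates is a rotation combined with a scaling, up to the orientation of
the axes; it multiplies areas by the square of the base length. No normalisation of the base vector
is needed. -/
theorem cross_eq_coords (b u v w : Pt) :
    (b.1 ^ 2 + b.2 ^ 2) * cross u v w = (along b v - along b u) * (across b w - across b u)
      - (across b v - across b u) * (along b w - along b u) := by
  simp only [along_apply, across_apply, cross]; ring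

theorem slope_lt {b u v w : Pt} (h1 : across b u < across b v) (h2 : across b v < across b w)
    (hc : 0 < cross u v w) :
    (along b w - along b v) / (across b w - across b v)
      < (along b v - along b u) / (across b v - across b u) := by
  have hb : 0 < b.1 ^ 2 + b.2 ^ 2 := by
    rcases (by positivity : 0 ≤ b.1 ^ 2 + b.2 ^ 2).lt_or_eq with h | h
    · exact h
    · have h3 : b.1 = 0 := by nlinarith [sq_nonneg b.1, sq_nonneg b.2]
      have h4 : b.2 = 0 := by nlinarith [sq_nonneg b.1, sq_nonneg b.2]
      simp [across_apply, h3, h4] at h1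
  have := cross_eq_coords b u v w
  have := mul_pos hb hc
  rw [div_lt_div_iff₀ (by linarith) (by linarith)]
  nlinarith

theorem lt_slope {b u v w : Pt} (h1 : across b u < across b v) (h2 : across b v < across b w)
    (hc : cross u v w < 0) :
    (along b v - along b u) / (across b v - across b u)
      < (along b w - along b v) / (across b w - across b v) := by
  have hb : 0 < b.1 ^ 2 + b.2 ^ 2 := by
    rcases (by positivity : 0 ≤ b.1 ^ 2 + b.2 ^ 2).lt_or_eq with h | h
    · exact h
    · have h3 : b.1 = 0 := by nlinarith [sq_nonneg b.1, sq_nonneg b.2]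
      have h4 : b.2 = 0 := by nlinarith [sq_nonneg b.1, sq_nonneg b.2]
      simp [across_apply, h3, h4] at h1
  have := cross_eq_coords b u v w
  have := mul_neg_of_pos_of_neg hb hc
  rw [div_lt_div_iff₀ (by linarith) (by linarith)]
  nlinarith

/-- The base vector of a funnel. -/
def baseVec (L R : List Pt) : Pt := vtx R 0 - vtx L 0

theorem height_eq (L R : List Pt) (p : Pt) :
    height L R p = across (baseVec L R) p - across (baseVec L R) (vtx L 0) := by
  simp only [height, cross, across_apply, baseVec, Prod.fst_sub, Prod.snd_sub]; ring

namespace IsFunnel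

variable {L R : List Pt}

theorem baseVec_sq_pos (hF : IsFunnel L R) :
    0 < (baseVec L R).1 ^ 2 + (baseVec L R).2 ^ 2 := by
  rcases (by positivity : 0 ≤ (baseVec L R).1 ^ 2 + (baseVec L R).2 ^ 2).lt_or_eq with h | h
  · exact h
  · have h3 : (baseVec L R).1 = 0 := by nlinarith [sq_nonneg (baseVec L R).1, sq_nonneg (baseVec L R).2]
    have h4 : (baseVec L R).2 = 0 := by nlinarith [sq_nonneg (baseVec L R).1, sq_nonneg (baseVec L R).2]
    have := hF.left_up 0 hF.two_le_left
    simp [height_eq, across_apply, h3, h4] at this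

theorem across_left_lt (hF : IsFunnel L R) {e : ℕ} (he : e + 1 < L.length) :
    across (baseVec L R) (vtx L e) < across (baseVec L R) (vtx L (e + 1)) := by
  have := hF.left_up e he
  simp only [height_eq] at this
  linarith

theorem across_right_lt (hF : IsFunnel L R) {f : ℕ} (hf : f + 1 < R.length) :
    across (baseVec L R) (vtx R f) < across (baseVec L R) (vtx R (f + 1)) := by
  have := hF.right_up f hf
  simp only [height_eq] at this
  linarith

/-- The adapted coordinates of a funnel. -/
def frame (hF : IsFunnel L R) : Frame where
  x := along (baseVec L R)
  h := across (baseVec L R)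
  K := L.length - 1
  M := R.length - 1
  l := vtx L
  r := vtx R
  sa e := (along (baseVec L R) (vtx L (e + 1)) - along (baseVec L R) (vtx L e)) /
    (across (baseVec L R) (vtx L (e + 1)) - across (baseVec L R) (vtx L e))
  sb f := (along (baseVec L R) (vtx R (f + 1)) - along (baseVec L R) (vtx R f)) /
    (across (baseVec L R) (vtx R (f + 1)) - across (baseVec L R) (vtx R f))
  K_pos := by have := hF.two_le_left; omega
  M_pos := by have := hF.two_le_right; omega
  inj p q hx hh := by
    have hb := hF.baseVec_sq_pos
    simp only [along_apply, across_apply] at hx hh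
    refine Prod.ext (mul_left_cancel₀ hb.ne' ?_) (mul_left_cancel₀ hb.ne' ?_)
    · linear_combination (baseVec L R).1 * hx - (baseVec L R).2 * hh
    · linear_combination (baseVec L R).2 * hx + (baseVec L R).1 * hh
  dir_x := ⟨baseVec L R, by have := hF.baseVec_sq_pos; rw [along_apply]; linarith,
    by rw [across_apply]; ring⟩
  dir_h := ⟨((baseVec L R).2, -(baseVec L R).1), by
    have := hF.baseVec_sq_pos; rw [across_apply]; linarith⟩
  l_up e he := hF.across_left_lt (by omega)
  r_up f hf := hF.across_right_lt (by omega)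
  l_edge e he := by
    have := hF.across_left_lt (e := e) (by omega)
    rw [div_mul_cancel₀ _ (by linarith)]; ring
  r_edge f hf := by
    have := hF.across_right_lt (f := f) (by omega)
    rw [div_mul_cancel₀ _ (by linarith)]; ring
  sa_lt e he := slope_lt (hF.across_left_lt (by omega)) (hF.across_left_lt (by omega))
    (hF.left_concave e (by omega))
  sb_lt f hf := lt_slope (hF.across_right_lt (by omega)) (hF.across_right_lt (by omega))
    (hF.right_concave f (by omega))
  apex := hF.apex_eq
  apex_lt := by
    have h2 := hF.two_le_left
    have h3 := hF.two_le_right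
    have h4 := hF.across_left_lt (e := L.length - 1 - 1) (by omega)
    have h5 := hF.across_right_lt (f := R.length - 1 - 1) (by omega)
    have h6 := hF.apex_convex
    rw [show L.length - 2 = L.length - 1 - 1 by omega,
      show R.length - 2 = R.length - 1 - 1 by omega] at h6
    rw [show L.length - 1 - 1 + 1 = L.length - 1 by omega] at h4 ⊢
    rw [show R.length - 1 - 1 + 1 = R.length - 1 by omega] at h5 ⊢
    rw [← hF.apex_eq] at h5 ⊢
    rw [div_lt_div_iff₀ (by linarith) (by linarith)]
    have h7 := cross_eq_coords (baseVec L R) (vtx L (L.length - 1 - 1)) (vtx R (R.length - 1 - 1))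
      (vtx L (L.length - 1))
    have := mul_pos hF.baseVec_sq_pos h6
    nlinarith
  base := by
    simp only [across_apply, baseVec, Prod.fst_sub, Prod.snd_sub]; ring

theorem frame_K (hF : IsFunnel L R) : hF.frame.K + 1 = L.length := by
  have := hF.two_le_left
  change L.length - 1 + 1 = _
  omega

theorem frame_M (hF : IsFunnel L R) : hF.frame.M + 1 = R.length := by
  have := hF.two_le_right
  change R.length - 1 + 1 = _
  omega

theorem chainCurve_left (hF : IsFunnel L R) : chainCurve L = {w | hF.frame.OnL w} := by
  ext w
  have := hF.frame_K
  constructor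
  · rintro ⟨i, hi, h⟩; exact ⟨i, by omega, h⟩
  · rintro ⟨i, hi, h⟩; exact ⟨i, by omega, h⟩

theorem chainCurve_right (hF : IsFunnel L R) : chainCurve R = {w | hF.frame.OnR w} := by
  ext w
  have := hF.frame_M
  change _ ↔ hF.frame.OnR w
  rw [Frame.onR_iff]
  constructor
  · rintro ⟨i, hi, h⟩; exact ⟨i, by omega, h⟩
  · rintro ⟨i, hi, h⟩; exact ⟨i, by omega, h⟩

theorem region_eq (hF : IsFunnel L R) : region L R = {w | hF.frame.InF w} := by
  rw [region, boundary, hF.chainCurve_left, hF.chainCurve_right]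
  exact Frame.enclosedRegion_bdry

/-- This is the bridge from the cross products computed by the algorithm to the signs of `A`; on the
right chain the orientation makes the factor negative. -/
theorem exists_cross_left (hF : IsFunnel L R) {e : ℕ} (he : e < hF.frame.K) :
    ∃ c > 0, ∀ w, cross (vtx L e) (vtx L (e + 1)) w = c * hF.frame.A e w := by
  have hb := hF.baseVec_sq_pos
  have hu := hF.frame.l_up e he
  refine ⟨(hF.frame.h (hF.frame.l (e + 1)) - hF.frame.h (hF.frame.l e)) /
    ((baseVec L R).1 ^ 2 + (baseVec L R).2 ^ 2), div_pos (by linarith) hb, fun w => ?_⟩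
  have h1 : (baseVec L R).1 ^ 2 + (baseVec L R).2 ^ 2 ≠ 0 := hb.ne'
  have h2 := cross_eq_coords (baseVec L R) (vtx L e) (vtx L (e + 1)) w
  have h3 := hF.frame.l_edge e he
  rw [div_mul_eq_mul_div, eq_div_iff h1, mul_comm, h2]
  change hF.frame.x (hF.frame.l (e + 1)) = _ at h3
  change (hF.frame.x (hF.frame.l (e + 1)) - hF.frame.x (hF.frame.l e)) *
    (hF.frame.h w - hF.frame.h (hF.frame.l e)) -
    (hF.frame.h (hF.frame.l (e + 1)) - hF.frame.h (hF.frame.l e)) *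
    (hF.frame.x w - hF.frame.x (hF.frame.l e)) = _
  rw [h3, Frame.A]; ring

theorem exists_cross_right (hF : IsFunnel L R) {f : ℕ} (hf : f < hF.frame.M) :
    ∃ c < 0, ∀ w, cross (vtx R f) (vtx R (f + 1)) w = c * hF.frame.B f w := by
  have hb := hF.baseVec_sq_pos
  have hu := hF.frame.r_up f hf
  refine ⟨-((hF.frame.h (hF.frame.r (f + 1)) - hF.frame.h (hF.frame.r f)) /
    ((baseVec L R).1 ^ 2 + (baseVec L R).2 ^ 2)), neg_neg_of_pos (div_pos (by linarith) hb),
    fun w => ?_⟩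
  have h1 : (baseVec L R).1 ^ 2 + (baseVec L R).2 ^ 2 ≠ 0 := hb.ne'
  have h2 := cross_eq_coords (baseVec L R) (vtx R f) (vtx R (f + 1)) w
  have h3 := hF.frame.r_edge f hf
  rw [neg_mul, div_mul_eq_mul_div, ← neg_div, eq_div_iff h1, mul_comm, h2]
  change (hF.frame.x (hF.frame.r (f + 1)) - hF.frame.x (hF.frame.r f)) *
    (hF.frame.h w - hF.frame.h (hF.frame.r f)) -
    (hF.frame.h (hF.frame.r (f + 1)) - hF.frame.h (hF.frame.r f)) *
    (hF.frame.x w - hF.frame.x (hF.frame.r f)) = _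
  rw [h3, Frame.B]; ring

theorem height_frame (hF : IsFunnel L R) (p : Pt) :
    height L R p = hF.frame.h p - hF.frame.h (vtx L 0) := height_eq L R p

theorem height_le_iff (hF : IsFunnel L R) {p q : Pt} :
    height L R p ≤ height L R q ↔ hF.frame.h p ≤ hF.frame.h q := by
  rw [hF.height_frame, hF.height_frame]; exact sub_le_sub_iff_right _

theorem height_lt_iff (hF : IsFunnel L R) {p q : Pt} :
    height L R p < height L R q ↔ hF.frame.h p < hF.frame.h q := by
  rw [hF.height_frame, hF.height_frame]; exact sub_lt_sub_iff_right _

end IsFunnel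
end FunnelGuarding

namespace FunnelGuarding

/-! ### Values of the elementary subroutines -/

@[simp] theorem Timed.bind_val {α β : Type} (x : Timed α) (f : α → Timed β) :
    (x >>= f).val = (f x.val).val := rfl

@[simp] theorem Timed.bind_time {α β : Type} (x : Timed α) (f : α → Timed β) :
    (x >>= f).time = x.time + (f x.val).time := rfl

@[simp] theorem Timed.pure_val {α : Type} (a : α) : (pure a : Timed α).val = a := rfl

@[simp] theorem Timed.pure_time {α : Type} (a : α) : (pure a : Timed α).time = 0 := rfl

@[simp] theorem tick_time : tick.time = 1 := rfl

@[simp] theorem len_val (C : List Pt) : (len C).val = C.length := by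
  induction C with
  | nil => rfl
  | cons c C ih => simp [len, nAdd, ih]

@[simp] theorem nth_val (C : List Pt) (i : ℕ) : (nth C i).val = vtx C i := by
  induction C generalizing i with
  | nil => simp [nth, vtx]
  | cons c C ih =>
    cases i with
    | zero => simp [nth, vtx]
    | succ i => simpa [nth, vtx] using ih i

@[simp] theorem crossT_val (a b c : Pt) : (crossT a b c).val = cross a b c := by
  simp [crossT, rSub, rMul, cross]

@[simp] theorem heightT_val (L R : List Pt) (p : Pt) : (heightT L R p).val = height L R p := by
  simp [heightT, height]

@[simp] theorem apexT_val (L : List Pt) : (apexT L).val = vtx L (L.length - 1) := by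
  simp [apexT, nSub]

@[simp] theorem ptEq_val (a b : Pt) : (ptEq a b).val = true ↔ a = b := by
  simp [ptEq, rEq, bAnd, Prod.ext_iff]

theorem hasApex_val (L : List Pt) (s : Front) :
    (hasApex L s).val = true ↔ s.q = vtx L (L.length - 1) ∨ s.p = vtx L (L.length - 1) := by
  rw [← ptEq_val, ← ptEq_val]
  simp [hasApex, bOr]

theorem clear_val (L R : List Pt) (a b : Pt) (h₀ h₁ : ℝ) (C : List Pt) :
    (clear L R a b h₀ h₁ C).val = true ↔
      ∀ c ∈ C, h₀ < height L R c → height L R c < h₁ → 0 ≤ cross a b c := by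
  induction C with
  | nil => simp [clear]
  | cons c C ih =>
    simp only [clear, Timed.bind_val, heightT_val, crossT_val, rLt, bAnd, List.forall_mem_cons,
      ← ih]
    split_ifs with h
    · simp only [Bool.and_eq_true, decide_eq_true_eq] at h
      exact iff_of_false (by simp) fun h' => absurd (h'.1 h.1.1 h.1.2) (not_le.2 h.2)
    · simp only [Bool.and_eq_true, decide_eq_true_eq, not_and, not_lt] at h
      exact ⟨fun h' => ⟨fun h1 h2 => h ⟨h1, h2⟩, h'⟩, fun h' => h'.2⟩

theorem seesT_val_of_le {L R : List Pt} {v w : Pt} (h : height L R v ≤ height L R w) :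
    (seesT L R v w).val = true ↔
      (clear L R v w (height L R v) (height L R w) L).val = true ∧
      (clear L R w v (height L R v) (height L R w) R).val = true := by
  simp [seesT, rLe, bAnd, h]

theorem seesT_val_of_gt {L R : List Pt} {v w : Pt} (h : height L R w < height L R v) :
    (seesT L R v w).val = true ↔
      (clear L R w v (height L R w) (height L R v) L).val = true ∧
      (clear L R v w (height L R w) (height L R v) R).val = true := by
  simp [seesT, rLe, bAnd, not_le.2 h]

theorem seesFront_val (L R : List Pt) (v : Pt) (s : Front) :
    (seesFront L R v s).val = true ↔ (seesT L R v s.q).val = true ∧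
      (seesT L R v s.t).val = true ∧ (seesT L R v s.p).val = true := by
  simp [seesFront, bAnd, and_assoc]

theorem meet_cross {u v c d : Pt} (h : cross u v c ≠ cross u v d) :
    cross u v (meet u v c d).val = 0 ∧ cross c d (meet u v c d).val = 0 := by
  have hne : cross u v c - cross u v d ≠ 0 := sub_ne_zero.2 h
  set s := cross u v c / (cross u v c - cross u v d) with hs
  have hval : (meet u v c d).val = (c.1 + s * (d.1 - c.1), c.2 + s * (d.2 - c.2)) := by
    simp [meet, rSub, rDiv, rMul, rAdd, hs]
  rw [hval]
  constructor
  · have h1 : cross u v (c.1 + s * (d.1 - c.1), c.2 + s * (d.2 - c.2))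
        = cross u v c - s * (cross u v c - cross u v d) := by
      simp only [cross]; ring
    rw [h1, hs, div_mul_cancel₀ _ hne, sub_self]
  · simp only [cross]; ring

theorem meet_spec {u v c d : Pt} (h : cross u v c * cross u v d ≤ 0) (hc : cross u v c ≠ 0) :
    (meet u v c d).val ∈ segment ℝ c d ∧ cross u v (meet u v c d).val = 0 := by
  have hne : cross u v c - cross u v d ≠ 0 := by
    intro h0
    have : cross u v d = cross u v c := by linarith
    rw [this] at h
    exact hc (by nlinarith [sq_nonneg (cross u v c)])
  set s := cross u v c / (cross u v c - cross u v d) with hs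
  have hval : (meet u v c d).val = (c.1 + s * (d.1 - c.1), c.2 + s * (d.2 - c.2)) := by
    simp [meet, rSub, rDiv, rMul, rAdd, hs]
  have hs0 : 0 ≤ s := by
    rw [hs, ← mul_div_mul_right _ _ hne]
    exact div_nonneg (by nlinarith [sq_nonneg (cross u v c)]) (mul_self_nonneg _)
  have hs1 : s ≤ 1 := by
    have : 1 - s = -cross u v d / (cross u v c - cross u v d) := by
      rw [hs]; field_simp; ring
    have h2 : 0 ≤ 1 - s := by
      rw [this, ← mul_div_mul_right _ _ hne]
      exact div_nonneg (by nlinarith [sq_nonneg (cross u v d)]) (mul_self_nonneg _)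
    linarith
  rw [hval]
  refine ⟨⟨1 - s, s, by linarith, hs0, by ring, ?_⟩, ?_⟩
  · ext <;> simp <;> ring
  · rw [← hval]; exact (meet_cross (sub_ne_zero.1 hne)).1

theorem chainCurve_cons {c d : Pt} {C : List Pt} {w : Pt} (hw : w ∈ chainCurve (d :: C)) :
    w ∈ chainCurve (c :: d :: C) := by
  obtain ⟨i, hi, h⟩ := hw
  exact ⟨i + 1, by simpa using hi, h⟩

/-- A first edge without a sign change has both ends strictly on one side, so the vertex on the
other side still witnesses a sign change in the remaining chain. Starting off the line keeps `meet`
from dividing by zero. -/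
theorem hit_spec (u v : Pt) (C : List Pt) (h0 : cross u v (vtx C 0) ≠ 0)
    (hex : ∃ c ∈ C, cross u v (vtx C 0) * cross u v c ≤ 0) :
    (hit u v C).val ∈ chainCurve C ∧ cross u v (hit u v C).val = 0 := by
  induction C with
  | nil => simp at hex
  | cons c C ih =>
    have hc : vtx (c :: C) 0 = c := rfl
    rw [hc] at h0 hex
    cases C with
    | nil =>
      simp only [List.mem_singleton, exists_eq_left] at hex
      exact absurd (by nlinarith [sq_nonneg (cross u v c)]) h0
    | cons d C =>
      have hd : vtx (d :: C) 0 = d := rfl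
      simp only [hit, Timed.bind_val, crossT_val, rMul, rLe]
      split_ifs with h
      · obtain ⟨h1, h2⟩ := meet_spec (of_decide_eq_true h) h0
        exact ⟨⟨0, by simp, h1⟩, h2⟩
      · simp only [decide_eq_true_eq, not_le] at h
        have hd0 : cross u v d ≠ 0 := by rintro h'; simp [h'] at h
        obtain ⟨h1, h2⟩ := ih (by rwa [hd]) (by
          rw [hd]
          obtain ⟨b, hb, hb'⟩ := hex
          rcases List.mem_cons.1 hb with rfl | hb
          · exact absurd (by nlinarith [sq_nonneg (cross u v b)]) h0
          · refine ⟨b, hb, ?_⟩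
            by_contra! h3
            have h4 := mul_pos h h3
            have h5 : 0 < cross u v d ^ 2 := by positivity
            nlinarith)
        exact ⟨chainCurve_cons h1, h2⟩

/-- The recursion changes both the index and the best candidate, so both must be arbitrary; the
first alternative says that the candidate survives. -/
theorem lastNotAbove_aux (L R : List Pt) (h : ℝ) (C : List Pt) (i best : ℕ) :
    ((lastNotAbove L R h C i best).val = best ∧ ∀ c < C.length, ¬ height L R (vtx C c) ≤ h) ∨
    ∃ c < C.length, (lastNotAbove L R h C i best).val = i + c ∧ height L R (vtx C c) ≤ h ∧
      ∀ d < C.length, height L R (vtx C d) ≤ h → d ≤ c := by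
  induction C generalizing i best with
  | nil => left; simp [lastNotAbove]
  | cons c C ih =>
    have hs : ∀ n, vtx (c :: C) (n + 1) = vtx C n := fun n => rfl
    have h0 : vtx (c :: C) 0 = c := rfl
    simp only [lastNotAbove, Timed.bind_val, heightT_val, rLe, nAdd]
    split_ifs with hb
    · simp only [decide_eq_true_eq] at hb
      right
      rcases ih (i + 1) i with ⟨h1, h2⟩ | ⟨n, hn, h1, h2, h3⟩
      · refine ⟨0, by simp, h1, hb, fun d hd hd' => ?_⟩
        cases d with
        | zero => rfl
        | succ d => exact absurd hd' (h2 d (by simpa using hd))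
      · refine ⟨n + 1, by simpa using hn, by rw [h1]; ring, h2, fun d hd hd' => ?_⟩
        cases d with
        | zero => omega
        | succ d => exact Nat.succ_le_succ (h3 d (by simpa using hd) hd')
    · simp only [decide_eq_true_eq] at hb
      rcases ih (i + 1) best with ⟨h1, h2⟩ | ⟨n, hn, h1, h2, h3⟩
      · refine Or.inl ⟨h1, fun d hd => ?_⟩
        cases d with
        | zero => exact hb
        | succ d => exact h2 d (by simpa using hd)
      · refine Or.inr ⟨n + 1, by simpa using hn, by rw [h1]; ring, h2, fun d hd hd' => ?_⟩
        cases d with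
        | zero => omega
        | succ d => exact Nat.succ_le_succ (h3 d (by simpa using hd) hd')

theorem lastBelow_aux (L R : List Pt) (h : ℝ) (C : List Pt) (i best : ℕ) :
    ((lastBelow L R h C i best).val = best ∧ ∀ c < C.length, ¬ height L R (vtx C c) < h) ∨
    ∃ c < C.length, (lastBelow L R h C i best).val = i + c ∧ height L R (vtx C c) < h ∧
      ∀ d < C.length, height L R (vtx C d) < h → d ≤ c := by
  induction C generalizing i best with
  | nil => left; simp [lastBelow]
  | cons c C ih =>
    have hs : ∀ n, vtx (c :: C) (n + 1) = vtx C n := fun n => rfl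
    have h0 : vtx (c :: C) 0 = c := rfl
    simp only [lastBelow, Timed.bind_val, heightT_val, rLt, nAdd]
    split_ifs with hb
    · simp only [decide_eq_true_eq] at hb
      right
      rcases ih (i + 1) i with ⟨h1, h2⟩ | ⟨n, hn, h1, h2, h3⟩
      · refine ⟨0, by simp, h1, hb, fun d hd hd' => ?_⟩
        cases d with
        | zero => rfl
        | succ d => exact absurd hd' (h2 d (by simpa using hd))
      · refine ⟨n + 1, by simpa using hn, by rw [h1]; ring, h2, fun d hd hd' => ?_⟩
        cases d with
        | zero => omega
        | succ d => exact Nat.succ_le_succ (h3 d (by simpa using hd) hd')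
    · simp only [decide_eq_true_eq] at hb
      rcases ih (i + 1) best with ⟨h1, h2⟩ | ⟨n, hn, h1, h2, h3⟩
      · refine Or.inl ⟨h1, fun d hd => ?_⟩
        cases d with
        | zero => exact hb
        | succ d => exact h2 d (by simpa using hd)
      · refine Or.inr ⟨n + 1, by simpa using hn, by rw [h1]; ring, h2, fun d hd hd' => ?_⟩
        cases d with
        | zero => omega
        | succ d => exact Nat.succ_le_succ (h3 d (by simpa using hd) hd')

theorem lastNotAbove_spec (L R : List Pt) (h : ℝ) (C : List Pt)
    (hex : ∃ c < C.length, height L R (vtx C c) ≤ h) :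
    (lastNotAbove L R h C 0 0).val < C.length ∧
      height L R (vtx C (lastNotAbove L R h C 0 0).val) ≤ h ∧
      ∀ d < C.length, height L R (vtx C d) ≤ h → d ≤ (lastNotAbove L R h C 0 0).val := by
  rcases lastNotAbove_aux L R h C 0 0 with ⟨-, h1⟩ | ⟨c, hc, h1, h2, h3⟩
  · obtain ⟨c, hc, h2⟩ := hex
    exact absurd h2 (h1 c hc)
  · rw [h1, zero_add]
    exact ⟨hc, h2, h3⟩

theorem lastBelow_spec (L R : List Pt) (h : ℝ) (C : List Pt)
    (hex : ∃ c < C.length, height L R (vtx C c) < h) :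
    (lastBelow L R h C 0 0).val < C.length ∧
      height L R (vtx C (lastBelow L R h C 0 0).val) < h ∧
      ∀ d < C.length, height L R (vtx C d) < h → d ≤ (lastBelow L R h C 0 0).val := by
  rcases lastBelow_aux L R h C 0 0 with ⟨-, h1⟩ | ⟨c, hc, h1, h2, h3⟩
  · obtain ⟨c, hc, h2⟩ := hex
    exact absurd h2 (h1 c hc)
  · rw [h1, zero_add]
    exact ⟨hc, h2, h3⟩

theorem topSeeing_val {L R C : List Pt} {s : Front} {i : ℕ} (hi : i + 1 < C.length) :
    (topSeeing L R C s i).val =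
      if (seesFront L R (vtx C (i + 1)) s).val = true then i + 1 else i := by
  simp only [topSeeing, Timed.bind_val, len_val, nAdd, nLt, hi, decide_true, if_true, nth_val]
  split_ifs <;> rfl

theorem upsegLeft_val_of_lt {L R : List Pt} {i : ℕ} (hi : i + 1 < L.length) :
    (upsegLeft L R i).val = ⟨vtx L (i + 1), vtx L (i + 1), (hit (vtx L i) (vtx L (i + 1)) R).val⟩ := by
  simp [upsegLeft, nAdd, nLt, hi]

theorem upsegLeft_val_of_ge {L R : List Pt} {i : ℕ} (hi : L.length ≤ i + 1) :
    (upsegLeft L R i).val =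
      ⟨vtx L (L.length - 1), vtx L (L.length - 1), vtx L (L.length - 1)⟩ := by
  simp [upsegLeft, nAdd, nLt, not_lt.2 hi]

theorem upsegRight_val_of_lt {L R : List Pt} {j : ℕ} (hj : j + 1 < R.length) :
    (upsegRight L R j).val =
      ⟨(hit (vtx R j) (vtx R (j + 1)) L).val, (hit (vtx R j) (vtx R (j + 1)) L).val, vtx R (j + 1)⟩ := by
  simp [upsegRight, nAdd, nLt, hj]

theorem upsegRight_val_of_ge {L R : List Pt} {j : ℕ} (hj : R.length ≤ j + 1) :
    (upsegRight L R j).val =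
      ⟨vtx L (L.length - 1), vtx L (L.length - 1), vtx L (L.length - 1)⟩ := by
  simp [upsegRight, nAdd, nLt, not_lt.2 hj]

theorem upsegPair_val (L R : List Pt) (i j : ℕ) :
    (upsegPair L R i j).val =
      if height L R (upsegLeft L R i).val.q ≤ height L R (upsegRight L R j).val.q then
        if height L R (upsegRight L R j).val.p ≤ height L R (upsegLeft L R i).val.p then
          ⟨(upsegRight L R j).val.q,
            (meet (vtx L i) (vtx L (i + 1)) (vtx R j) (vtx R (j + 1))).val,
            (upsegLeft L R i).val.p⟩
        else (upsegRight L R j).val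
      else (upsegLeft L R i).val := by
  simp only [upsegPair, Timed.bind_val, heightT_val, rLe, bAnd, nAdd]
  by_cases h1 : height L R (upsegLeft L R i).val.q ≤ height L R (upsegRight L R j).val.q <;>
  by_cases h2 : height L R (upsegRight L R j).val.p ≤ height L R (upsegLeft L R i).val.p <;>
  simp [h1, h2]

end FunnelGuarding

namespace FunnelGuarding

namespace Frame

/-! ### Upper segments as fronts -/

variable {H : Frame}

theorem OnR.A_lt {u w : Pt} (hu : H.OnR u) (hw : ∃ f < H.M, H.B f w ≤ 0) {e : ℕ} (he : e < H.K)
    (huw : H.h u < H.h w) : H.A e u < H.A e w := by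
  rw [← mirror_B, ← mirror_B]
  exact OnL.B_lt hu (by simp only [mirror_A]; exact hw) he huw

theorem OnR.B_nonneg {w : Pt} (hw : H.OnR w) {f : ℕ} (hf : f < H.M) : 0 ≤ H.B f w := by
  rw [← mirror_A]; exact OnL.A_nonneg (H := H.mirror) hw hf

theorem OnL.h_lt_apex {q : Pt} (hq : H.OnL q) (hne : q ≠ H.l H.K) : H.h q < H.h (H.l H.K) := by
  refine lt_of_le_of_ne hq.inF.h_le fun h => hne ?_
  have hL := H.onL_vertex le_rfl
  have h1 := (hq.h_le_iff hL H.M_pos).1 h.le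
  have h2 := (hL.h_le_iff hq H.M_pos).1 h.symm.le
  refine H.inj _ _ ?_ h
  simp only [B, h] at h1 h2
  linarith

theorem OnR.h_lt_apex {p : Pt} (hp : H.OnR p) (hne : p ≠ H.r H.M) : H.h p < H.h (H.r H.M) :=
  OnL.h_lt_apex (H := H.mirror) hp hne

/-- `s` is the lower boundary of `H.Upper cL cR`. -/
structure IsFrontCurve (H : Frame) (cL cR : Option ℕ) (s : Front) : Prop where
  q_on : H.OnL s.q
  p_on : H.OnR s.p
  cL_spec : ∀ a ∈ cL, a < H.K ∧ H.h (H.l (a + 1)) ≤ H.h s.q ∧ 0 ≤ H.A a s.p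
  cR_spec : ∀ b ∈ cR, b < H.M ∧ H.h (H.r (b + 1)) ≤ H.h s.p ∧ 0 ≤ H.B b s.q
  q_attained : s.q = H.l 0 ∨ (∃ a ∈ cL, s.q = H.l (a + 1)) ∨ ∃ b ∈ cR, H.B b s.q = 0
  p_attained : s.p = H.r 0 ∨ (∃ b ∈ cR, s.p = H.r (b + 1)) ∨ ∃ a ∈ cL, H.A a s.p = 0
  t_spec : s.t = s.q ∨ s.t = s.p ∨ ∃ a ∈ cL, ∃ b ∈ cR,
    H.A a s.t = 0 ∧ H.B b s.t = 0 ∧ H.A a s.p = 0 ∧ H.B b s.q = 0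

namespace IsFrontCurve

variable {cL cR : Option ℕ} {s : Front} {i j : ℕ}

theorem mirror (hs : H.IsFrontCurve cL cR s) : H.mirror.IsFrontCurve cR cL ⟨s.p, s.t, s.q⟩ where
  q_on := hs.p_on
  p_on := hs.q_on
  cL_spec b hb := by rw [mirror_A]; exact hs.cR_spec b hb
  cR_spec a ha := by rw [mirror_B]; exact hs.cL_spec a ha
  q_attained := by simp only [mirror_B]; exact hs.p_attained
  p_attained := by simp only [mirror_A]; exact hs.q_attained
  t_spec := by
    rcases hs.t_spec with h | h | ⟨a, ha, b, hb, h1, h2, h3, h4⟩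
    · exact Or.inr (Or.inl h)
    · exact Or.inl h
    · exact Or.inr (Or.inr ⟨b, hb, a, ha, by rw [mirror_A]; exact h2, by rw [mirror_B]; exact h1,
        by rw [mirror_A]; exact h4, by rw [mirror_B]; exact h3⟩)

/-- The left end of `s` lies on edge `i` of the left chain, and is not its upper end. -/
def LeftIndex (H : Frame) (s : Front) (i : ℕ) : Prop :=
  i < H.K ∧ H.h (H.l i) ≤ H.h s.q ∧ H.h s.q < H.h (H.l (i + 1))

/-- The right end of `s` lies on edge `j` of the right chain, and is not its upper end. -/
def RightIndex (H : Frame) (s : Front) (j : ℕ) : Prop :=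
  j < H.M ∧ H.h (H.r j) ≤ H.h s.p ∧ H.h s.p < H.h (H.r (j + 1))

theorem cL_lt (hs : H.IsFrontCurve cL cR s) (hi : LeftIndex H s i) : ∀ a ∈ cL, a < i := by
  intro a ha
  obtain ⟨h1, h2, -⟩ := hs.cL_spec a ha
  have := H.lt_of_h_l_lt (Nat.succ_le_of_lt h1) (h2.trans_lt hi.2.2)
  omega

/-- An end at `l 0` or `l (a + 1)` is a vertex, and the half-open height range of edge `i` then
fixes `i`. -/
theorem eq_vertex_or (hs : H.IsFrontCurve cL cR s) (hi : LeftIndex H s i) :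
    ((i = 0 ∨ ∃ a ∈ cL, i = a + 1) ∧ s.q = H.l i) ∨ ∃ b ∈ cR, H.B b s.q = 0 := by
  rcases hs.q_attained with h | ⟨a, ha, h⟩ | h
  · left
    have : i = 0 := by
      by_contra h0
      have := H.h_l_strictMono (Nat.pos_of_ne_zero h0) hi.1.le
      have := hi.2.1
      rw [h] at this
      linarith
    subst this
    exact ⟨Or.inl rfl, h⟩
  · left
    have h1 := hs.cL_lt hi a ha
    have h2 : i = a + 1 := by
      by_contra h0
      have := H.h_l_strictMono (c := a + 1) (d := i) (by omega) hi.1.le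
      have := hi.2.1
      rw [h] at this
      linarith
    exact ⟨Or.inr ⟨a, ha, h2⟩, by rw [h, h2]⟩
  · exact Or.inr h

theorem isFront (hs : H.IsFrontCurve cL cR s) (hi : LeftIndex H s i) (hj : RightIndex H s j) :
    H.IsFront cL cR i j := by
  -- Stated for all frames, so that it can be used a second time for the mirror image.
  have hup : ∀ {H : Frame} {cL cR : Option ℕ} {s : Front} {i : ℕ}, H.IsFrontCurve cL cR s →
      LeftIndex H s i → (∀ b ∈ cR, 0 < H.B b (H.l (i + 1))) ∧
      (i = 0 ∨ (∃ a ∈ cL, i = a + 1) ∨ ∃ b ∈ cR, H.B b (H.l i) ≤ 0) := by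
    intro H cL cR s i hs hi
    constructor
    · intro b hb
      obtain ⟨h1, -, h2⟩ := hs.cR_spec b hb
      exact h2.trans_lt (hs.q_on.B_lt (H.exists_A_vertex_nonpos hi.1) h1 hi.2.2)
    · rcases hs.eq_vertex_or hi with ⟨h | h, -⟩ | ⟨b, hb, h⟩
      · exact Or.inl h
      · exact Or.inr (Or.inl h)
      · refine Or.inr (Or.inr ⟨b, hb, ?_⟩)
        rw [← h]
        exact (H.onL_vertex hi.1.le).B_le hs.q_on.exists_A_nonpos (hs.cR_spec b hb).1 hi.2.1
  have hL := hup hs hi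
  have hR := hup hs.mirror (i := j) hj
  simp only [mirror_B] at hR
  exact ⟨hi.1, hj.1, hs.cL_lt hi, hs.mirror.cL_lt (i := j) hj, hL.1, hR.1, hL.2, hR.2⟩

/-- This and its companions for `p` and `t` put the whole front on the inner sides of the edges `i`
and `j`, so that the visibility test for the next vertex reduces to one sign. If `q` lies on the
tangent of `b` but below `r j`, then `A i + B j` is compared at these two points. -/
theorem B_q_nonpos (hs : H.IsFrontCurve cL cR s) (hi : LeftIndex H s i) (hj : RightIndex H s j) :
    H.B j s.q ≤ 0 := by
  have hf := hs.isFront hi hj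
  rcases hs.eq_vertex_or hi with ⟨-, h⟩ | ⟨b, hb, h⟩
  · rw [h]; exact hf.vertex_neg.1.le
  · rcases le_or_gt (H.h (H.r j)) (H.h s.q) with h1 | h1
    · exact (H.B_le_of_ge (hf.cR_lt b hb).le hj.1 h1).trans h.le
    · have h2 := H.A_add_B_lt hi.1 hj.1 h1
      have h3 := hs.q_on.A_nonneg hi.1
      have h4 := hf.vertex_neg.2
      rw [H.B_self] at h2
      linarith

theorem A_q_nonpos (hs : H.IsFrontCurve cL cR s) (hi : LeftIndex H s i) : H.A i s.q ≤ 0 :=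
  hs.q_on.inF.A_nonpos hi.1 hi.2.1 hi.2.2.le

theorem A_p_nonpos (hs : H.IsFrontCurve cL cR s) (hi : LeftIndex H s i) (hj : RightIndex H s j) :
    H.A i s.p ≤ 0 := by
  have := hs.mirror.B_q_nonpos (i := j) (j := i) hj hi
  rwa [mirror_B] at this

theorem B_p_nonpos (hs : H.IsFrontCurve cL cR s) (hj : RightIndex H s j) : H.B j s.p ≤ 0 := by
  have := hs.mirror.A_q_nonpos (i := j) hj
  rwa [mirror_A] at this

theorem B_t_nonpos (hs : H.IsFrontCurve cL cR s) (hi : LeftIndex H s i) (hj : RightIndex H s j) :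
    H.B j s.t ≤ 0 := by
  rcases hs.t_spec with h | h | ⟨a, ha, b, hb, h1, h2, h3, -⟩
  · rw [h]; exact hs.B_q_nonpos hi hj
  · rw [h]; exact hs.B_p_nonpos hj
  · have hf := hs.isFront hi hj
    rcases le_or_gt (H.h (H.r j)) (H.h s.t) with h4 | h4
    · exact (H.B_le_of_ge (hf.cR_lt b hb).le hj.1 h4).trans h2.le
    · have haK := (hs.cL_spec a ha).1
      have h5 := H.A_add_B_lt haK hj.1 h4
      have h6 := (onR_vertex hj.1.le).A_le hs.p_on.inF.2.2 haK hj.2.1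
      rw [H.B_self] at h5
      linarith

theorem A_t_nonpos (hs : H.IsFrontCurve cL cR s) (hi : LeftIndex H s i) (hj : RightIndex H s j) :
    H.A i s.t ≤ 0 := by
  have := hs.mirror.B_t_nonpos (i := j) (j := i) hj hi
  rwa [mirror_B] at this

/-- The apex is not on the base, so one of the two tangents produces this end. That tangent must
belong to the last edge of its chain, since every other edge line misses the apex strictly. -/
theorem upper_empty_of_q_eq_apex (hs : H.IsFrontCurve cL cR s) (hq : s.q = H.l H.K) (w : Pt) :
    ¬ H.Upper cL cR w := by
  intro hw
  rcases hs.q_attained with h | ⟨a, ha, h⟩ | ⟨b, hb, h⟩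
  · have := H.h_l_strictMono H.K_pos le_rfl
    rw [← hq, h] at this
    exact lt_irrefl _ this
  · have haK := (hs.cL_spec a ha).1
    refine not_aboveL_of_last hw.1 ?_ (hw.2.1 a ha)
    by_contra h1
    have := H.h_l_strictMono (c := a + 1) (d := H.K) (by omega) le_rfl
    rw [← hq, h] at this
    exact lt_irrefl _ this
  · have hbM := (hs.cR_spec b hb).1
    refine not_aboveR_of_last hw.1 ?_ (hw.2.2 b hb)
    by_contra h1
    have := H.B_vertex_pos hbM le_rfl (by omega) (by omega)
    rw [← H.apex, ← hq] at this
    linarith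

theorem upper_empty_of_apex (hs : H.IsFrontCurve cL cR s)
    (h : s.q = H.l H.K ∨ s.p = H.l H.K) (w : Pt) : ¬ H.Upper cL cR w := by
  rcases h with h | h
  · exact hs.upper_empty_of_q_eq_apex h w
  · rw [← mirror_Upper]
    exact hs.mirror.upper_empty_of_q_eq_apex (h.trans H.apex) w

end IsFrontCurve
end Frame

/-! ### The computed upper segments are front curves. -/

namespace IsFunnel

variable {L R : List Pt}

theorem mem_left_iff (hF : IsFunnel L R) {v : Pt} :
    v ∈ L ↔ ∃ c ≤ hF.frame.K, v = vtx L c := by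
  have hK := hF.frame_K
  constructor
  · intro h
    obtain ⟨n, hn, rfl⟩ := List.mem_iff_getElem.1 h
    exact ⟨n, by omega, by simp [vtx, hn]⟩
  · rintro ⟨c, hc, rfl⟩
    have : c < L.length := by omega
    simp [vtx, this]

theorem mem_right_iff (hF : IsFunnel L R) {v : Pt} :
    v ∈ R ↔ ∃ c ≤ hF.frame.M, v = vtx R c := by
  have hM := hF.frame_M
  constructor
  · intro h
    obtain ⟨n, hn, rfl⟩ := List.mem_iff_getElem.1 h
    exact ⟨n, by omega, by simp [vtx, hn]⟩
  · rintro ⟨c, hc, rfl⟩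
    have : c < R.length := by omega
    simp [vtx, this]

/-- The line of a left edge separates `r 0`, which is lower than `l (i + 1)`, from the apex; this is
the sign change that `hit` looks for. -/
theorem hit_right (hF : IsFunnel L R) {i : ℕ} (hi : i < hF.frame.K) :
    hF.frame.OnR (hit (vtx L i) (vtx L (i + 1)) R).val ∧
      hF.frame.A i (hit (vtx L i) (vtx L (i + 1)) R).val = 0 := by
  obtain ⟨c, hc, hcr⟩ := hF.exists_cross_left hi
  have hM := hF.frame.M_pos
  have h0 : hF.frame.A i (vtx R 0) < 0 := by
    rw [← hF.frame.A_next hi]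
    refine (Frame.onR_vertex (H := hF.frame) (c := 0) (by omega)).A_lt
      (hF.frame.onL_vertex (Nat.succ_le_of_lt hi)).inF.2.2 hi ?_
    have h1 := hF.frame.h_l_strictMono (c := 0) (d := i + 1) (by omega) hi
    have h2 := hF.frame.base
    rw [← h2]; exact h1
  have h1 : 0 ≤ hF.frame.A i (vtx R hF.frame.M) := by
    have := hF.frame.A_vertex_nonneg hi le_rfl
    rwa [hF.frame.apex] at this
  have h2 := hit_spec (vtx L i) (vtx L (i + 1)) R
    (by rw [hcr]; exact mul_ne_zero hc.ne' h0.ne)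
    ⟨vtx R hF.frame.M, hF.mem_right_iff.2 ⟨_, le_rfl, rfl⟩, by
      rw [hcr, hcr]
      exact mul_nonpos_of_nonpos_of_nonneg (mul_nonpos_of_nonneg_of_nonpos hc.le h0.le)
        (mul_nonneg hc.le h1)⟩
  rw [hF.chainCurve_right, hcr] at h2
  exact ⟨h2.1, (mul_eq_zero.1 h2.2).resolve_left hc.ne'⟩

theorem hit_left (hF : IsFunnel L R) {j : ℕ} (hj : j < hF.frame.M) :
    hF.frame.OnL (hit (vtx R j) (vtx R (j + 1)) L).val ∧
      hF.frame.B j (hit (vtx R j) (vtx R (j + 1)) L).val = 0 := by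
  obtain ⟨c, hc, hcr⟩ := hF.exists_cross_right hj
  have hK := hF.frame.K_pos
  have h0 : hF.frame.B j (vtx L 0) < 0 := by
    rw [← hF.frame.B_next hj]
    refine (hF.frame.onL_vertex (c := 0) (by omega)).B_lt
      (Frame.onR_vertex (H := hF.frame) (Nat.succ_le_of_lt hj)).inF.2.1 hj ?_
    have h1 := hF.frame.mirror.h_l_strictMono (c := 0) (d := j + 1) (by omega) hj
    have h2 := hF.frame.base
    rw [h2]; exact h1
  have h1 : 0 ≤ hF.frame.B j (vtx L hF.frame.K) := by
    have := hF.frame.B_vertex_nonneg hj le_rfl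
    rwa [← hF.frame.apex] at this
  have h2 := hit_spec (vtx R j) (vtx R (j + 1)) L
    (by rw [hcr]; exact mul_ne_zero hc.ne h0.ne)
    ⟨vtx L hF.frame.K, hF.mem_left_iff.2 ⟨_, le_rfl, rfl⟩, by
      rw [hcr, hcr]
      exact mul_nonpos_of_nonneg_of_nonpos (mul_nonneg_of_nonpos_of_nonpos hc.le h0.le)
        (mul_nonpos_of_nonpos_of_nonneg hc.le h1)⟩
  rw [hF.chainCurve_left, hcr] at h2
  exact ⟨h2.1, (mul_eq_zero.1 h2.2).resolve_left hc.ne⟩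

end IsFunnel

/-- The left vertex whose upper segment bounds the part of the funnel above a node. -/
def Node.leftPart : Node → Option ℕ
  | .left i => some i
  | .pair i _ => some i
  | _ => none

/-- The right vertex whose upper segment bounds the part of the funnel above a node. -/
def Node.rightPart : Node → Option ℕ
  | .right j => some j
  | .pair _ j => some j
  | _ => none

/-- The nodes whose indices are within range. -/
def Node.Valid (H : Frame) : Node → Prop
  | .source => True
  | .sink => False
  | .left i => i ≤ H.K
  | .right j => j ≤ H.M
  | .pair i j => i < H.K ∧ j < H.M

namespace IsFunnel

variable {L R : List Pt}

theorem isFrontCurve_left (hF : IsFunnel L R) {i : ℕ} (hi : i < hF.frame.K) :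
    hF.frame.IsFrontCurve (some i) none (upsegLeft L R i).val := by
  have hK := hF.frame_K
  rw [upsegLeft_val_of_lt (by omega)]
  obtain ⟨h1, h2⟩ := hF.hit_right hi
  exact
    { q_on := hF.frame.onL_vertex hi
      p_on := h1
      cL_spec := by rintro _ ⟨⟩; exact ⟨hi, le_rfl, h2.ge⟩
      cR_spec := by simp
      q_attained := Or.inr (Or.inl ⟨i, rfl, rfl⟩)
      p_attained := Or.inr (Or.inr ⟨i, rfl, h2⟩)
      t_spec := Or.inl rfl }

theorem isFrontCurve_right (hF : IsFunnel L R) {j : ℕ} (hj : j < hF.frame.M) :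
    hF.frame.IsFrontCurve none (some j) (upsegRight L R j).val := by
  have hM := hF.frame_M
  rw [upsegRight_val_of_lt (by omega)]
  obtain ⟨h1, h2⟩ := hF.hit_left hj
  exact
    { q_on := h1
      p_on := Frame.onR_vertex (H := hF.frame) hj
      cL_spec := by simp
      cR_spec := by rintro _ ⟨⟩; exact ⟨hj, le_rfl, h2.ge⟩
      q_attained := Or.inr (Or.inr ⟨j, rfl, h2⟩)
      p_attained := Or.inr (Or.inl ⟨j, rfl, rfl⟩)
      t_spec := Or.inl rfl }

theorem isFrontCurve_pair (hF : IsFunnel L R) {i j : ℕ} (hi : i < hF.frame.K)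
    (hj : j < hF.frame.M) :
    hF.frame.IsFrontCurve (some i) (some j) (upsegPair L R i j).val := by
  have hK := hF.frame_K
  have hM := hF.frame_M
  obtain ⟨c, hc, hcr⟩ := hF.exists_cross_left hi
  obtain ⟨d, hd, hdr⟩ := hF.exists_cross_right hj
  have hl : hF.frame.OnL (vtx L (i + 1)) := hF.frame.onL_vertex hi
  have hr : hF.frame.OnR (vtx R (j + 1)) := Frame.onR_vertex (H := hF.frame) hj
  have hli : hF.frame.OnL (vtx L i) := hF.frame.onL_vertex hi.le
  have hrj : hF.frame.OnR (vtx R j) := Frame.onR_vertex (H := hF.frame) hj.le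
  rw [upsegPair_val, upsegLeft_val_of_lt (by omega), upsegRight_val_of_lt (by omega)]
  simp only [hF.height_le_iff]
  obtain ⟨hp, hp0⟩ := hF.hit_right hi
  obtain ⟨hq, hq0⟩ := hF.hit_left hj
  set p := (hit (vtx L i) (vtx L (i + 1)) R).val
  set q := (hit (vtx R j) (vtx R (j + 1)) L).val
  split_ifs with h1 h2
  · have hne : cross (vtx L i) (vtx L (i + 1)) (vtx R j)
        ≠ cross (vtx L i) (vtx L (i + 1)) (vtx R (j + 1)) := by
      rw [hcr, hcr]
      intro h
      have := (hrj.h_lt_iff hr hi).1 (hF.frame.r_up j hj)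
      exact absurd (mul_left_cancel₀ hc.ne' h) this.ne
    obtain ⟨ht1, ht2⟩ := meet_cross hne
    rw [hcr] at ht1
    rw [hdr] at ht2
    have ht1 := (mul_eq_zero.1 ht1).resolve_left hc.ne'
    have ht2 := (mul_eq_zero.1 ht2).resolve_left hd.ne
    exact
      { q_on := hq
        p_on := hp
        cL_spec := by rintro _ ⟨⟩; exact ⟨hi, h1, hp0.ge⟩
        cR_spec := by rintro _ ⟨⟩; exact ⟨hj, h2, hq0.ge⟩
        q_attained := Or.inr (Or.inr ⟨j, rfl, hq0⟩)
        p_attained := Or.inr (Or.inr ⟨i, rfl, hp0⟩)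
        t_spec := Or.inr (Or.inr ⟨i, rfl, j, rfl, ht1, ht2, hp0, hq0⟩) }
  · push Not at h2
    exact
      { q_on := hq
        p_on := hr
        cL_spec := by
          rintro _ ⟨⟩
          exact ⟨hi, h1, hp0.ge.trans ((hp.h_lt_iff hr hi).1 h2).le⟩
        cR_spec := by rintro _ ⟨⟩; exact ⟨hj, le_rfl, hq0.ge⟩
        q_attained := Or.inr (Or.inr ⟨j, rfl, hq0⟩)
        p_attained := Or.inr (Or.inl ⟨j, rfl, rfl⟩)
        t_spec := Or.inl rfl }
  · push Not at h1
    have h3 : 0 < hF.frame.B j (vtx L (i + 1)) := by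
      rw [← hq0]; exact (hq.h_lt_iff hl hj).1 h1
    have h4 := hl.h_right_lt hj h3
    exact
      { q_on := hl
        p_on := hp
        cL_spec := by rintro _ ⟨⟩; exact ⟨hi, le_rfl, hp0.ge⟩
        cR_spec := by
          rintro _ ⟨⟩
          refine ⟨hj, ?_, h3.le⟩
          -- Here `l (i + 1)` is higher than `r (j + 1)`. If `p` were lower than `r (j + 1)`, that
          -- vertex would be beyond the left tangent, hence higher than `l (i + 1)`.
          by_contra! h5
          have h6 := (hp.h_lt_iff hr hi).1 h5
          rw [hp0] at h6
          have := hr.h_left_lt hi h6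
          exact lt_asymm h4 this
        q_attained := Or.inr (Or.inl ⟨i, rfl, rfl⟩)
        p_attained := Or.inr (Or.inr ⟨i, rfl, hp0⟩)
        t_spec := Or.inl rfl }

theorem isFrontCurve_source (hF : IsFunnel L R) :
    hF.frame.IsFrontCurve none none (upseg L R .source).val := by
  have : (upseg L R .source).val = ⟨vtx L 0, vtx L 0, vtx R 0⟩ := by simp [upseg]
  rw [this]
  exact
    { q_on := hF.frame.onL_vertex (Nat.zero_le _)
      p_on := Frame.onR_vertex (H := hF.frame) (Nat.zero_le _)
      cL_spec := by simp
      cR_spec := by simp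
      q_attained := Or.inl rfl
      p_attained := Or.inl rfl
      t_spec := Or.inl rfl }

/-- The upper segment of the node includes the apex. -/
def ReachesApex (L R : List Pt) (z : Node) : Prop :=
  (hasApex L (upseg L R z).val).val = true

theorem reachesApex_iff (hF : IsFunnel L R) (z : Node) :
    ReachesApex L R z ↔ (upseg L R z).val.q = hF.frame.l hF.frame.K ∨
      (upseg L R z).val.p = hF.frame.l hF.frame.K :=
  hasApex_val L _

theorem isFrontCurve_or (hF : IsFunnel L R) {z : Node} (hz : z.Valid hF.frame) :
    hF.frame.IsFrontCurve z.leftPart z.rightPart (upseg L R z).val ∨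
      z = .left hF.frame.K ∨ z = .right hF.frame.M := by
  cases z with
  | source => exact Or.inl hF.isFrontCurve_source
  | sink => exact hz.elim
  | left i =>
    rcases Nat.lt_or_eq_of_le hz with h | h
    · exact Or.inl (hF.isFrontCurve_left h)
    · exact Or.inr (Or.inl (h ▸ rfl))
  | right j =>
    rcases Nat.lt_or_eq_of_le hz with h | h
    · exact Or.inl (hF.isFrontCurve_right h)
    · exact Or.inr (Or.inr (h ▸ rfl))
  | pair i j => exact Or.inl (hF.isFrontCurve_pair hz.1 hz.2)

theorem upper_empty_of_reachesApex (hF : IsFunnel L R) {z : Node} (hz : z.Valid hF.frame)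
    (ha : ReachesApex L R z) (w : Pt) : ¬ hF.frame.Upper z.leftPart z.rightPart w := by
  rcases hF.isFrontCurve_or hz with h | rfl | rfl
  · exact h.upper_empty_of_apex ((hF.reachesApex_iff z).1 ha) w
  · exact fun h => lt_irrefl _ (h.2.1 _ rfl).1
  · exact fun h => lt_irrefl _ (h.2.2 _ rfl).1

theorem isFrontCurve_of_not_reachesApex (hF : IsFunnel L R) {z : Node} (hz : z.Valid hF.frame)
    (ha : ¬ ReachesApex L R z) :
    hF.frame.IsFrontCurve z.leftPart z.rightPart (upseg L R z).val := by
  have hK := hF.frame_K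
  have hM := hF.frame_M
  rcases hF.isFrontCurve_or hz with h | rfl | rfl
  · exact h
  · refine absurd ?_ ha
    rw [ReachesApex, hasApex_val]
    simp only [upseg]
    rw [upsegLeft_val_of_ge (by omega)]
    exact Or.inl rfl
  · refine absurd ?_ ha
    rw [ReachesApex, hasApex_val]
    simp only [upseg]
    rw [upsegRight_val_of_ge (by omega)]
    exact Or.inl rfl

/-- The region above the base is the whole funnel, which is not empty. -/
theorem not_reachesApex_source (hF : IsFunnel L R) : ¬ ReachesApex L R .source := fun h =>
  hF.isFrontCurve_source.upper_empty_of_apex ((hF.reachesApex_iff _).1 h) (vtx L 0)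
    ⟨(hF.frame.onL_vertex (Nat.zero_le _)).inF, by simp, by simp⟩

/-! ### The visibility test -/

/-- The orientation of `v`, `w`, `c` measures how far `A e c` exceeds the linear interpolation of `A
e v` and `A e w` at the height of `c`. Vertices of the left chain have `A e ≥ 0`, so they cannot
block a segment with `A e ≤ 0` at both ends. -/
theorem cross_eq_A (hF : IsFunnel L R) (e : ℕ) (v w c : Pt) :
    ((baseVec L R).1 ^ 2 + (baseVec L R).2 ^ 2) * cross v w c =
      (hF.frame.h w - hF.frame.h v) * hF.frame.A e c
      - (hF.frame.h w - hF.frame.h c) * hF.frame.A e v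
      - (hF.frame.h c - hF.frame.h v) * hF.frame.A e w := by
  rw [cross_eq_coords]
  change (hF.frame.x w - hF.frame.x v) * (hF.frame.h c - hF.frame.h v) -
    (hF.frame.h w - hF.frame.h v) * (hF.frame.x c - hF.frame.x v) = _
  simp only [Frame.A]; ring

theorem cross_eq_B (hF : IsFunnel L R) (f : ℕ) (v w c : Pt) :
    ((baseVec L R).1 ^ 2 + (baseVec L R).2 ^ 2) * cross w v c =
      (hF.frame.h w - hF.frame.h v) * hF.frame.B f c
      - (hF.frame.h w - hF.frame.h c) * hF.frame.B f v
      - (hF.frame.h c - hF.frame.h v) * hF.frame.B f w := by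
  rw [cross_eq_coords]
  change (hF.frame.x v - hF.frame.x w) * (hF.frame.h c - hF.frame.h w) -
    (hF.frame.h v - hF.frame.h w) * (hF.frame.x c - hF.frame.x w) = _
  simp only [Frame.B]; ring

theorem clear_left (hF : IsFunnel L R) {e : ℕ} (he : e < hF.frame.K) {v w : Pt}
    (hv : hF.frame.A e v ≤ 0) (hw : hF.frame.A e w ≤ 0) :
    (clear L R v w (height L R v) (height L R w) L).val = true := by
  rw [clear_val]
  intro c hc h1 h2
  rw [hF.height_lt_iff] at h1 h2
  obtain ⟨d, hd, rfl⟩ := hF.mem_left_iff.1 hc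
  have h3 : 0 ≤ hF.frame.A e (vtx L d) := hF.frame.A_vertex_nonneg he hd
  have h4 := hF.cross_eq_A e v w (vtx L d)
  refine nonneg_of_mul_nonneg_right ?_ hF.baseVec_sq_pos
  rw [h4]
  have h5 := mul_nonneg (sub_nonneg.2 (h1.trans h2).le) h3
  have h6 := mul_nonpos_of_nonneg_of_nonpos (sub_nonneg.2 h2.le) hv
  have h7 := mul_nonpos_of_nonneg_of_nonpos (sub_nonneg.2 h1.le) hw
  linarith

theorem clear_right (hF : IsFunnel L R) {f : ℕ} (hf : f < hF.frame.M) {v w : Pt}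
    (hv : hF.frame.B f v ≤ 0) (hw : hF.frame.B f w ≤ 0) :
    (clear L R w v (height L R v) (height L R w) R).val = true := by
  rw [clear_val]
  intro c hc h1 h2
  rw [hF.height_lt_iff] at h1 h2
  obtain ⟨d, hd, rfl⟩ := hF.mem_right_iff.1 hc
  have h3 : 0 ≤ hF.frame.B f (vtx R d) := hF.frame.B_vertex_nonneg hf hd
  have h4 := hF.cross_eq_B f v w (vtx R d)
  refine nonneg_of_mul_nonneg_right ?_ hF.baseVec_sq_pos
  rw [h4]
  have h5 := mul_nonneg (sub_nonneg.2 (h1.trans h2).le) h3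
  have h6 := mul_nonpos_of_nonneg_of_nonpos (sub_nonneg.2 h2.le) hv
  have h7 := mul_nonpos_of_nonneg_of_nonpos (sub_nonneg.2 h1.le) hw
  linarith

theorem seesT_of_nonpos (hF : IsFunnel L R) {e f : ℕ} (he : e < hF.frame.K) (hf : f < hF.frame.M)
    {v w : Pt} (hv : hF.frame.A e v ≤ 0) (hw : hF.frame.A e w ≤ 0)
    (hv' : hF.frame.B f v ≤ 0) (hw' : hF.frame.B f w ≤ 0) : (seesT L R v w).val = true := by
  rcases le_or_gt (height L R v) (height L R w) with h | h
  · rw [seesT_val_of_le h]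
    exact ⟨hF.clear_left he hv hw, hF.clear_right hf hv' hw'⟩
  · rw [seesT_val_of_gt h]
    exact ⟨hF.clear_left he hw hv, hF.clear_right hf hw' hv'⟩

/-- If `v` were beyond the line of edge `j`, then `r (j + 1)` would lie at a height strictly between
`p` and `v`. As `B j` vanishes at `p` and at `r (j + 1)`, that vertex would block the segment. -/
theorem B_nonpos_of_seesT (hF : IsFunnel L R) {j : ℕ} {s : Front} (hp : hF.frame.OnR s.p)
    (hj : Frame.IsFrontCurve.RightIndex hF.frame s j) {v : Pt} (hv : hF.frame.OnL v)
    (hs : (seesT L R v s.p).val = true) : hF.frame.B j v ≤ 0 := by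
  by_contra! hB
  obtain ⟨hjM, h1, h2⟩ := hj
  have h3 := hv.h_right_lt hjM hB
  have h4 : hF.frame.B j s.p = 0 :=
    le_antisymm (hp.inF.B_nonpos hjM h1 h2.le) (hp.B_nonneg hjM)
  rw [seesT_val_of_gt (hF.height_lt_iff.2 (h2.trans h3)), clear_val, clear_val] at hs
  have h5 := hs.2 (vtx R (j + 1)) (hF.mem_right_iff.2 ⟨_, hjM, rfl⟩) (hF.height_lt_iff.2 h2)
    (hF.height_lt_iff.2 h3)
  have h6 := hF.cross_eq_B j s.p v (vtx R (j + 1))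
  have h7 := mul_nonneg hF.baseVec_sq_pos.le h5
  have h8 : hF.frame.B j (vtx R (j + 1)) = 0 := hF.frame.B_next hjM
  rw [h6, h8, h4, mul_zero, mul_zero, sub_zero, zero_sub] at h7
  have h9 := mul_pos (sub_pos.2 h2) hB
  exact absurd h7 (not_le.2 (neg_neg_of_pos h9))

theorem A_nonpos_of_seesT (hF : IsFunnel L R) {i : ℕ} {s : Front} (hq : hF.frame.OnL s.q)
    (hi : Frame.IsFrontCurve.LeftIndex hF.frame s i) {v : Pt} (hv : hF.frame.OnR v)
    (hs : (seesT L R v s.q).val = true) : hF.frame.A i v ≤ 0 := by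
  by_contra! hA
  obtain ⟨hiK, h1, h2⟩ := hi
  have h3 := hv.h_left_lt hiK hA
  have h4 : hF.frame.A i s.q = 0 :=
    le_antisymm (hq.inF.A_nonpos hiK h1 h2.le) (hq.A_nonneg hiK)
  rw [seesT_val_of_gt (hF.height_lt_iff.2 (h2.trans h3)), clear_val, clear_val] at hs
  have h5 := hs.1 (vtx L (i + 1)) (hF.mem_left_iff.2 ⟨_, hiK, rfl⟩) (hF.height_lt_iff.2 h2)
    (hF.height_lt_iff.2 h3)
  have h6 := hF.cross_eq_A i s.q v (vtx L (i + 1))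
  have h7 := mul_nonneg hF.baseVec_sq_pos.le h5
  have h8 : hF.frame.A i (vtx L (i + 1)) = 0 := hF.frame.A_next hiK
  rw [h6, h8, h4, mul_zero, mul_zero, sub_zero, zero_sub] at h7
  have h9 := mul_pos (sub_pos.2 h2) hA
  exact absurd h7 (not_le.2 (neg_neg_of_pos h9))

end IsFunnel
end FunnelGuarding

namespace FunnelGuarding

namespace IsFunnel

variable {L R : List Pt}

open FunnelGuarding.Frame FunnelGuarding.Frame.IsFrontCurve

/-! ### The out-neighbours of a node -/

theorem leftIndex_lastNotAbove (hF : IsFunnel L R) {s : Front} (hq : hF.frame.OnL s.q)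
    (hne : s.q ≠ hF.frame.l hF.frame.K) :
    LeftIndex hF.frame s (lastNotAbove L R (height L R s.q) L 0 0).val := by
  have hK := hF.frame_K
  have hlt := hq.h_lt_apex hne
  obtain ⟨h1, h2, h3⟩ := lastNotAbove_spec L R (height L R s.q) L
    ⟨0, by omega, hF.height_le_iff.2 hq.inF.1⟩
  set i := (lastNotAbove L R (height L R s.q) L 0 0).val
  rw [hF.height_le_iff] at h2
  have hi : i < hF.frame.K := by
    by_contra h
    have : i = hF.frame.K := by omega
    rw [this] at h2
    exact absurd hlt (not_lt.2 h2)
  refine ⟨hi, h2, ?_⟩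
  by_contra! h
  have := h3 (i + 1) (by omega) (hF.height_le_iff.2 h)
  omega

theorem rightIndex_lastNotAbove (hF : IsFunnel L R) {s : Front} (hp : hF.frame.OnR s.p)
    (hne : s.p ≠ hF.frame.r hF.frame.M) :
    RightIndex hF.frame s (lastNotAbove L R (height L R s.p) R 0 0).val := by
  have hM := hF.frame_M
  have hlt := hp.h_lt_apex hne
  have h0 : hF.frame.h (vtx R 0) ≤ hF.frame.h s.p := by
    have := hp.inF.1
    rwa [hF.frame.base] at this
  obtain ⟨h1, h2, h3⟩ := lastNotAbove_spec L R (height L R s.p) R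
    ⟨0, by omega, hF.height_le_iff.2 h0⟩
  set j := (lastNotAbove L R (height L R s.p) R 0 0).val
  rw [hF.height_le_iff] at h2
  have hj : j < hF.frame.M := by
    by_contra h
    have : j = hF.frame.M := by omega
    rw [this] at h2
    exact absurd hlt (not_lt.2 h2)
  refine ⟨hj, h2, ?_⟩
  by_contra! h
  have := h3 (j + 1) (by omega) (hF.height_le_iff.2 h)
  omega

theorem lastBelow_left (hF : IsFunnel L R) {j : ℕ} (hj : j < hF.frame.M)
    (hex : ∃ c ≤ hF.frame.K, hF.frame.B j (vtx L c) < 0) :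
    (lastBelow L R (height L R (upsegRight L R j).val.q) L 0 0).val < hF.frame.K ∧
      ∀ c ≤ hF.frame.K, hF.frame.B j (vtx L c) < 0 ↔
        c ≤ (lastBelow L R (height L R (upsegRight L R j).val.q) L 0 0).val := by
  have hK := hF.frame_K
  have hM := hF.frame_M
  rw [upsegRight_val_of_lt (by omega)]
  dsimp only
  obtain ⟨hq, hq0⟩ := hF.hit_left hj
  set q := (hit (vtx R j) (vtx R (j + 1)) L).val
  have key : ∀ c ≤ hF.frame.K, height L R (vtx L c) < height L R q ↔
      hF.frame.B j (vtx L c) < 0 := fun c hc => by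
    rw [hF.height_lt_iff, ← hq0]
    exact (hF.frame.onL_vertex hc).h_lt_iff hq hj
  obtain ⟨c₀, hc₀, h0⟩ := hex
  obtain ⟨h1, h2, h3⟩ := lastBelow_spec L R (height L R q) L ⟨c₀, by omega, (key c₀ hc₀).2 h0⟩
  set a := (lastBelow L R (height L R q) L 0 0).val
  refine ⟨?_, fun c hc => ⟨fun h => h3 c (by omega) ((key c hc).2 h), fun h => ?_⟩⟩
  · by_contra h
    have : a = hF.frame.K := by omega
    rw [this, hF.height_lt_iff] at h2
    exact absurd hq.inF.h_le (not_le.2 h2)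
  · rw [← key c hc]
    exact (hF.height_le_iff.2 (hF.frame.h_l_mono h (by omega))).trans_lt h2

theorem lastBelow_right (hF : IsFunnel L R) {i : ℕ} (hi : i < hF.frame.K)
    (hex : ∃ c ≤ hF.frame.M, hF.frame.A i (vtx R c) < 0) :
    (lastBelow L R (height L R (upsegLeft L R i).val.p) R 0 0).val < hF.frame.M ∧
      ∀ c ≤ hF.frame.M, hF.frame.A i (vtx R c) < 0 ↔
        c ≤ (lastBelow L R (height L R (upsegLeft L R i).val.p) R 0 0).val := by
  have hK := hF.frame_K
  have hM := hF.frame_M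
  rw [upsegLeft_val_of_lt (by omega)]
  dsimp only
  obtain ⟨hp, hp0⟩ := hF.hit_right hi
  set p := (hit (vtx L i) (vtx L (i + 1)) R).val
  have key : ∀ c ≤ hF.frame.M, height L R (vtx R c) < height L R p ↔
      hF.frame.A i (vtx R c) < 0 := fun c hc => by
    rw [hF.height_lt_iff, ← hp0]
    exact (onR_vertex (H := hF.frame) hc).h_lt_iff hp hi
  obtain ⟨c₀, hc₀, h0⟩ := hex
  obtain ⟨h1, h2, h3⟩ := lastBelow_spec L R (height L R p) R ⟨c₀, by omega, (key c₀ hc₀).2 h0⟩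
  set b := (lastBelow L R (height L R p) R 0 0).val
  refine ⟨?_, fun c hc => ⟨fun h => h3 c (by omega) ((key c hc).2 h), fun h => ?_⟩⟩
  · by_contra h
    have : b = hF.frame.M := by omega
    rw [this, hF.height_lt_iff] at h2
    have h4 := hp.inF.h_le
    rw [hF.frame.apex] at h4
    exact absurd h4 (not_le.2 h2)
  · rw [← key c hc]
    exact (hF.height_le_iff.2 (hF.frame.h_r_mono h (by omega))).trans_lt h2

/-- The test against three points of the front becomes one sign. Failure shows already at the right
end, and success follows because edges `i` and `j` are common to the vertex and the entire front. -/
theorem topSeeing_left (hF : IsFunnel L R) {cL cR : Option ℕ} {s : Front}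
    (hs : hF.frame.IsFrontCurve cL cR s) {i j : ℕ} (hi : LeftIndex hF.frame s i)
    (hj : RightIndex hF.frame s j) :
    (topSeeing L R L s i).val = if hF.frame.B j (vtx L (i + 1)) ≤ 0 then i + 1 else i := by
  have hK := hF.frame_K
  have hi' := hi.1
  have hl : hF.frame.OnL (vtx L (i + 1)) := hF.frame.onL_vertex hi.1
  rw [topSeeing_val (by omega)]
  congr 1
  rw [seesFront_val, eq_iff_iff]
  constructor
  · exact fun h => hF.B_nonpos_of_seesT hs.p_on hj hl h.2.2
  · intro h
    have h0 : hF.frame.A i (vtx L (i + 1)) ≤ 0 := (hF.frame.A_next hi.1).le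
    exact ⟨hF.seesT_of_nonpos hi.1 hj.1 h0 (hs.A_q_nonpos hi) h (hs.B_q_nonpos hi hj),
      hF.seesT_of_nonpos hi.1 hj.1 h0 (hs.A_t_nonpos hi hj) h (hs.B_t_nonpos hi hj),
      hF.seesT_of_nonpos hi.1 hj.1 h0 (hs.A_p_nonpos hi hj) h (hs.B_p_nonpos hj)⟩

theorem topSeeing_right (hF : IsFunnel L R) {cL cR : Option ℕ} {s : Front}
    (hs : hF.frame.IsFrontCurve cL cR s) {i j : ℕ} (hi : LeftIndex hF.frame s i)
    (hj : RightIndex hF.frame s j) :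
    (topSeeing L R R s j).val = if hF.frame.A i (vtx R (j + 1)) ≤ 0 then j + 1 else j := by
  have hM := hF.frame_M
  have hj' := hj.1
  have hr : hF.frame.OnR (vtx R (j + 1)) := onR_vertex (H := hF.frame) hj.1
  rw [topSeeing_val (by omega)]
  congr 1
  rw [seesFront_val, eq_iff_iff]
  constructor
  · exact fun h => hF.A_nonpos_of_seesT hs.q_on hi hr h.1
  · intro h
    have h0 : hF.frame.B j (vtx R (j + 1)) ≤ 0 := (hF.frame.B_next hj.1).le
    exact ⟨hF.seesT_of_nonpos hi.1 hj.1 h (hs.A_q_nonpos hi) h0 (hs.B_q_nonpos hi hj),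
      hF.seesT_of_nonpos hi.1 hj.1 h (hs.A_t_nonpos hi hj) h0 (hs.B_t_nonpos hi hj),
      hF.seesT_of_nonpos hi.1 hj.1 h (hs.A_p_nonpos hi hj) h0 (hs.B_p_nonpos hj)⟩

/-- Description of the out-neighbours `left i'`, `right j'`, `pair a b` of a node whose front ends
on the edges `i` and `j`. -/
structure IsStep (H : Frame) (t : Node) (i j i' j' a b : ℕ) : Prop where
  front : H.IsFront t.leftPart t.rightPart i j
  left_eq : i' = if H.B j (H.l (i + 1)) ≤ 0 then i + 1 else i
  right_eq : j' = if H.A i (H.r (j + 1)) ≤ 0 then j + 1 else j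
  pair_left_lt : a < H.K
  pair_right_lt : b < H.M
  pair_left_iff : ∀ c ≤ H.K, H.B j (H.l c) < 0 ↔ c ≤ a
  pair_right_iff : ∀ c ≤ H.M, H.A i (H.r c) < 0 ↔ c ≤ b

/-- From here on the computed indices enter only through the signs of `A` and `B` at vertices. -/
theorem outNeighbours_spec (hF : IsFunnel L R) {t : Node} (ht : t.Valid hF.frame)
    (hna : ¬ ReachesApex L R t) :
    ∃ i j i' j' a b, IsStep hF.frame t i j i' j' a b ∧
      (outNeighbours L R t).val = [(.left i', 1), (.right j', 1), (.pair a b, 2)] := by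
  have hs := hF.isFrontCurve_of_not_reachesApex ht hna
  rw [hF.reachesApex_iff, not_or] at hna
  have hi := hF.leftIndex_lastNotAbove hs.q_on hna.1
  have hj := hF.rightIndex_lastNotAbove hs.p_on (hF.frame.apex ▸ hna.2)
  have hf := hs.isFront hi hj
  obtain ⟨h1, h2⟩ := hF.lastBelow_left hj.1 ⟨_, hi.1.le, hf.vertex_neg.1⟩
  obtain ⟨h3, h4⟩ := hF.lastBelow_right hi.1 ⟨_, hj.1.le, hf.vertex_neg.2⟩
  refine ⟨_, _, _, _, _, _,
    ⟨hf, hF.topSeeing_left hs hi hj, hF.topSeeing_right hs hi hj, h1, h3, h2, h4⟩, ?_⟩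
  simp [outNeighbours]

namespace IsStep

variable {H : Frame} {t : Node} {i j i' j' a b : ℕ}

theorem le_left (hs : IsStep H t i j i' j' a b) : i ≤ i' := by
  rw [hs.left_eq]; split_ifs <;> omega

theorem le_right (hs : IsStep H t i j i' j' a b) : j ≤ j' := by
  rw [hs.right_eq]; split_ifs <;> omega

theorem left_le (hs : IsStep H t i j i' j' a b) : i' ≤ H.K := by
  have := hs.front.left_lt
  rw [hs.left_eq]; split_ifs <;> omega

theorem right_le (hs : IsStep H t i j i' j' a b) : j' ≤ H.M := by
  have := hs.front.right_lt
  rw [hs.right_eq]; split_ifs <;> omega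

theorem le_pair_left (hs : IsStep H t i j i' j' a b) : i ≤ a :=
  (hs.pair_left_iff i hs.front.left_lt.le).1 hs.front.vertex_neg.1

theorem le_pair_right (hs : IsStep H t i j i' j' a b) : j ≤ b :=
  (hs.pair_right_iff j hs.front.right_lt.le).1 hs.front.vertex_neg.2

theorem sees_left (hs : IsStep H t i j i' j' a b) {w : Pt}
    (hw : H.Upper t.leftPart t.rightPart w) (hn : ¬ H.AboveL i' w) :
    H.CommonEdges (H.l i') w := by
  have h := hs.left_eq
  split_ifs at h with hB <;> subst h
  · exact hs.front.sees_left_succ hw hB hn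
  · exact hs.front.sees_left hw hn

theorem sees_right (hs : IsStep H t i j i' j' a b) {w : Pt}
    (hw : H.Upper t.leftPart t.rightPart w) (hn : ¬ H.AboveR j' w) :
    H.CommonEdges (H.r j') w := by
  rw [← mirror_CommonEdges]
  rw [← mirror_AboveL] at hn
  rw [← mirror_Upper] at hw
  have h := hs.right_eq
  split_ifs at h with hA <;> subst h
  · exact hs.front.mirror.sees_left_succ hw (by rw [mirror_B]; exact hA) hn
  · exact hs.front.mirror.sees_left hw hn

theorem sees_pair (hs : IsStep H t i j i' j' a b) {w : Pt}
    (hw : H.Upper t.leftPart t.rightPart w) (hn : ¬ (H.AboveL a w ∧ H.AboveR b w)) :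
    H.CommonEdges (H.l a) w ∨ H.CommonEdges (H.r b) w :=
  hs.front.sees_pair hw hs.le_pair_left hs.pair_left_lt hs.le_pair_right hs.pair_right_lt
    ((hs.pair_left_iff a hs.pair_left_lt.le).2 le_rfl)
    ((hs.pair_right_iff b hs.pair_right_lt.le).2 le_rfl) hn

end IsStep

/-! ### What the guards of an out-neighbour see. -/

/-- The guards listed in a node. -/
def _root_.FunnelGuarding.Node.guards (L R : List Pt) : Node → List Pt
  | .left i => [vtx L i]
  | .right j => [vtx R j]
  | .pair i j => [vtx L i, vtx R j]
  | _ => []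

theorem sees_of_commonEdges (hF : IsFunnel L R) {g w : Pt} (h : hF.frame.CommonEdges g w)
    (hg : hF.frame.InF g) (hw : hF.frame.InF w) : Sees (region L R) g w := by
  rw [hF.region_eq]
  exact h.segment_inF hg hw

theorem sees_iff (hF : IsFunnel L R) {g w : Pt} :
    Sees (region L R) g w ↔ ∀ u ∈ segment ℝ g w, hF.frame.InF u := by
  rw [hF.region_eq]; rfl

theorem valid_of_mem_outNeighbours (hF : IsFunnel L R) {t : Node} (ht : t.Valid hF.frame)
    (hna : ¬ ReachesApex L R t) {z : Node} {w : ℕ} (hz : (z, w) ∈ (outNeighbours L R t).val) :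
    z.Valid hF.frame ∧ w = (z.guards L R).length := by
  obtain ⟨i, j, i', j', a, b, hs, h⟩ := hF.outNeighbours_spec ht hna
  rw [h] at hz
  simp only [List.mem_cons, Prod.mk.injEq, List.not_mem_nil, or_false] at hz
  rcases hz with ⟨rfl, rfl⟩ | ⟨rfl, rfl⟩ | ⟨rfl, rfl⟩
  · exact ⟨hs.left_le, rfl⟩
  · exact ⟨hs.right_le, rfl⟩
  · exact ⟨⟨hs.pair_left_lt, hs.pair_right_lt⟩, rfl⟩

theorem guards_mem (hF : IsFunnel L R) {z : Node} (hz : z.Valid hF.frame) {g : Pt}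
    (hg : g ∈ z.guards L R) : g ∈ L ∨ g ∈ R := by
  rw [hF.mem_left_iff, hF.mem_right_iff]
  cases z with
  | source => simp [Node.guards] at hg
  | sink => simp [Node.guards] at hg
  | left i => exact Or.inl ⟨i, hz, by simpa [Node.guards] using hg⟩
  | right j => exact Or.inr ⟨j, hz, by simpa [Node.guards] using hg⟩
  | pair i j =>
    simp only [Node.guards, List.mem_cons, List.not_mem_nil, or_false] at hg
    rcases hg with rfl | rfl
    · exact Or.inl ⟨i, hz.1.le, rfl⟩
    · exact Or.inr ⟨j, hz.2.le, rfl⟩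

/-- The guards of an out-neighbour see everything between the two upper segments. -/
theorem guards_see (hF : IsFunnel L R) {t : Node} (ht : t.Valid hF.frame)
    (hna : ¬ ReachesApex L R t) {z : Node} {n : ℕ} (hz : (z, n) ∈ (outNeighbours L R t).val)
    {w : Pt} (hw : hF.frame.Upper t.leftPart t.rightPart w)
    (hn : ¬ hF.frame.Upper z.leftPart z.rightPart w) :
    ∃ g ∈ z.guards L R, Sees (region L R) g w := by
  obtain ⟨i, j, i', j', a, b, hs, h⟩ := hF.outNeighbours_spec ht hna
  rw [h] at hz
  simp only [List.mem_cons, Prod.mk.injEq, List.not_mem_nil, or_false] at hz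
  have hl : ∀ c ≤ hF.frame.K, hF.frame.CommonEdges (vtx L c) w → Sees (region L R) (vtx L c) w :=
    fun c hc h => hF.sees_of_commonEdges h (hF.frame.onL_vertex hc).inF hw.1
  have hr : ∀ c ≤ hF.frame.M, hF.frame.CommonEdges (vtx R c) w → Sees (region L R) (vtx R c) w :=
    fun c hc h => hF.sees_of_commonEdges h (onR_vertex (H := hF.frame) hc).inF hw.1
  rcases hz with ⟨rfl, rfl⟩ | ⟨rfl, rfl⟩ | ⟨rfl, rfl⟩
  · refine ⟨vtx L i', by simp [Node.guards], hl _ hs.left_le (hs.sees_left hw fun h' => hn ?_)⟩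
    exact ⟨hw.1, by simpa [Node.leftPart] using h', by simp [Node.rightPart]⟩
  · refine ⟨vtx R j', by simp [Node.guards], hr _ hs.right_le (hs.sees_right hw fun h' => hn ?_)⟩
    exact ⟨hw.1, by simp [Node.leftPart], by simpa [Node.rightPart] using h'⟩
  · rcases hs.sees_pair hw (fun h' => hn ⟨hw.1, by simpa [Node.leftPart] using h'.1,
      by simpa [Node.rightPart] using h'.2⟩) with h' | h'
    · exact ⟨vtx L a, by simp [Node.guards], hl _ hs.pair_left_lt.le h'⟩
    · exact ⟨vtx R b, by simp [Node.guards], hr _ hs.pair_right_lt.le h'⟩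

/-! ### The lower bound -/

open Classical in
/-- The guards of `D` which see nothing above the upper segment of `t`. -/
def spent (hF : IsFunnel L R) (D : Finset Pt) (t : Node) : Finset Pt :=
  D.filter fun g => ∀ w, hF.frame.Upper t.leftPart t.rightPart w → ¬ Sees (region L R) g w

theorem mem_spent (hF : IsFunnel L R) {D : Finset Pt} {t : Node} {g : Pt} :
    g ∈ hF.spent D t ↔
      g ∈ D ∧ ∀ w, hF.frame.Upper t.leftPart t.rightPart w → ¬ Sees (region L R) g w := by
  simp [spent]

theorem spent_mono (hF : IsFunnel L R) {D : Finset Pt} {t z : Node}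
    (h : ∀ w, hF.frame.Upper z.leftPart z.rightPart w → hF.frame.Upper t.leftPart t.rightPart w) :
    hF.spent D t ⊆ hF.spent D z := fun g hg => by
  rw [mem_spent] at hg ⊢
  exact ⟨hg.1, fun w hw => hg.2 w (h w hw)⟩

theorem upper_of_outNeighbour (hF : IsFunnel L R) {t : Node} (ht : t.Valid hF.frame)
    (hna : ¬ ReachesApex L R t) {z : Node} {n : ℕ} (hz : (z, n) ∈ (outNeighbours L R t).val)
    {w : Pt} (hw : hF.frame.Upper z.leftPart z.rightPart w) :
    hF.frame.Upper t.leftPart t.rightPart w := by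
  obtain ⟨i, j, i', j', a, b, hs, h⟩ := hF.outNeighbours_spec ht hna
  rw [h] at hz
  simp only [List.mem_cons, Prod.mk.injEq, List.not_mem_nil, or_false] at hz
  rcases hz with ⟨rfl, rfl⟩ | ⟨rfl, rfl⟩ | ⟨rfl, rfl⟩
  · exact hs.front.upper_of_aboveL hw.1 (hw.2.1 _ rfl) hs.le_left
  · exact hs.front.upper_of_aboveR hw.1 (hw.2.2 _ rfl) hs.le_right
  · exact hs.front.upper_of_aboveL hw.1 (hw.2.1 _ rfl) hs.le_pair_left

/-- By nesting, whatever is above the upper segment of `c` is above that of every earlier vertex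
`a`, and no vertex sees points above its own upper segment. -/
theorem left_mem_spent (hF : IsFunnel L R) {D : Finset Pt} {z : Node} {a c : ℕ}
    (hz : c ∈ z.leftPart) (hac : a ≤ c) (ha : vtx L a ∈ D) : vtx L a ∈ hF.spent D z := by
  rw [mem_spent]
  refine ⟨ha, fun w hw hs => ?_⟩
  rw [hF.sees_iff] at hs
  exact ((hw.2.1 c hz).mono hac).not_sees hs

theorem right_mem_spent (hF : IsFunnel L R) {D : Finset Pt} {z : Node} {b c : ℕ}
    (hz : c ∈ z.rightPart) (hbc : b ≤ c) (hb : vtx R b ∈ D) : vtx R b ∈ hF.spent D z := by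
  rw [mem_spent]
  refine ⟨hb, fun w hw hs => ?_⟩
  rw [hF.sees_iff] at hs
  exact (mirror_AboveL.1 ((mirror_AboveL.2 (hw.2.2 c hz)).mono hbc)).not_sees hs

theorem left_ne_right (hF : IsFunnel L R) {a b : ℕ} (ha : a < hF.frame.K) (hb : b < hF.frame.M) :
    vtx L a ≠ vtx R b := fun h => by
  have hM := hF.frame.M_pos
  have hK := hF.frame.K_pos
  have h1 := hF.frame.B_last_neg (w := hF.frame.l a)
    (hF.frame.A_vertex_nonneg (by omega) ha.le) (hF.frame.h_l_strictMono ha le_rfl)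
  have h2 := hF.frame.B_vertex_nonneg (f := hF.frame.M - 1) (c := b) (by omega) hb.le
  change hF.frame.B _ (vtx L a) < 0 at h1
  change 0 ≤ hF.frame.B _ (vtx R b) at h2
  rw [h] at h1
  linarith

/-- A guard set contains a guard of the left chain within reach of the front, or one of the right
chain that is not above the line through the left edge of the front. -/
theorem guard_cases_left (hF : IsFunnel L R) {g : Pt} (hg : g ∈ L ∨ g ∈ R)
    {i : ℕ} (hi : i < hF.frame.K) (hA : hF.frame.A i g ≤ 0) :
    g = vtx L i ∨ g = vtx L (i + 1) ∨ ∃ b < hF.frame.M, g = vtx R b := by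
  have key : ∀ c ≤ hF.frame.K, hF.frame.A i (vtx L c) ≤ 0 → c = i ∨ c = i + 1 := by
    intro c hc h
    by_contra! h'
    exact absurd (hF.frame.A_vertex_pos hi hc h'.1 h'.2) (not_lt.2 h)
  rcases hg with hg | hg
  · obtain ⟨c, hc, rfl⟩ := hF.mem_left_iff.1 hg
    rcases key c hc hA with rfl | rfl
    · exact Or.inl rfl
    · exact Or.inr (Or.inl rfl)
  · obtain ⟨c, hc, rfl⟩ := hF.mem_right_iff.1 hg
    rcases hc.lt_or_eq with h | rfl
    · exact Or.inr (Or.inr ⟨c, h, rfl⟩)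
    · have : vtx L hF.frame.K = vtx R hF.frame.M := hF.frame.apex
      rw [← this] at hA ⊢
      rcases key _ le_rfl hA with h | h <;> rw [h]
      · exact Or.inl rfl
      · exact Or.inr (Or.inl rfl)

theorem guard_cases_right (hF : IsFunnel L R) {g : Pt} (hg : g ∈ L ∨ g ∈ R)
    {j : ℕ} (hj : j < hF.frame.M) (hB : hF.frame.B j g ≤ 0) :
    g = vtx R j ∨ g = vtx R (j + 1) ∨ ∃ a < hF.frame.K, g = vtx L a := by
  have key : ∀ c ≤ hF.frame.M, hF.frame.B j (vtx R c) ≤ 0 → c = j ∨ c = j + 1 := by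
    intro c hc h
    by_contra! h'
    exact absurd (hF.frame.B_vertex_pos hj hc h'.1 h'.2) (not_lt.2 h)
  rcases hg with hg | hg
  · obtain ⟨c, hc, rfl⟩ := hF.mem_left_iff.1 hg
    rcases hc.lt_or_eq with h | rfl
    · exact Or.inr (Or.inr ⟨c, h, rfl⟩)
    · have : vtx L hF.frame.K = vtx R hF.frame.M := hF.frame.apex
      rw [this] at hB ⊢
      rcases key _ le_rfl hB with h | h <;> rw [h]
      · exact Or.inl rfl
      · exact Or.inr (Or.inl rfl)
  · obtain ⟨c, hc, rfl⟩ := hF.mem_right_iff.1 hg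
    rcases key c hc hB with rfl | rfl
    · exact Or.inl rfl
    · exact Or.inr (Or.inl rfl)

theorem card_spent_add_le (hF : IsFunnel L R) {D : Finset Pt} {t z : Node}
    (hsub : hF.spent D t ⊆ hF.spent D z) {S : Finset Pt} (hS : S ⊆ hF.spent D z)
    (hd : ∀ g ∈ S, g ∉ hF.spent D t) : (hF.spent D t).card + S.card ≤ (hF.spent D z).card := by
  rw [← Finset.card_union_of_disjoint (Finset.disjoint_right.2 hd)]
  exact Finset.card_le_card (Finset.union_subset hsub hS)

/-- Some out-neighbour accounts for as many further guards of `D` as the weight of the edge. -/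
theorem exists_outNeighbour_spent (hF : IsFunnel L R) (hgp : OppositeEdgesAvoidVertices L R)
    {D : Finset Pt} (hD : IsVertexGuardSet L R D) {t : Node} (ht : t.Valid hF.frame)
    (hna : ¬ ReachesApex L R t) :
    ∃ z n, (z, n) ∈ (outNeighbours L R t).val ∧ 0 < n ∧
      (hF.spent D t).card + n ≤ (hF.spent D z).card := by
  have hmono := fun z n hz => hF.spent_mono (D := D) (t := t) (z := z)
    fun w => hF.upper_of_outNeighbour ht hna (n := n) hz
  obtain ⟨i, j, i', j', a, b, hs, h⟩ := hF.outNeighbours_spec ht hna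
  have hi := hs.front.left_lt
  have hj := hs.front.right_lt
  have hK := hF.frame_K
  have hM := hF.frame_M
  have hzl : (Node.left i', 1) ∈ (outNeighbours L R t).val := by rw [h]; simp
  have hzr : (Node.right j', 1) ∈ (outNeighbours L R t).val := by rw [h]; simp
  have hzp : (Node.pair a b, 2) ∈ (outNeighbours L R t).val := by rw [h]; simp
  have single : ∀ z g, (z, 1) ∈ (outNeighbours L R t).val → g ∉ hF.spent D t →
      g ∈ hF.spent D z → ∃ z n, (z, n) ∈ (outNeighbours L R t).val ∧ 0 < n ∧
      (hF.spent D t).card + n ≤ (hF.spent D z).card := fun z g hz hg hg' =>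
    ⟨z, 1, hz, one_pos, by
      simpa using hF.card_spent_add_le (hmono z 1 hz) (S := {g}) (by simpa using hg')
        (by simpa using hg)⟩
  -- The guards `g` and `k` that see these two points are not spent at `t`, and they lie on the
  -- inner sides of edges `i` and `j`, respectively.
  obtain ⟨cq, hcq, hcqU⟩ := hs.front.exists_upper_left
  obtain ⟨cp, hcp, hcpU⟩ := hs.front.exists_upper_right
  obtain ⟨g, hgD, hgs⟩ := hD.2 cq (by rw [hF.region_eq]; exact hcqU.1)
  obtain ⟨k, hkD, hks⟩ := hD.2 cp (by rw [hF.region_eq]; exact hcpU.1)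
  have hg0 : g ∉ hF.spent D t := fun h => (hF.mem_spent.1 h).2 cq hcqU hgs
  have hk0 : k ∉ hF.spent D t := fun h => (hF.mem_spent.1 h).2 cp hcpU hks
  have hgA := A_nonpos_of_sees_openSegment (hF.sees_iff.1 hgs) hi hcq
  have hkB := B_nonpos_of_sees_openSegment (hF.sees_iff.1 hks) hj hcp
  have step_self : k = vtx R j → ∃ z n, (z, n) ∈ (outNeighbours L R t).val ∧
      0 < n ∧ (hF.spent D t).card + n ≤ (hF.spent D z).card := by
    rintro rfl
    exact single _ _ hzr hk0 (hF.right_mem_spent (z := .right j') rfl hs.le_right hkD)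
  have step_succ : k = vtx R (j + 1) → (∃ z n, (z, n) ∈ (outNeighbours L R t).val ∧
      0 < n ∧ (hF.spent D t).card + n ≤ (hF.spent D z).card) ∨
      0 < hF.frame.A i (vtx R (j + 1)) := by
    rintro rfl
    have hj' := hs.right_eq
    split_ifs at hj' with hA
    · exact Or.inl (single _ _ hzr hk0 (hF.right_mem_spent (z := .right j') rfl hj'.ge hkD))
    · exact Or.inr (not_le.1 hA)
  rcases hF.guard_cases_left (hD.1 g hgD) hi hgA with rfl | rfl | ⟨d, hd, rfl⟩
  · exact single _ _ hzl hg0 (hF.left_mem_spent (z := .left i') rfl hs.le_left hgD)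
  · have hi' := hs.left_eq
    split_ifs at hi' with hB
    · exact single _ _ hzl hg0 (hF.left_mem_spent (z := .left i') rfl hi'.ge hgD)
    · push Not at hB
      have hl := hF.frame.onL_vertex (Nat.succ_le_of_lt hi)
      -- Now `g = l (i + 1)` lies beyond the line of edge `j` and is out of reach, so `k` must
      -- provide the progress. The vertices `l (i + 1)` and `r (j + 1)` cannot both be out of reach,
      -- since each would be higher than the other.
      rcases hF.guard_cases_right (hD.1 k hkD) hj hkB with hk | hk | ⟨c, hc, rfl⟩
      · exact step_self hk
      · exact (step_succ hk).elim id fun h' => absurd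
          ((onR_vertex (H := hF.frame) (Nat.succ_le_of_lt hj)).h_left_lt hi h')
          (lt_asymm (hl.h_right_lt hj hB))
      · refine single _ _ hzl hk0 (hF.left_mem_spent (z := .left i') rfl ?_ hkD)
        have hlt : hF.frame.B j (hF.frame.l c) < hF.frame.B j (hF.frame.l (i + 1)) :=
          lt_of_le_of_lt hkB hB
        have := hF.frame.lt_of_h_l_lt hc.le
          (((hF.frame.onL_vertex hc.le).h_lt_iff hl hj).2 hlt)
        omega
  -- The index `b` is maximal for a strict inequality; a vertex on the tangent line itself is
  -- excluded by the position hypothesis.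
  · have hdA : hF.frame.A i (vtx R d) < 0 := by
      refine lt_of_le_of_ne hgA fun h0 => hgp.2 i d (by omega) (by omega) ?_
      obtain ⟨c, -, hcr⟩ := hF.exists_cross_left hi
      rw [hcr, h0, mul_zero]
    have hdb : d ≤ b := (hs.pair_right_iff d hd.le).1 hdA
    rcases hF.guard_cases_right (hD.1 k hkD) hj hkB with hk | hk | ⟨c, hc, rfl⟩
    · exact step_self hk
    · refine (step_succ hk).elim id fun h' => ?_
      refine single _ _ hzr hg0 (hF.right_mem_spent (z := .right j') rfl ?_ hgD)
      have hlt : hF.frame.A i (hF.frame.r d) < hF.frame.A i (hF.frame.r (j + 1)) :=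
        lt_of_le_of_lt hgA h'
      have := hF.frame.mirror.lt_of_h_l_lt (c := d) (d := j + 1) hd.le
        (((onR_vertex (H := hF.frame) hd.le).h_lt_iff
          (onR_vertex (H := hF.frame) (Nat.succ_le_of_lt hj)) hi).2 hlt)
      have := hs.le_right
      omega
    · have hcB : hF.frame.B j (vtx L c) < 0 := by
        refine lt_of_le_of_ne hkB fun h0 => hgp.1 c j (by omega) (by omega) ?_
        obtain ⟨e, -, hcr⟩ := hF.exists_cross_right hj
        rw [hcr, h0, mul_zero]
      have hca : c ≤ a := (hs.pair_left_iff c hc.le).1 hcB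
      -- Each test point is guarded from the opposite chain. These two distinct guards have indices
      -- at most `a` and `b`, so the edge to the pair, of weight two, accounts for both.
      refine ⟨_, 2, hzp, two_pos, ?_⟩
      have hcard : ({vtx L c, vtx R d} : Finset Pt).card = 2 :=
        Finset.card_pair (hF.left_ne_right hc hd)
      rw [← hcard]
      refine hF.card_spent_add_le (hmono _ _ hzp) ?_ ?_
      · intro x hx
        simp only [Finset.mem_insert, Finset.mem_singleton] at hx
        rcases hx with rfl | rfl
        · exact hF.left_mem_spent (z := .pair a b) rfl hca hkD
        · exact hF.right_mem_spent (z := .pair a b) rfl hdb hgD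
      · intro x hx
        simp only [Finset.mem_insert, Finset.mem_singleton] at hx
        rcases hx with rfl | rfl
        · exact hk0
        · exact hg0

end IsFunnel
end FunnelGuarding

namespace FunnelGuarding

/-! ### The loop -/

section Loop

variable {L R : List Pt}

theorem memNode_val (z : Node) (l : List Node) : (memNode z l).val = true ↔ z ∈ l := by
  induction l with
  | nil => simp [memNode]
  | cons a l ih =>
    simp only [memNode, Timed.bind_val, nodeEq, List.mem_cons]
    split_ifs with h
    · simpa using Or.inl (of_decide_eq_true h)
    · rw [ih]
      have : z ≠ a := by simpa using h
      simp [this]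

theorem takeAt_spec (l : List Node) (n : ℕ) (hn : n < l.length) :
    (takeAt l n).val.2.length + 1 = l.length ∧
      ∀ z, z ∈ l ↔ z = (takeAt l n).val.1 ∨ z ∈ (takeAt l n).val.2 := by
  induction l generalizing n with
  | nil => simp at hn
  | cons a l ih =>
    cases n with
    | zero => simp [takeAt]
    | succ n =>
      obtain ⟨h1, h2⟩ := ih n (by simpa using hn)
      simp only [takeAt, Timed.bind_val, Timed.pure_val, List.length_cons, List.mem_cons]
      refine ⟨by omega, fun z => ?_⟩
      rw [h2]; tauto

open IsFunnel (ReachesApex)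

theorem addEdge_val (t z : Node) (w : ℕ) (σ : State) [Decidable (ReachesApex L R z)] :
    (addEdge L R t z w σ).val =
      if ReachesApex L R z then ⟨(z, .sink, 0) :: (t, z, w) :: σ.edges, z :: σ.known, σ.work⟩
      else if z ∈ σ.known then ⟨(t, z, w) :: σ.edges, σ.known, σ.work⟩
      else ⟨(t, z, w) :: σ.edges, z :: σ.known, z :: σ.work⟩ := by
  have h1 : ReachesApex L R z ↔ (hasApex L (upseg L R z).val).val = true := Iff.rfl
  simp only [addEdge, Timed.bind_val]
  by_cases ha : ReachesApex L R z
  · rw [if_pos ha, if_pos (h1.1 ha)]; rfl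
  · rw [if_neg ha, if_neg (fun h => ha (h1.2 h))]
    by_cases hb : z ∈ σ.known
    · rw [if_pos hb, if_pos ((memNode_val _ _).2 hb)]; rfl
    · rw [if_neg hb, if_neg (fun h => hb ((memNode_val _ _).1 h))]; rfl

/-- What the addition of the edges from `t` to `zs` makes of the state `σ`. -/
structure Extends (L R : List Pt) (t : Node) (zs : List (Node × ℕ)) (σ τ : State) : Prop where
  edges_iff : ∀ e, e ∈ τ.edges ↔ e ∈ σ.edges ∨
    ∃ z w, (z, w) ∈ zs ∧ (e = (t, z, w) ∨ ReachesApex L R z ∧ e = (z, .sink, 0))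
  known_iff : ∀ z, z ∈ τ.known ↔ z ∈ σ.known ∨ ∃ w, (z, w) ∈ zs
  work_mono : ∀ z ∈ σ.work, z ∈ τ.work
  of_work : ∀ z ∈ τ.work, z ∈ σ.work ∨ (∃ w, (z, w) ∈ zs) ∧ ¬ ReachesApex L R z
  of_known : ∀ z ∈ τ.known, z ∈ σ.known ∨ ReachesApex L R z ∨ z ∈ τ.work

theorem extends_addEdge (t z : Node) (w : ℕ) (σ : State) :
    Extends L R t [(z, w)] σ (addEdge L R t z w σ).val := by
  classical
  rw [addEdge_val]
  split_ifs with h1 h2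
  · constructor
    · intro e; simp [h1]; tauto
    · intro u; simp; tauto
    · simp
    · intro u hu; exact Or.inl hu
    · intro u hu
      rcases List.mem_cons.1 hu with rfl | hu
      · exact Or.inr (Or.inl h1)
      · exact Or.inl hu
  · constructor
    · intro e; simp [h1]; tauto
    · intro u; simp only [List.mem_singleton, Prod.mk.injEq, exists_and_left, exists_eq,
        and_true]
      constructor
      · exact Or.inl
      · rintro (h | rfl)
        · exact h
        · exact h2
    · simp
    · intro u hu; exact Or.inl hu
    · intro u hu; exact Or.inl hu
  · constructor
    · intro e; simp [h1]; tauto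
    · intro u; simp; tauto
    · intro u hu; exact List.mem_cons_of_mem _ hu
    · intro u hu
      rcases List.mem_cons.1 hu with rfl | hu
      · exact Or.inr ⟨⟨w, by simp⟩, h1⟩
      · exact Or.inl hu
    · intro u hu
      rcases List.mem_cons.1 hu with rfl | hu
      · exact Or.inr (Or.inr (by simp))
      · exact Or.inl hu

theorem extends_addEdges (t : Node) (zs : List (Node × ℕ)) (σ : State) :
    Extends L R t zs σ (addEdges L R t zs σ).val := by
  induction zs generalizing σ with
  | nil =>
    exact ⟨by simp [addEdges], by simp [addEdges], fun z h => h, fun z h => Or.inl h,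
      fun z h => Or.inl h⟩
  | cons x zs ih =>
    obtain ⟨z, w⟩ := x
    have h1 := extends_addEdge (L := L) (R := R) t z w σ
    have h2 := ih (addEdge L R t z w σ).val
    have h3 : (addEdges L R t ((z, w) :: zs) σ).val
      = (addEdges L R t zs (addEdge L R t z w σ).val).val := rfl
    rw [h3]
    set τ := (addEdge L R t z w σ).val
    set ρ := (addEdges L R t zs τ).val
    constructor
    · intro e
      rw [h2.edges_iff, h1.edges_iff]
      simp only [List.mem_cons, List.not_mem_nil, or_false]
      constructor
      · rintro ((h | ⟨u, c, h, h'⟩) | ⟨u, c, h, h'⟩)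
        · exact Or.inl h
        · exact Or.inr ⟨u, c, Or.inl h, h'⟩
        · exact Or.inr ⟨u, c, Or.inr h, h'⟩
      · rintro (h | ⟨u, c, h | h, h'⟩)
        · exact Or.inl (Or.inl h)
        · exact Or.inl (Or.inr ⟨u, c, h, h'⟩)
        · exact Or.inr ⟨u, c, h, h'⟩
    · intro u
      rw [h2.known_iff, h1.known_iff]
      simp only [List.mem_cons, List.not_mem_nil, or_false, exists_or, or_assoc]
    · exact fun u hu => h2.work_mono u (h1.work_mono u hu)
    · intro u hu
      rcases h2.of_work u hu with h | ⟨⟨c, h⟩, h'⟩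
      · rcases h1.of_work u h with h | ⟨⟨c, h⟩, h'⟩
        · exact Or.inl h
        · exact Or.inr ⟨⟨c, by simp only [List.mem_singleton] at h; simp [h]⟩, h'⟩
      · exact Or.inr ⟨⟨c, List.mem_cons_of_mem _ h⟩, h'⟩
    · intro u hu
      rcases h2.of_known u hu with h | h
      · rcases h1.of_known u h with h | h | h
        · exact Or.inl h
        · exact Or.inr (Or.inl h)
        · exact Or.inr (Or.inr (h2.work_mono u h))
      · exact Or.inr h

/-- All edges out of `t`, and those from their heads to the sink, have been added. -/
def Processed (L R : List Pt) (σ : State) (t : Node) : Prop :=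
  ∀ z w, (z, w) ∈ (outNeighbours L R t).val → (t, z, w) ∈ σ.edges ∧ z ∈ σ.known ∧
    (ReachesApex L R z → (z, .sink, 0) ∈ σ.edges)

/-- The invariant of the loop. -/
structure LoopInv (hF : IsFunnel L R) (σ : State) : Prop where
  edge : ∀ t z w, (t, z, w) ∈ σ.edges →
    (t.Valid hF.frame ∧ ¬ ReachesApex L R t ∧ (z, w) ∈ (outNeighbours L R t).val) ∨
    (z = .sink ∧ w = 0 ∧ t.Valid hF.frame ∧ ReachesApex L R t)
  work : ∀ t ∈ σ.work, ¬ ReachesApex L R t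
  work_known : ∀ t ∈ σ.work, t ∈ σ.known
  known : ∀ t ∈ σ.known, t.Valid hF.frame
  source : .source ∈ σ.known
  processed : ∀ t ∈ σ.known, ReachesApex L R t ∨ t ∈ σ.work ∨ Processed L R σ t

theorem loopInv_init (hF : IsFunnel L R) : LoopInv hF initState where
  edge := by simp [initState]
  work := by simpa [initState] using hF.not_reachesApex_source
  work_known := by simp [initState]
  known := by simp [initState, Node.Valid]
  source := by simp [initState]
  processed := by simp [initState]

theorem loopInv_step {hF : IsFunnel L R} {σ : State} (hσ : LoopInv hF σ) {n : ℕ}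
    (hn : n < σ.work.length) : LoopInv hF (loopBody L R n σ).val := by
  obtain ⟨-, hmem⟩ := takeAt_spec σ.work n hn
  have hval : (loopBody L R n σ).val = (addEdges L R (takeAt σ.work n).val.1
    (outNeighbours L R (takeAt σ.work n).val.1).val
    ⟨σ.edges, σ.known, (takeAt σ.work n).val.2⟩).val := rfl
  have hx := extends_addEdges (L := L) (R := R) (takeAt σ.work n).val.1
    (outNeighbours L R (takeAt σ.work n).val.1).val ⟨σ.edges, σ.known, (takeAt σ.work n).val.2⟩
  rw [hval]
  set t := (takeAt σ.work n).val.1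
  set W := (takeAt σ.work n).val.2
  set τ := (addEdges L R t (outNeighbours L R t).val ⟨σ.edges, σ.known, W⟩).val
  have htw : t ∈ σ.work := (hmem t).2 (Or.inl rfl)
  have hta := hσ.work t htw
  have htv := hσ.known t (hσ.work_known t htw)
  have hval := fun z w (h : (z, w) ∈ (outNeighbours L R t).val) =>
    (hF.valid_of_mem_outNeighbours htv hta h).1
  constructor
  · intro u z w he
    rcases (hx.edges_iff _).1 he with h | ⟨z', w', h, h' | ⟨h', h''⟩⟩
    · exact hσ.edge u z w h
    · simp only [Prod.mk.injEq] at h'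
      obtain ⟨rfl, rfl, rfl⟩ := h'
      exact Or.inl ⟨htv, hta, h⟩
    · simp only [Prod.mk.injEq] at h''
      obtain ⟨rfl, rfl, rfl⟩ := h''
      exact Or.inr ⟨rfl, rfl, hval _ _ h, h'⟩
  · intro u hu
    rcases hx.of_work u hu with h | h
    · exact hσ.work u ((hmem u).2 (Or.inr h))
    · exact h.2
  · intro u hu
    rw [hx.known_iff]
    rcases hx.of_work u hu with h | h
    · exact Or.inl (hσ.work_known u ((hmem u).2 (Or.inr h)))
    · exact Or.inr h.1
  · intro u hu
    rcases (hx.known_iff u).1 hu with h | ⟨w, h⟩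
    · exact hσ.known u h
    · exact hval _ _ h
  · exact (hx.known_iff _).2 (Or.inl hσ.source)
  · intro u hu
    rcases hx.of_known u hu with h | h | h
    · rcases hσ.processed u h with h | h | h
      · exact Or.inl h
      · rcases (hmem u).1 h with rfl | h
        · refine Or.inr (Or.inr fun z w hz => ⟨?_, ?_, fun ha => ?_⟩)
          · exact (hx.edges_iff _).2 (Or.inr ⟨z, w, hz, Or.inl rfl⟩)
          · exact (hx.known_iff _).2 (Or.inr ⟨w, hz⟩)
          · exact (hx.edges_iff _).2 (Or.inr ⟨z, w, hz, Or.inr ⟨ha, rfl⟩⟩)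
        · exact Or.inr (Or.inl (hx.work_mono u h))
      · refine Or.inr (Or.inr fun z w hz => ?_)
        obtain ⟨h1, h2, h3⟩ := h z w hz
        exact ⟨(hx.edges_iff _).2 (Or.inl h1), (hx.known_iff _).2 (Or.inl h2),
          fun ha => (hx.edges_iff _).2 (Or.inl (h3 ha))⟩
    · exact Or.inl h
    · exact Or.inr (Or.inl h)

/-! ### Termination of the loop. -/

/-- The set of all valid nodes. -/
def validNodes (H : Frame) : Finset Node :=
  {.source} ∪ (Finset.range (H.K + 1)).image .left ∪ (Finset.range (H.M + 1)).image .right ∪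
    (Finset.range H.K ×ˢ Finset.range H.M).image fun x => .pair x.1 x.2

theorem mem_validNodes {H : Frame} {z : Node} (hz : z.Valid H) : z ∈ validNodes H := by
  cases z with
  | source => simp [validNodes]
  | sink => exact hz.elim
  | left i => simpa [validNodes] using Nat.lt_succ_of_le hz
  | right j => simpa [validNodes] using Nat.lt_succ_of_le hz
  | pair i j => simpa [validNodes] using (show i < H.K ∧ j < H.M from hz)

theorem card_validNodes (H : Frame) : (validNodes H).card ≤ (H.K + H.M + 3) ^ 2 := by
  have h1 : (validNodes H).card ≤ 1 + (H.K + 1) + (H.M + 1) + H.K * H.M := by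
    unfold validNodes
    refine (Finset.card_union_le _ _).trans (add_le_add ((Finset.card_union_le _ _).trans
      (add_le_add ((Finset.card_union_le _ _).trans (add_le_add ?_ ?_)) ?_)) ?_)
    · simp
    · exact Finset.card_image_le.trans (by simp)
    · exact Finset.card_image_le.trans (by simp)
    · exact Finset.card_image_le.trans (by simp)
  nlinarith

/-- The number of iterations that are still possible. -/
def remaining (H : Frame) (σ : State) : ℕ :=
  σ.work.length + (validNodes H \ σ.known.toFinset).card

/-- A node that enters the work list leaves the set of unknown valid nodes, so the sum does not
grow; removing the processed node then makes it drop. -/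
theorem remaining_addEdge {H : Frame} {t z : Node} {w : ℕ} {σ : State} (hz : z.Valid H) :
    remaining H (addEdge L R t z w σ).val ≤ remaining H σ := by
  classical
  rw [addEdge_val]
  have hsub : validNodes H \ (z :: σ.known).toFinset ⊆ validNodes H \ σ.known.toFinset := by
    refine Finset.sdiff_subset_sdiff le_rfl fun u hu => ?_
    simp only [List.mem_toFinset, List.mem_cons] at hu ⊢
    exact Or.inr hu
  split_ifs with h1 h2
  · exact Nat.add_le_add_left (Finset.card_le_card hsub) _
  · exact le_rfl
  · have hss : validNodes H \ (z :: σ.known).toFinset ⊂ validNodes H \ σ.known.toFinset := by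
      refine Finset.ssubset_iff_subset_ne.2 ⟨hsub, fun h => ?_⟩
      have : z ∈ validNodes H \ σ.known.toFinset := by simp [mem_validNodes hz, h2]
      rw [← h] at this
      simp at this
    have := Finset.card_lt_card hss
    simp only [remaining, List.length_cons]
    omega

theorem remaining_addEdges {H : Frame} {t : Node} {zs : List (Node × ℕ)} {σ : State}
    (hz : ∀ z w, (z, w) ∈ zs → z.Valid H) :
    remaining H (addEdges L R t zs σ).val ≤ remaining H σ := by
  induction zs generalizing σ with
  | nil => exact le_rfl
  | cons x zs ih =>
    exact (ih fun z w h => hz z w (List.mem_cons_of_mem _ h)).trans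
      (remaining_addEdge (hz x.1 x.2 (by simp)))

theorem remaining_loopBody {hF : IsFunnel L R} {σ : State} (hσ : LoopInv hF σ) {n : ℕ}
    (hn : n < σ.work.length) :
    remaining hF.frame (loopBody L R n σ).val + 1 ≤ remaining hF.frame σ := by
  obtain ⟨hlen, hmem⟩ := takeAt_spec σ.work n hn
  have htw := (hmem _).2 (Or.inl rfl)
  have h := remaining_addEdges (L := L) (R := R) (H := hF.frame) (t := (takeAt σ.work n).val.1)
    (zs := (outNeighbours L R (takeAt σ.work n).val.1).val)
    (σ := ⟨σ.edges, σ.known, (takeAt σ.work n).val.2⟩)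
    fun z w h => (hF.valid_of_mem_outNeighbours (hσ.known _ (hσ.work_known _ htw))
      (hσ.work _ htw) h).1
  have hval : (loopBody L R n σ).val = (addEdges L R (takeAt σ.work n).val.1
    (outNeighbours L R (takeAt σ.work n).val.1).val
    ⟨σ.edges, σ.known, (takeAt σ.work n).val.2⟩).val := rfl
  rw [hval]
  simp only [remaining] at h ⊢
  omega

theorem length_addEdge (t z : Node) (w : ℕ) (σ : State) :
    (addEdge L R t z w σ).val.edges.length ≤ σ.edges.length + 2 ∧
      (addEdge L R t z w σ).val.known.length ≤ σ.known.length + 1 := by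
  classical
  rw [addEdge_val]
  split_ifs <;> simp

theorem length_addEdges (t : Node) (zs : List (Node × ℕ)) (σ : State) :
    (addEdges L R t zs σ).val.edges.length ≤ σ.edges.length + 2 * zs.length ∧
      (addEdges L R t zs σ).val.known.length ≤ σ.known.length + zs.length := by
  induction zs generalizing σ with
  | nil => exact ⟨le_rfl, le_rfl⟩
  | cons x zs ih =>
    have h1 := ih (addEdge L R t x.1 x.2 σ).val
    have h2 := length_addEdge (L := L) (R := R) t x.1 x.2 σ
    have h3 : (addEdges L R t (x :: zs) σ).val
      = (addEdges L R t zs (addEdge L R t x.1 x.2 σ).val).val := rfl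
    rw [h3, List.length_cons]
    omega

theorem length_loopBody (n : ℕ) (σ : State) :
    (loopBody L R n σ).val.edges.length ≤ σ.edges.length + 6 ∧
      (loopBody L R n σ).val.known.length ≤ σ.known.length + 3 :=
  length_addEdges (L := L) (R := R) (takeAt σ.work n).val.1
    (outNeighbours L R (takeAt σ.work n).val.1).val ⟨σ.edges, σ.known, (takeAt σ.work n).val.2⟩

end Loop

/-! ### Shortest paths -/

section Paths

theorem lookup_mem {z : Node} {labels : List Label} {x : ℕ × List Node}
    (h : (lookup z labels).val = some x) : (z, x) ∈ labels := by
  induction labels with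
  | nil => simp [lookup] at h
  | cons a l ih =>
    simp only [lookup, Timed.bind_val, nodeEq] at h
    split_ifs at h with hz
    · have h1 : z = a.1 := of_decide_eq_true hz
      have h2 : a.2 = x := by simpa using h
      rw [h1, ← h2]
      simp
    · exact List.mem_cons_of_mem _ (ih h)

/-- `path`, read backwards, is a walk of weight `d` from the source to `z`. -/
inductive WalkTo (es : List Edge) : Node → ℕ → List Node → Prop
  | source : WalkTo es .source 0 []
  | step {t z : Node} {d w : ℕ} {path : List Node} : WalkTo es t d path → (t, z, w) ∈ es →
      WalkTo es z (d + w) (z :: path)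

/-- Every label belongs to a walk, which is shorter than the list of labels. -/
def LabelsSound (es : List Edge) (labels : List Label) : Prop :=
  ∀ z d path, (z, d, path) ∈ labels → WalkTo es z d path ∧ path.length < labels.length

/-- There is a label for `z` of weight at most `w`. -/
def LabelLe (labels : List Label) (z : Node) (w : ℕ) : Prop :=
  ∃ d path, (lookup z labels).val = some (d, path) ∧ d ≤ w

theorem lookup_cons (z u : Node) (x : ℕ × List Node) (l : List Label) :
    (lookup z ((u, x) :: l)).val = if z = u then some x else (lookup z l).val := by
  simp only [lookup, Timed.bind_val, nodeEq, decide_eq_true_eq]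
  split_ifs <;> rfl

/-- Either nothing changes because the head already has a label at least as good as the edge would
provide, or the new label supersedes the old one without being heavier. `LabelLe` refers to the
newest label only, so both facts are needed. -/
theorem relax_cases (e : Edge) (labels : List Label) :
    ((relax e labels).val = labels ∧ ∀ w, LabelLe labels e.1 w → LabelLe labels e.2.1 (w + e.2.2)) ∨
    ∃ d path, (lookup e.1 labels).val = some (d, path) ∧
      (relax e labels).val = (e.2.1, d + e.2.2, e.2.1 :: path) :: labels ∧
      ∀ w, LabelLe labels e.2.1 w → d + e.2.2 ≤ w := by
  simp only [relax, Timed.bind_val]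
  rcases h1 : (lookup e.1 labels).val with - | ⟨d, path⟩
  · left
    refine ⟨rfl, ?_⟩
    rintro w ⟨d, p, h, -⟩
    rw [h1] at h
    exact absurd h (by simp)
  · simp only [Timed.bind_val, nAdd]
    rcases h2 : (lookup e.2.1 labels).val with - | ⟨d', path'⟩
    · right
      refine ⟨d, path, rfl, rfl, ?_⟩
      rintro w ⟨d, p, h, -⟩
      rw [h2] at h
      exact absurd h (by simp)
    · simp only [Timed.bind_val, nLt, decide_eq_true_eq]
      split_ifs with h3
      · right
        refine ⟨d, path, rfl, rfl, ?_⟩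
        rintro w ⟨d'', p, h, hw⟩
        rw [h2] at h
        simp only [Option.some.injEq, Prod.mk.injEq] at h
        omega
      · left
        refine ⟨rfl, ?_⟩
        rintro w ⟨d'', p, h, hw⟩
        rw [h1] at h
        simp only [Option.some.injEq, Prod.mk.injEq] at h
        exact ⟨d', path', h2, by omega⟩

theorem relax_length (e : Edge) (labels : List Label) :
    labels.length ≤ (relax e labels).val.length ∧
      (relax e labels).val.length ≤ labels.length + 1 := by
  rcases relax_cases e labels with ⟨h, -⟩ | ⟨d, path, -, h, -⟩ <;> rw [h] <;> simp

theorem relax_sound {es : List Edge} {e : Edge} (he : e ∈ es) {labels : List Label}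
    (h : LabelsSound es labels) : LabelsSound es (relax e labels).val := by
  rcases relax_cases e labels with ⟨h', -⟩ | ⟨d, path, h1, h', -⟩ <;> rw [h']
  · exact h
  · intro z d' path' hz
    rcases List.mem_cons.1 hz with hz | hz
    · simp only [Prod.mk.injEq] at hz
      obtain ⟨rfl, rfl, rfl⟩ := hz
      obtain ⟨h2, h3⟩ := h _ _ _ (lookup_mem h1)
      exact ⟨h2.step he, by simpa using h3⟩
    · obtain ⟨h2, h3⟩ := h _ _ _ hz
      exact ⟨h2, by simp only [List.length_cons]; omega⟩

theorem relax_mono {e : Edge} {labels : List Label} {z : Node} {w : ℕ}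
    (h : LabelLe labels z w) : LabelLe (relax e labels).val z w := by
  rcases relax_cases e labels with ⟨h', -⟩ | ⟨d, path, h1, h', h2⟩ <;> rw [h']
  · exact h
  · unfold LabelLe
    rw [lookup_cons]
    split_ifs with hz
    · exact ⟨_, _, rfl, h2 w (hz ▸ h)⟩
    · exact h

theorem relax_edge {e : Edge} {labels : List Label} {w : ℕ} (h : LabelLe labels e.1 w) :
    LabelLe (relax e labels).val e.2.1 (w + e.2.2) := by
  rcases relax_cases e labels with ⟨h', h2⟩ | ⟨d, path, h1, h', h2⟩ <;> rw [h']
  · exact h2 w h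
  · unfold LabelLe
    rw [lookup_cons, if_pos rfl]
    obtain ⟨d', path', h3, h4⟩ := h
    rw [h1] at h3
    simp only [Option.some.injEq, Prod.mk.injEq] at h3
    exact ⟨_, _, rfl, by omega⟩

theorem relaxAll_cons (e : Edge) (es : List Edge) (labels : List Label) :
    (relaxAll (e :: es) labels).val = (relaxAll es (relax e labels).val).val := rfl

theorem relaxRounds_cons (es : List Edge) (e : Edge) (rounds : List Edge) (labels : List Label) :
    (relaxRounds es (e :: rounds) labels).val
      = (relaxRounds es rounds (relaxAll es labels).val).val := rfl

theorem relaxAll_mono {es : List Edge} {labels : List Label} {z : Node} {w : ℕ}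
    (h : LabelLe labels z w) : LabelLe (relaxAll es labels).val z w := by
  induction es generalizing labels with
  | nil => exact h
  | cons e es ih => rw [relaxAll_cons]; exact ih (relax_mono h)

theorem relaxAll_edge {es : List Edge} {labels : List Label} {t z : Node} {w c : ℕ}
    (he : (t, z, c) ∈ es) (h : LabelLe labels t w) :
    LabelLe (relaxAll es labels).val z (w + c) := by
  induction es generalizing labels with
  | nil => simp at he
  | cons e es ih =>
    rw [relaxAll_cons]
    rcases List.mem_cons.1 he with rfl | he
    · exact relaxAll_mono (relax_edge (e := (t, z, c)) h)
    · exact ih he (relax_mono h)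

theorem relaxRounds_mono {es rounds : List Edge} {labels : List Label} {z : Node} {w : ℕ}
    (h : LabelLe labels z w) : LabelLe (relaxRounds es rounds labels).val z w := by
  induction rounds generalizing labels with
  | nil => exact h
  | cons e rounds ih => rw [relaxRounds_cons]; exact ih (relaxAll_mono h)

/-- `p` is a walk from `t` to `z`. -/
def IsWalk : Node → List Edge → Node → Prop
  | t, [], z => t = z
  | t, e :: p, z => e.1 = t ∧ IsWalk e.2.1 p z

/-- The weight of a walk. -/
def weight (p : List Edge) : ℕ := (p.map fun e => e.2.2).sum

/-- One round carries the bound over at least the next edge of the walk, whatever the order of the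
edges in the list. -/
theorem relaxRounds_walk {es rounds : List Edge} {labels : List Label} {t z : Node} {w : ℕ}
    {p : List Edge} (hp : IsWalk t p z) (hes : ∀ e ∈ p, e ∈ es) (hlen : p.length ≤ rounds.length)
    (h : LabelLe labels t w) : LabelLe (relaxRounds es rounds labels).val z (w + weight p) := by
  induction p generalizing t labels rounds w with
  | nil => rw [← (show t = z from hp)]; exact relaxRounds_mono h
  | cons e p ih =>
    obtain ⟨rfl, hp⟩ := hp
    cases rounds with
    | nil => simp at hlen
    | cons x rounds =>
      rw [relaxRounds_cons]
      have := ih (rounds := rounds) hp (fun e he => hes e (List.mem_cons_of_mem _ he))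
        (by simpa using hlen)
        (relaxAll_edge (t := e.1) (z := e.2.1) (c := e.2.2) (hes e (by simp)) h)
      simpa [weight, add_assoc] using this

theorem relaxAll_sound {es es' : List Edge} (hsub : ∀ e ∈ es', e ∈ es) {labels : List Label}
    (h : LabelsSound es labels) : LabelsSound es (relaxAll es' labels).val := by
  induction es' generalizing labels with
  | nil => exact h
  | cons e es' ih =>
    rw [relaxAll_cons]
    exact ih (fun e he => hsub e (List.mem_cons_of_mem _ he)) (relax_sound (hsub e (by simp)) h)

theorem relaxRounds_sound {es rounds : List Edge} {labels : List Label}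
    (h : LabelsSound es labels) : LabelsSound es (relaxRounds es rounds labels).val := by
  induction rounds generalizing labels with
  | nil => exact h
  | cons e rounds ih => rw [relaxRounds_cons]; exact ih (relaxAll_sound (fun e he => he) h)

theorem labelsSound_init (es : List Edge) : LabelsSound es [(.source, 0, [])] := by
  intro z d path h
  simp only [List.mem_singleton, Prod.mk.injEq] at h
  obtain ⟨rfl, rfl, rfl⟩ := h
  exact ⟨.source, by simp⟩

theorem guardsOf_val (L R : List Pt) (p : List Node) :
    (guardsOf L R p).val = p.flatMap (Node.guards L R) := by
  induction p with
  | nil => rfl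
  | cons z p ih => cases z <;> simp [guardsOf, Node.guards, ih]

/-- If there is a simple walk from the source to the sink, the guards of a walk which is at most as
heavy are found. -/
theorem shortestPathGuards_spec (L R : List Pt) {es p : List Edge} (hp : IsWalk .source p .sink)
    (hes : ∀ e ∈ p, e ∈ es) (hnd : p.Nodup) :
    ∃ d path, WalkTo es .sink d path ∧ d ≤ weight p ∧
      (shortestPathGuards L R es).val = path.flatMap (Node.guards L R) := by
  -- A walk without repeated edges is no longer than the edge list, which also serves as the counter
  -- of rounds.
  have hlen : p.length ≤ es.length := (hnd.subperm hes).length_le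
  obtain ⟨d, path, h1, h2⟩ := relaxRounds_walk (labels := [(.source, 0, [])]) (w := 0) hp hes hlen
    ⟨0, [], by rw [lookup_cons, if_pos rfl], le_rfl⟩
  refine ⟨d, path, (relaxRounds_sound (labelsSound_init es) _ _ _ (lookup_mem h1)).1,
    by simpa using h2, ?_⟩
  simp only [shortestPathGuards, Timed.bind_val, h1, guardsOf_val]

end Paths

/-! ### Correctness -/

section Correctness

variable {L R : List Pt}

open IsFunnel (ReachesApex)

/-- Follow the decreasing potential `f`, which pays for the weights. Its strict decrease both ends
the walk and prevents repeated edges. One potential shows that the sink is reached at all, another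
bounds the cost by the size of a given guard set. -/
theorem exists_walk {hF : IsFunnel L R} {σ : State} (hσ : LoopInv hF σ) (hw : σ.work = [])
    (f : Node → ℕ) (hstep : ∀ t, t.Valid hF.frame → ¬ ReachesApex L R t →
      ∃ z w, (z, w) ∈ (outNeighbours L R t).val ∧ f z + w ≤ f t ∧ f z < f t) :
    ∀ t ∈ σ.known, ¬ ReachesApex L R t → ∃ p, IsWalk t p .sink ∧ (∀ e ∈ p, e ∈ σ.edges) ∧
      weight p ≤ f t ∧ p.Nodup ∧ ∀ e ∈ p, f e.1 ≤ f t := by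
  intro t
  induction hn : f t using Nat.strong_induction_on generalizing t with
  | _ n ih =>
    subst hn
    intro htk hta
    obtain ⟨z, w, hz, hfw, hf⟩ := hstep t (hσ.known t htk) hta
    have hproc : Processed L R σ t := by
      rcases hσ.processed t htk with h | h | h
      · exact absurd h hta
      · rw [hw] at h; simp at h
      · exact h
    obtain ⟨h1, h2, h3⟩ := hproc z w hz
    by_cases hza : ReachesApex L R z
    · refine ⟨[(t, z, w), (z, .sink, 0)], ⟨rfl, rfl, rfl⟩, ?_, ?_, ?_, ?_⟩
      · simp only [List.mem_cons, List.not_mem_nil, or_false, forall_eq_or_imp, forall_eq]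
        exact ⟨h1, h3 hza⟩
      · simp only [weight, List.map_cons, List.map_nil, List.sum_cons, List.sum_nil]
        omega
      · have : t ≠ z := by rintro rfl; exact lt_irrefl _ hf
        simp [this]
      · simpa using hf.le
    · obtain ⟨p, hp1, hp2, hp3, hp4, hp5⟩ := ih (f z) hf z rfl h2 hza
      refine ⟨(t, z, w) :: p, ⟨rfl, hp1⟩, ?_, ?_, ?_, ?_⟩
      · simp only [List.mem_cons, forall_eq_or_imp]
        exact ⟨h1, hp2⟩
      · simp only [weight, List.map_cons, List.sum_cons] at hp3 ⊢
        omega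
      · refine List.nodup_cons.2 ⟨fun hmem => ?_, hp4⟩
        exact absurd (hp5 _ hmem) (not_le.2 hf)
      · simp only [List.mem_cons, forall_eq_or_imp]
        exact ⟨le_rfl, fun e he => (hp5 e he).trans hf.le⟩

/-- Steps to the left chain alone lead to the apex. -/
theorem exists_left_step (hF : IsFunnel L R) (t : Node) (ht : t.Valid hF.frame)
    (hta : ¬ ReachesApex L R t) :
    ∃ z w, (z, w) ∈ (outNeighbours L R t).val ∧
      (hF.frame.K + 1 - (z.leftPart.elim 0 Nat.succ)) + w
        ≤ hF.frame.K + 1 - (t.leftPart.elim 0 Nat.succ) ∧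
      hF.frame.K + 1 - (z.leftPart.elim 0 Nat.succ)
        < hF.frame.K + 1 - (t.leftPart.elim 0 Nat.succ) := by
  obtain ⟨i, j, i', j', a, b, hs, h⟩ := hF.outNeighbours_spec ht hta
  refine ⟨.left i', 1, by rw [h]; simp, ?_⟩
  have h1 := hs.left_le
  have h2 := hs.le_left
  have h3 : (Node.left i').leftPart.elim 0 Nat.succ = i' + 1 := rfl
  -- The potential counts a missing left part as 0 and a left vertex `c` as `c + 1`; the earlier
  -- left vertex is before `i ≤ i'`, so a step of weight one is paid for.
  have h4 : t.leftPart.elim 0 Nat.succ ≤ i := by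
    rcases hp : t.leftPart with - | c
    · exact Nat.zero_le _
    · exact hs.front.cL_lt c hp
  rw [h3]
  omega

/-- Along the walk, a point not above `z` either was not above the previous node, and is covered by
induction, or lies between the two fronts, and is seen by the guards of `z`. An edge to the sink
leaves a node with nothing above it. -/
theorem walkTo_spec {hF : IsFunnel L R} {σ : State} (hσ : LoopInv hF σ) {z : Node} {d : ℕ}
    {path : List Node} (h : WalkTo σ.edges z d path) :
    d = (path.flatMap (Node.guards L R)).length ∧
    (∀ g ∈ path.flatMap (Node.guards L R), g ∈ L ∨ g ∈ R) ∧
    (z.Valid hF.frame ∧ (∀ w, hF.frame.InF w → ¬ hF.frame.Upper z.leftPart z.rightPart w →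
        ∃ g ∈ path.flatMap (Node.guards L R), Sees (region L R) g w) ∨
      z = .sink ∧ ∀ w, hF.frame.InF w →
        ∃ g ∈ path.flatMap (Node.guards L R), Sees (region L R) g w) := by
  induction h with
  | source =>
    refine ⟨rfl, by simp, Or.inl ⟨trivial, fun w hw hn => absurd ?_ hn⟩⟩
    exact ⟨hw, by simp [Node.leftPart], by simp [Node.rightPart]⟩
  | @step t z d w path _ he ih =>
    obtain ⟨ih1, ih2, ih3⟩ := ih
    simp only [List.flatMap_cons, List.length_append, List.mem_append]
    rcases hσ.edge t z w he with ⟨htv, hta, hz⟩ | ⟨rfl, rfl, htv, hta⟩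
    · obtain ⟨hzv, hw⟩ := hF.valid_of_mem_outNeighbours htv hta hz
      refine ⟨by omega, ?_, Or.inl ⟨hzv, fun v hv hn => ?_⟩⟩
      · rintro g (hg | hg)
        · exact hF.guards_mem hzv hg
        · exact ih2 g hg
      · by_cases hu : hF.frame.Upper t.leftPart t.rightPart v
        · obtain ⟨g, hg, hs⟩ := hF.guards_see htv hta hz hu hn
          exact ⟨g, Or.inl hg, hs⟩
        · rcases ih3 with ⟨-, h⟩ | ⟨rfl, -⟩
          · obtain ⟨g, hg, hs⟩ := h v hv hu
            exact ⟨g, Or.inr hg, hs⟩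
          · exact htv.elim
    · refine ⟨by simp [Node.guards, ih1], ?_, Or.inr ⟨rfl, fun v hv => ?_⟩⟩
      · rintro g (hg | hg)
        · simp [Node.guards] at hg
        · exact ih2 g hg
      · rcases ih3 with ⟨-, h⟩ | ⟨rfl, -⟩
        · obtain ⟨g, hg, hs⟩ := h v hv (hF.upper_empty_of_reachesApex htv hta v)
          exact ⟨g, Or.inr hg, hs⟩
        · exact htv.elim

theorem output_isVertexGuardSet {hF : IsFunnel L R} {σ : State} (hσ : LoopInv hF σ)
    (hw : σ.work = []) :
    IsVertexGuardSet L R (shortestPathGuards L R σ.edges).val.toFinset := by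
  obtain ⟨p, h1, h2, -, h3, -⟩ := exists_walk hσ hw
    (fun t => hF.frame.K + 1 - (t.leftPart.elim 0 Nat.succ)) (exists_left_step hF) _ hσ.source
    hF.not_reachesApex_source
  obtain ⟨d, path, h4, -, h5⟩ := shortestPathGuards_spec L R h1 h2 h3
  obtain ⟨-, h6, h7⟩ := walkTo_spec hσ h4
  rw [h5]
  refine ⟨fun v hv => h6 v (List.mem_toFinset.1 hv), fun v hv => ?_⟩
  rw [hF.region_eq] at hv
  rcases h7 with ⟨h, -⟩ | ⟨-, h⟩
  · exact h.elim
  · obtain ⟨g, hg, hs⟩ := h v hv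
    exact ⟨g, List.mem_toFinset.2 hg, hs⟩

/-- The potential is the number of guards of `D` not yet spent. It pays for every edge; removing
repetitions from the output can only help. -/
theorem output_card_le {hF : IsFunnel L R} {σ : State} (hσ : LoopInv hF σ) (hw : σ.work = [])
    (hgp : OppositeEdgesAvoidVertices L R) {D : Finset Pt} (hD : IsVertexGuardSet L R D) :
    (shortestPathGuards L R σ.edges).val.toFinset.card ≤ D.card := by
  have hle : ∀ t, (hF.spent D t).card ≤ D.card := fun t =>
    Finset.card_le_card fun g hg => (hF.mem_spent.1 hg).1
  obtain ⟨p, h1, h2, h0, h3, -⟩ := exists_walk hσ hw (fun t => D.card - (hF.spent D t).card)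
    (fun t ht hta => by
      obtain ⟨z, n, hz, hn, h⟩ := hF.exists_outNeighbour_spent hgp hD ht hta
      have := hle z
      exact ⟨z, n, hz, by omega, by omega⟩) _ hσ.source hF.not_reachesApex_source
  obtain ⟨d, path, h4, h5, h6⟩ := shortestPathGuards_spec L R h1 h2 h3
  obtain ⟨h7, -, -⟩ := walkTo_spec hσ h4
  rw [h6]
  have h8 := List.toFinset_card_le (path.flatMap (Node.guards L R))
  omega

end Correctness
end FunnelGuarding

namespace FunnelGuarding

/-! ### Running time -/

section Time

variable (L R : List Pt)

theorem len_time (C : List Pt) : (len C).time = 2 * C.length := by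
  induction C with
  | nil => rfl
  | cons c C ih => simp only [len, Timed.bind_time, tick_time, ih, nAdd, List.length_cons]; omega

theorem nth_time_le (C : List Pt) (i : ℕ) : (nth C i).time ≤ C.length := by
  induction C generalizing i with
  | nil => exact le_rfl
  | cons c C ih =>
    cases i with
    | zero => simp [nth]
    | succ i =>
      have := ih i
      simp only [nth, Timed.bind_time, tick_time, List.length_cons]; omega

theorem crossT_time (a b c : Pt) : (crossT a b c).time = 7 := rfl

theorem heightT_time_le (p : Pt) : (heightT L R p).time ≤ 7 * (L.length + R.length + 1) := by
  have h1 := nth_time_le L 0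
  have h2 := nth_time_le R 0
  simp only [heightT, Timed.bind_time, crossT_time]
  omega

theorem apexT_time_le : (apexT L).time ≤ 3 * (L.length + R.length + 1) := by
  have h1 := nth_time_le L (L.length - 1)
  simp only [apexT, Timed.bind_time, len_time, len_val, nSub]
  omega

theorem meet_time (u v c d : Pt) : (meet u v c d).time = 22 := rfl

theorem hit_time_le (u v : Pt) (C : List Pt) : (hit u v C).time ≤ 17 * C.length + 22 := by
  induction C with
  | nil => simp [hit]
  | cons c C ih =>
    cases C with
    | nil => simp [hit]
    | cons d C =>
      simp only [hit, Timed.bind_time, tick_time, crossT_time, rMul, rLe, List.length_cons] at ih ⊢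
      split_ifs
      · rw [meet_time]; omega
      · omega

theorem lastNotAbove_time_le (h : ℝ) (C : List Pt) (i best : ℕ) :
    (lastNotAbove L R h C i best).time ≤ C.length * (10 * (L.length + R.length + 1)) := by
  induction C generalizing i best with
  | nil => simp [lastNotAbove]
  | cons c C ih =>
    have h1 := heightT_time_le L R c
    simp only [lastNotAbove, Timed.bind_time, tick_time, rLe, nAdd, List.length_cons, add_mul,
      one_mul]
    split_ifs
    · have := ih (i + 1) i
      omega
    · have := ih (i + 1) best
      omega

theorem lastBelow_time_le (h : ℝ) (C : List Pt) (i best : ℕ) :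
    (lastBelow L R h C i best).time ≤ C.length * (10 * (L.length + R.length + 1)) := by
  induction C generalizing i best with
  | nil => simp [lastBelow]
  | cons c C ih =>
    have h1 := heightT_time_le L R c
    simp only [lastBelow, Timed.bind_time, tick_time, rLt, nAdd, List.length_cons, add_mul,
      one_mul]
    split_ifs
    · have := ih (i + 1) i
      omega
    · have := ih (i + 1) best
      omega

theorem clear_time_le (a b : Pt) (h₀ h₁ : ℝ) (C : List Pt) :
    (clear L R a b h₀ h₁ C).time ≤ C.length * (20 * (L.length + R.length + 1)) := by
  induction C with
  | nil => simp [clear]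
  | cons c C ih =>
    have h1 := heightT_time_le L R c
    simp only [clear, Timed.bind_time, tick_time, rLt, bAnd, crossT_time, List.length_cons, add_mul,
      one_mul]
    split_ifs
    · simp only [Timed.pure_time]
      omega
    · omega

theorem seesT_time_le (v w : Pt) : (seesT L R v w).time ≤ 36 * (L.length + R.length + 1) ^ 2 := by
  have h1 := heightT_time_le L R v
  have h2 := heightT_time_le L R w
  simp only [seesT, Timed.bind_time, rLe, bAnd]
  split_ifs
  · have h3 := clear_time_le L R v w (heightT L R v).val (heightT L R w).val L
    have h4 := clear_time_le L R w v (heightT L R v).val (heightT L R w).val R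
    simp only [Timed.bind_time]
    nlinarith
  · have h3 := clear_time_le L R w v (heightT L R w).val (heightT L R v).val L
    have h4 := clear_time_le L R v w (heightT L R w).val (heightT L R v).val R
    simp only [Timed.bind_time]
    nlinarith

theorem upsegLeft_time_le (i : ℕ) :
    (upsegLeft L R i).time ≤ 30 * (L.length + R.length + 1) := by
  have h1 := nth_time_le L i
  have h2 := nth_time_le L (i + 1)
  have h3 := hit_time_le (vtx L i) (vtx L (i + 1)) R
  have h4 := apexT_time_le L R
  simp only [upsegLeft, Timed.bind_time, len_time, nAdd, nLt]
  split_ifs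
  · simp only [Timed.bind_time, Timed.pure_time, nth_val]
    omega
  · simp only [Timed.bind_time, Timed.pure_time]
    omega

theorem upsegRight_time_le (j : ℕ) :
    (upsegRight L R j).time ≤ 30 * (L.length + R.length + 1) := by
  have h1 := nth_time_le R j
  have h2 := nth_time_le R (j + 1)
  have h3 := hit_time_le (vtx R j) (vtx R (j + 1)) L
  have h4 := apexT_time_le L R
  simp only [upsegRight, Timed.bind_time, len_time, nAdd, nLt]
  split_ifs
  · simp only [Timed.bind_time, Timed.pure_time, nth_val]
    omega
  · simp only [Timed.bind_time, Timed.pure_time]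
    omega

theorem upsegPair_time_le (i j : ℕ) :
    (upsegPair L R i j).time ≤ 120 * (L.length + R.length + 1) := by
  have h1 := upsegLeft_time_le L R i
  have h2 := upsegRight_time_le L R j
  have h3 := heightT_time_le L R (upsegLeft L R i).val.q
  have h4 := heightT_time_le L R (upsegLeft L R i).val.p
  have h5 := heightT_time_le L R (upsegRight L R j).val.q
  have h6 := heightT_time_le L R (upsegRight L R j).val.p
  have h7 := nth_time_le L i
  have h8 := nth_time_le L (i + 1)
  have h9 := nth_time_le R j
  have h10 := nth_time_le R (j + 1)
  simp only [upsegPair, Timed.bind_time, rLe, bAnd, nAdd]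
  generalize upsegLeft L R i = f at *
  generalize upsegRight L R j = g at *
  generalize heightT L R f.val.q = fq at *
  generalize heightT L R f.val.p = fp at *
  generalize heightT L R g.val.q = gq at *
  generalize heightT L R g.val.p = gp at *
  generalize decide (fq.val ≤ gq.val) = b₁
  generalize decide (gp.val ≤ fp.val) = b₂
  cases b₁ <;> cases b₂ <;>
    simp only [Bool.and_true, Bool.and_false, Bool.false_eq_true, if_true, if_false,
      Timed.bind_time, Timed.pure_time, meet_time] <;>
    linarith

theorem upseg_time_le (z : Node) : (upseg L R z).time ≤ 120 * (L.length + R.length + 1) := by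
  have h1 := nth_time_le L 0
  have h2 := nth_time_le R 0
  cases z with
  | left i => have := upsegLeft_time_le L R i; simp only [upseg]; omega
  | right j => have := upsegRight_time_le L R j; simp only [upseg]; omega
  | pair i j => exact upsegPair_time_le L R i j
  | source => simp only [upseg, Timed.bind_time, Timed.pure_time]; omega
  | sink => simp only [upseg, Timed.bind_time, Timed.pure_time]; omega

theorem seesFront_time_le (v : Pt) (s : Front) :
    (seesFront L R v s).time ≤ 110 * (L.length + R.length + 1) ^ 2 := by
  have h1 := seesT_time_le L R v s.q
  have h2 := seesT_time_le L R v s.t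
  have h3 := seesT_time_le L R v s.p
  have h4 : 1 ≤ (L.length + R.length + 1) ^ 2 := Nat.one_le_pow _ _ (by omega)
  simp only [seesFront, Timed.bind_time, bAnd]
  omega

theorem hasApex_time_le (s : Front) : (hasApex L s).time ≤ 10 * (L.length + R.length + 1) := by
  have h1 := apexT_time_le L R
  have h2 : ∀ a b, (ptEq a b).time = 3 := fun a b => rfl
  simp only [hasApex, Timed.bind_time, bOr, h2]
  omega

theorem topSeeing_time_le (C : List Pt) (hC : C.length ≤ L.length + R.length) (s : Front) (i : ℕ) :
    (topSeeing L R C s i).time ≤ 115 * (L.length + R.length + 1) ^ 2 := by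
  have h1 := nth_time_le C (i + 1)
  have h2 := seesFront_time_le L R (vtx C (i + 1)) s
  have h3 : L.length + R.length + 1 ≤ (L.length + R.length + 1) ^ 2 :=
    Nat.le_self_pow two_ne_zero _
  simp only [topSeeing, Timed.bind_time, len_time, nAdd, nLt]
  split_ifs
  · simp only [Timed.bind_time, nth_val]
    split_ifs <;> simp only [Timed.pure_time] <;> omega
  · simp only [Timed.pure_time]
    omega

theorem outNeighbours_time_le (t : Node) :
    (outNeighbours L R t).time ≤ 500 * (L.length + R.length + 1) ^ 2 := by
  set m := L.length + R.length + 1 with hm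
  have h0 : m ≤ m ^ 2 := Nat.le_self_pow two_ne_zero _
  have h1 := upseg_time_le L R t
  have h2 := fun p => heightT_time_le L R p
  have h3 : ∀ h, (lastNotAbove L R h L 0 0).time ≤ 10 * m ^ 2 := fun h =>
    (lastNotAbove_time_le L R h L 0 0).trans (by nlinarith)
  have h4 : ∀ h, (lastNotAbove L R h R 0 0).time ≤ 10 * m ^ 2 := fun h =>
    (lastNotAbove_time_le L R h R 0 0).trans (by nlinarith)
  have h5 : ∀ h, (lastBelow L R h L 0 0).time ≤ 10 * m ^ 2 := fun h =>
    (lastBelow_time_le L R h L 0 0).trans (by nlinarith)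
  have h6 : ∀ h, (lastBelow L R h R 0 0).time ≤ 10 * m ^ 2 := fun h =>
    (lastBelow_time_le L R h R 0 0).trans (by nlinarith)
  have h7 := fun s i => topSeeing_time_le L R L (by omega) s i
  have h8 := fun s i => topSeeing_time_le L R R (by omega) s i
  have h9 := fun i => upsegLeft_time_le L R i
  have h10 := fun i => upsegRight_time_le L R i
  rw [← hm] at h1 h2 h7 h8 h9 h10
  simp only [outNeighbours, Timed.bind_time, Timed.pure_time]
  set s := (upseg L R t).val
  have a1 := h2 s.q
  have a2 := h2 s.p
  have a3 := h3 (heightT L R s.q).val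
  have a4 := h4 (heightT L R s.p).val
  set i := (lastNotAbove L R (heightT L R s.q).val L 0 0).val
  set j := (lastNotAbove L R (heightT L R s.p).val R 0 0).val
  have a5 := h7 s i
  have a6 := h8 s j
  have a7 := h9 i
  have a8 := h10 j
  have a9 := h2 (upsegRight L R j).val.q
  have a10 := h2 (upsegLeft L R i).val.p
  have a11 := h5 (heightT L R (upsegRight L R j).val.q).val
  have a12 := h6 (heightT L R (upsegLeft L R i).val.p).val
  omega

theorem memNode_time_le (z : Node) (l : List Node) : (memNode z l).time ≤ 2 * l.length := by
  induction l with
  | nil => simp [memNode]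
  | cons a l ih =>
    simp only [memNode, Timed.bind_time, tick_time, nodeEq, List.length_cons]
    split_ifs
    · simp only [Timed.pure_time]; omega
    · omega

theorem takeAt_time_le (l : List Node) (n : ℕ) : (takeAt l n).time ≤ l.length := by
  induction l generalizing n with
  | nil => simp [takeAt]
  | cons a l ih =>
    cases n with
    | zero => simp [takeAt]
    | succ n =>
      have := ih n
      simp only [takeAt, Timed.bind_time, tick_time, Timed.pure_time, List.length_cons]
      omega

theorem addEdge_time_le (t z : Node) (w : ℕ) (σ : State) :
    (addEdge L R t z w σ).time ≤ 131 * (L.length + R.length + 1) + 2 * σ.known.length := by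
  have h1 := upseg_time_le L R z
  have h2 := hasApex_time_le L R (upseg L R z).val
  have h3 := memNode_time_le z σ.known
  simp only [addEdge, Timed.bind_time, tick_time]
  split_ifs <;> simp only [Timed.pure_time] <;> omega

theorem addEdges_time_le (t : Node) (zs : List (Node × ℕ)) (σ : State) :
    (addEdges L R t zs σ).time ≤
      zs.length * (131 * (L.length + R.length + 1) + 2 * (σ.known.length + zs.length)) := by
  induction zs generalizing σ with
  | nil => simp [addEdges]
  | cons x zs ih =>
    have h1 := ih (addEdge L R t x.1 x.2 σ).val
    have h2 := addEdge_time_le L R t x.1 x.2 σ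
    have h3 := (length_addEdge (L := L) (R := R) t x.1 x.2 σ).2
    have h4 : (addEdges L R t (x :: zs) σ).time = (addEdge L R t x.1 x.2 σ).time +
      (addEdges L R t zs (addEdge L R t x.1 x.2 σ).val).time := rfl
    have h5 : zs.length * (131 * (L.length + R.length + 1) +
        2 * ((addEdge L R t x.1 x.2 σ).val.known.length + zs.length)) ≤
        zs.length * (131 * (L.length + R.length + 1) + 2 * (σ.known.length + (zs.length + 1))) :=
      Nat.mul_le_mul_left _ (by omega)
    rw [h4, List.length_cons, add_mul, one_mul]
    omega

/-- The constant is `893 = 500 + 3 * 131`: the out-neighbours and the three edges added. -/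
theorem loopBody_time_le (n : ℕ) (σ : State) :
    (loopBody L R n σ).time ≤
      σ.work.length + 893 * (L.length + R.length + 1) ^ 2 + 6 * (σ.known.length + 3) := by
  have h1 := takeAt_time_le σ.work n
  have h2 := outNeighbours_time_le L R (takeAt σ.work n).val.1
  have h3 := addEdges_time_le L R (takeAt σ.work n).val.1
    (outNeighbours L R (takeAt σ.work n).val.1).val ⟨σ.edges, σ.known, (takeAt σ.work n).val.2⟩
  have h4 : (outNeighbours L R (takeAt σ.work n).val.1).val.length = 3 := rfl
  have h5 : L.length + R.length + 1 ≤ (L.length + R.length + 1) ^ 2 :=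
    Nat.le_self_pow two_ne_zero _
  rw [h4] at h3
  simp only [loopBody, Timed.bind_time]
  dsimp only at h3
  omega

/-- Induction on a bound `N` for the remaining iterations. `Q` bounds the list of known nodes
throughout, since an iteration lengthens it by at most three; it exceeds the length of the work list
as well. -/
theorem exists_loopRuns {L R : List Pt} {hF : IsFunnel L R} (pick : State → ℕ) {Q : ℕ} (N : ℕ)
    (σ : State) (hσ : LoopInv hF σ) (hN : remaining hF.frame σ ≤ N)
    (hQ : σ.known.length + 3 * N ≤ Q) :
    ∃ τ T, LoopRuns pick L R σ τ T ∧ LoopInv hF τ ∧ τ.work = [] ∧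
      τ.edges.length ≤ σ.edges.length + 6 * N ∧
      T ≤ 1 + N * (1 + (Q + 893 * (L.length + R.length + 1) ^ 2 + 6 * Q)) := by
  induction N generalizing σ with
  | zero =>
    have : σ.work = [] := by
      rw [← List.length_eq_zero_iff]
      simp only [remaining] at hN
      omega
    exact ⟨σ, 1, .done σ this, hσ, this, by omega, by omega⟩
  | succ N ih =>
    by_cases hw : σ.work = []
    · exact ⟨σ, 1, .done σ hw, hσ, hw, by omega, by omega⟩
    · have hn : pick σ % σ.work.length < σ.work.length :=
        Nat.mod_lt _ (List.length_pos_iff.2 hw)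
      set n := pick σ % σ.work.length with hn'
      have h1 := remaining_loopBody hσ hn
      have h2 := length_loopBody (L := L) (R := R) n σ
      have h3 := loopBody_time_le L R n σ
      obtain ⟨τ, T, hr, hτ, hτw, he, hT⟩ := ih (loopBody L R n σ).val (loopInv_step hσ hn)
        (by omega) (by omega)
      refine ⟨τ, _, .step σ τ T hw hr, hτ, hτw, by omega, ?_⟩
      rw [← hn', add_mul, one_mul]
      have : σ.work.length ≤ N + 1 := by simp only [remaining] at hN; omega
      omega

theorem lookup_time_le (z : Node) (labels : List Label) :
    (lookup z labels).time ≤ 2 * labels.length := by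
  induction labels with
  | nil => simp [lookup]
  | cons a l ih =>
    simp only [lookup, Timed.bind_time, tick_time, nodeEq, List.length_cons]
    split_ifs
    · simp only [Timed.pure_time]; omega
    · omega

theorem relax_time_le (e : Edge) (labels : List Label) :
    (relax e labels).time ≤ 4 * labels.length + 3 := by
  have h1 := lookup_time_le e.1 labels
  have h2 := lookup_time_le e.2.1 labels
  simp only [relax, Timed.bind_time, tick_time]
  rcases (lookup e.1 labels).val with - | ⟨d, path⟩
  · simp only [Timed.pure_time]; omega
  · simp only [Timed.bind_time, nAdd]
    rcases (lookup e.2.1 labels).val with - | ⟨d', path'⟩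
    · simp only [Timed.pure_time]; omega
    · simp only [Timed.bind_time, nLt]
      split_ifs <;> simp only [Timed.pure_time] <;> omega

theorem relaxAll_length_le (es : List Edge) (labels : List Label) :
    (relaxAll es labels).val.length ≤ labels.length + es.length := by
  induction es generalizing labels with
  | nil => exact le_rfl
  | cons e es ih =>
    have h1 := ih (relax e labels).val
    have h2 := (relax_length e labels).2
    rw [relaxAll_cons, List.length_cons]
    omega

theorem relaxAll_time_le (es : List Edge) (labels : List Label) {q : ℕ}
    (hq : labels.length + es.length ≤ q) : (relaxAll es labels).time ≤ es.length * (4 * q + 3) := by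
  induction es generalizing labels with
  | nil => simp [relaxAll]
  | cons e es ih =>
    have h0 := (relax_length e labels).2
    rw [List.length_cons] at hq
    have h1 := ih (relax e labels).val (by omega)
    have h2 := relax_time_le e labels
    have h3 : (relaxAll (e :: es) labels).time
      = (relax e labels).time + (relaxAll es (relax e labels).val).time := rfl
    rw [h3, List.length_cons, add_mul, one_mul]
    omega

theorem relaxRounds_length_le (es rounds : List Edge) (labels : List Label) :
    (relaxRounds es rounds labels).val.length ≤ labels.length + rounds.length * es.length := by
  induction rounds generalizing labels with
  | nil => simp [relaxRounds]
  | cons e rounds ih =>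
    have h1 := ih (relaxAll es labels).val
    have h2 := relaxAll_length_le es labels
    rw [relaxRounds_cons, List.length_cons, add_mul, one_mul]
    omega

theorem relaxRounds_time_le (es rounds : List Edge) (labels : List Label) {q : ℕ}
    (hq : labels.length + rounds.length * es.length ≤ q) :
    (relaxRounds es rounds labels).time ≤ rounds.length * (1 + es.length * (4 * q + 3)) := by
  induction rounds generalizing labels with
  | nil => simp [relaxRounds]
  | cons e rounds ih =>
    rw [List.length_cons, add_mul, one_mul] at hq
    have h0 := relaxAll_length_le es labels
    have h1 := ih (relaxAll es labels).val (by omega)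
    have h2 := relaxAll_time_le es labels (q := q) (by omega)
    have h3 : (relaxRounds es (e :: rounds) labels).time
      = 1 + ((relaxAll es labels).time + (relaxRounds es rounds (relaxAll es labels).val).time) := rfl
    rw [h3, List.length_cons, add_mul, one_mul]
    omega

theorem guardsOf_time_le (p : List Node) :
    (guardsOf L R p).time ≤ p.length * (L.length + R.length + 1) := by
  induction p with
  | nil => simp [guardsOf]
  | cons z p ih =>
    rw [List.length_cons, add_mul, one_mul]
    cases z with
    | source => simp only [guardsOf, Timed.bind_time, tick_time, Timed.pure_time]; omega
    | sink => simp only [guardsOf, Timed.bind_time, tick_time, Timed.pure_time]; omega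
    | left i =>
      have := nth_time_le L i
      simp only [guardsOf, Timed.bind_time, tick_time, Timed.pure_time]; omega
    | right j =>
      have := nth_time_le R j
      simp only [guardsOf, Timed.bind_time, tick_time, Timed.pure_time]; omega
    | pair i j =>
      have := nth_time_le L i
      have := nth_time_le R j
      simp only [guardsOf, Timed.bind_time, tick_time, Timed.pure_time]; omega

theorem shortestPathGuards_time_le (es : List Edge) {E : ℕ} (hE : es.length ≤ E) :
    (shortestPathGuards L R es).time ≤ E * (1 + E * (4 * (1 + E * E) + 3)) + 2 * (1 + E * E) +
      (1 + E * E) * (L.length + R.length + 1) := by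
  have hEE : es.length * es.length ≤ E * E := Nat.mul_le_mul hE hE
  have h1 := relaxRounds_time_le es es [(.source, 0, [])] (q := 1 + E * E) (by simpa using hEE)
  have h2 : (relaxRounds es es [(.source, 0, [])]).val.length ≤ 1 + E * E :=
    (relaxRounds_length_le es es [(.source, 0, [])]).trans (by simpa using hEE)
  have h3 := lookup_time_le .sink (relaxRounds es es [(.source, 0, [])]).val
  have h4 : es.length * (1 + es.length * (4 * (1 + E * E) + 3)) ≤
      E * (1 + E * (4 * (1 + E * E) + 3)) :=
    Nat.mul_le_mul hE (Nat.add_le_add_left (Nat.mul_le_mul_right _ hE) _)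
  simp only [shortestPathGuards, Timed.bind_time]
  rcases h5 : (lookup .sink (relaxRounds es es [(.source, 0, [])]).val).val with - | ⟨d, path⟩
  · simp only [Timed.pure_time]
    omega
  · have h6 := (relaxRounds_sound (labelsSound_init es) _ _ _ (lookup_mem h5)).2
    have h7 := guardsOf_time_le L R path
    have h8 : path.length * (L.length + R.length + 1) ≤ (1 + E * E) * (L.length + R.length + 1) :=
      Nat.mul_le_mul_right _ (by omega)
    dsimp only
    omega

end Time

/-- A bound for the running time, in terms of the number of input points. -/
def timeBound : Polynomial ℕ :=
  let m : Polynomial ℕ := Polynomial.X + 1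
  let E : Polynomial ℕ := 6 * m ^ 2
  -- The first summand makes the bound strict. There are at most `m ^ 2` iterations, `1 + 3 * m ^ 2`
  -- bounds the list of known nodes, and `E` bounds the number of edges, six per iteration.
  1 + (1 + m ^ 2 * (1 + ((1 + 3 * m ^ 2) + 893 * m ^ 2 + 6 * (1 + 3 * m ^ 2)))) +
    (E * (1 + E * (4 * (1 + E * E) + 3)) + 2 * (1 + E * E) + (1 + E * E) * m)

theorem timeBound_eval (n : ℕ) :
    timeBound.eval n =
      1 + (1 + (n + 1) ^ 2 * (1 + ((1 + 3 * (n + 1) ^ 2) + 893 * (n + 1) ^ 2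
        + 6 * (1 + 3 * (n + 1) ^ 2)))) +
      (6 * (n + 1) ^ 2 * (1 + 6 * (n + 1) ^ 2 *
        (4 * (1 + 6 * (n + 1) ^ 2 * (6 * (n + 1) ^ 2)) + 3)) +
        2 * (1 + 6 * (n + 1) ^ 2 * (6 * (n + 1) ^ 2)) +
        (1 + 6 * (n + 1) ^ 2 * (6 * (n + 1) ^ 2)) * (n + 1)) := by
  simp [timeBound]

end FunnelGuarding

end

/-- The number of operations is bounded by a polynomial in the number of input points, and the
output is a feasible vertex guard set. It has minimum size if no vertex other than the apex lies on
the line through an edge of the opposite chain. -/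
theorem mainTheorem1 :
    ∃ P : Polynomial ℕ, ∀ L R : List FunnelGuarding.Pt, FunnelGuarding.IsFunnel L R →
      ∀ pick : FunnelGuarding.State → ℕ, ∃ (out : List FunnelGuarding.Pt) (T : ℕ),
        FunnelGuarding.AlgorithmRuns pick L R out T ∧
        T < P.eval (L.length + R.length) ∧
        FunnelGuarding.IsVertexGuardSet L R out.toFinset ∧
        (FunnelGuarding.OppositeEdgesAvoidVertices L R →
          ∀ D : Finset FunnelGuarding.Pt, FunnelGuarding.IsVertexGuardSet L R D →
            out.toFinset.card ≤ D.card) := by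
  refine ⟨FunnelGuarding.timeBound, fun L R hF pick => ?_⟩
  have hK := hF.frame_K
  have hM := hF.frame_M
  have hrem : FunnelGuarding.remaining hF.frame FunnelGuarding.initState
      ≤ (L.length + R.length + 1) ^ 2 := by
    have h1 := FunnelGuarding.card_validNodes hF.frame
    rw [show hF.frame.K + hF.frame.M + 3 = L.length + R.length + 1 by omega] at h1
    -- The source is known from the start, so its removal from the unknown nodes compensates for its
    -- place in the work list.
    have h2 : FunnelGuarding.validNodes hF.frame \ {FunnelGuarding.Node.source}
        ⊂ FunnelGuarding.validNodes hF.frame :=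
      Finset.sdiff_ssubset (Finset.singleton_subset_iff.2
        (FunnelGuarding.mem_validNodes (z := .source) trivial)) (Finset.singleton_nonempty _)
    have h3 := Finset.card_lt_card h2
    simp only [FunnelGuarding.remaining, FunnelGuarding.initState, List.length_singleton,
      List.toFinset_cons, List.toFinset_nil, insert_empty_eq]
    omega
  obtain ⟨σ, T, hrun, hσ, hw, hE, hT⟩ := FunnelGuarding.exists_loopRuns pick
    (Q := 1 + 3 * (L.length + R.length + 1) ^ 2) _ FunnelGuarding.initState
    (FunnelGuarding.loopInv_init hF) hrem le_rfl
  refine ⟨_, _, ⟨σ, T, hrun, rfl, rfl⟩, ?_, FunnelGuarding.output_isVertexGuardSet hσ hw,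
    fun hgp D hD => FunnelGuarding.output_card_le hσ hw hgp hD⟩
  have hE' : σ.edges.length ≤ 6 * (L.length + R.length + 1) ^ 2 := by
    simpa [FunnelGuarding.initState] using hE
  have h1 := FunnelGuarding.shortestPathGuards_time_le L R σ.edges hE'
  rw [FunnelGuarding.timeBound_eval]
  omega
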